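/- **Setting.** Let $T>0$, $H>\frac12$, $H_-:=H-\frac12$, $H_+:=H+\frac12$, let $B$ be a one-dimensional Brownian motion under $\mathbb P$, and consider the model $X_t=x_0+\int_0^t (t-r)^{H_-}V(X_r)\circ dB_r$ with payoff $G(X_T)$, where $G\in C^5(\mathbb R)$, $V\in C^4(\mathbb R)$. For $n\ge1$ put $\mathbb T_n=\{0\le t_n\le\dots\le t_1\le T\}$, $t_0:=T$, $\mathcal S_n=\{\vec\kappa=(\kappa_1,\dots,\kappa_n):\kappa_l\in\{0,\dots,l-1\}\}$, and $$\mathcal K(\vec\kappa;\vec t\,)=\prod_{l=1}^n (t_{\kappa_l}-t_l)^{H_-},\qquad \mathcal V_0(\vec\kappa;x)=G^{(N_0(\vec\kappa))}(x)\prod_{\alpha=1}^n V^{(N_\alpha(\vec\kappa))}(x),\qquad N_\alpha(\vec\kappa)=\#\{l:\kappa_l=\alpha\}.$$ Let $\mathbb V_5=\{\mathcal V_0(\vec\kappa;\cdot):\vec\kappa\in\mathcal S_n,\ 1\le n\le5\}$ and, for $\phi\in\mathbb V_5$, $$\Gamma^\phi_5=\sum_{n=1}^5\sum_{\vec\kappa\in\mathcal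 S_n}\mathbf 1_{\{\mathcal V_0(\vec\kappa;\cdot)=\phi\}}\int_{\mathbb T_n}\mathcal K(\vec\kappa;\vec t\,)\circ dB_{t_n}\cdots\circ dB_{t_1}.$$ The multiple Stratonovich integrals are the limits in mean square, as the mesh of the partition of $[0,T]$ tends to $0$, of the integrals along the polygonal interpolations of $B$. Let $s_l=\frac{lT}{4}$, $\lambda_1,\lambda_2>0$, $a_{k,l}\in\mathbb R$ ($k=1,2$; $l=1,\dots,4$). Let $\omega_k$ ($k=1,2$) be the continuous path with $\omega_k(0)=0$ and slope $a_{k,l}/\sqrt T$ on $[s_{l-1},s_l]$, let $\omega_{k+2}=-\omega_k$, $\lambda_{k+2}=\lambda_k$, and $Q=\sum_{k=1}^4\lambda_k\delta_{\omega_k}$. Write $\mathbb E^Q[\Gamma^\phi_5]=\sum_{k=1}^4\lambda_k\Gamma^\phi_5(\omega_k)$, where $\Gamma^\phi_5(\omega)$ is $\Gamma^\phi_5$ with $\circ dB$ replaced by $d\omega$. We say that $Q$ is a *5-Volterra cubature formula* on $[0,T]$ if $\sum_{k=1}^4\lambda_k=1$ and $\mathbb E^Q[\Gamma_5^\phi]=\mathbb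 E[\Gamma_5^\phi]$ for all $\phi\in\mathbb V_5$. **Constants.** Let $\Gamma(\alpha,\beta)=\int_0^1(1-t)^{\alpha-1}t^{\beta-1}dt$ and $$c(l,l)=\int_{s_{l-1}}^{s_l}\!\int_{s_{l-1}}^{t_1}[(T-t_1)(t_1-t_2)]^{H_-}dt_2dt_1,\qquad c(l_1,l_2)=\int_{s_{l_1-1}}^{s_{l_1}}\!\int_{s_{l_2-1}}^{s_{l_2}}[(T-t_1)(t_1-t_2)]^{H_-}dt_2dt_1\quad(l_1>l_2),$$ $$c(\vec\kappa,\vec l\,)=\int_{s_{l_1-1}}^{s_{l_1}}\int_{s_{l_2-1}}^{s_{l_2}\wedge t_1}\int_{s_{l_3-1}}^{s_{l_3}\wedge t_2}\int_{s_{l_4-1}}^{s_{l_4}\wedge t_3}\mathcal K(\vec\kappa;\vec t\,)\,dt_4dt_3dt_2dt_1\qquad(\vec\kappa\in\mathcal S_4,\ l_4\le l_3\le l_2\le l_1).$$ Let $\mathcal S_4=\bigcup_{\alpha=1}^7\mathcal S_{4,\alpha}$ be the partition - $\mathcal S_{4,1}=\{(0,0,0,0)\}$, $\mathcal S_{4,5}=\{(0,1,1,1)\}$,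 $\mathcal S_{4,7}=\{(0,1,2,3)\}$, - $\mathcal S_{4,2}=\{(0,0,0,1),(0,0,1,0),(0,1,0,0),(0,0,0,2),(0,0,2,0),(0,0,0,3)\}$, - $\mathcal S_{4,3}=\{(0,0,1,1),(0,1,0,1),(0,1,1,0),(0,0,2,2)\}$, - $\mathcal S_{4,4}=\{(0,0,1,2),(0,0,2,1),(0,0,1,3),(0,0,2,3),(0,1,0,2),(0,1,2,0),(0,1,0,3)\}$, - $\mathcal S_{4,6}=\{(0,1,1,2),(0,1,2,1),(0,1,2,2),(0,1,1,3)\}$, whose classes correspond to $\phi_1=G^{(4)}V^4$, $\phi_2=G^{(3)}V'V^3$, $\phi_3=G''V''V^3$, $\phi_4=G''(V')^2V^2$, $\phi_5=G'V^{(3)}V^3$, $\phi_6=G'V''V'V^2$, $\phi_7=G'(V')^3V$, and let $$\gamma^{\phi_1}_4=\frac{T^{4H}}{32H^2},\quad \gamma^{\phi_2}_4=\frac{T^{4H}}{4H}\Gamma(2H,H_+),\quad \gamma^{\phi_3}_4=\gamma^{\phi_4}_4=\frac{T^{4H}}{4H}\Gamma(2H,2H_+),\quad \gamma^{\phi_5}_4=\gamma^{\phi_6}_4=\gamma^{\phi_7}_4=0.$$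 **Theorem.** All the multiple Stratonovich integrals above exist. If the nine functions $G''V^2$, $G'V'V$, $\phi_1,\dots,\phi_7$ are pairwise distinct, then $Q$ is a 5-Volterra cubature formula on $[0,T]$ if and only if the following ten polynomial equations hold: $$\lambda_1+\lambda_2=\tfrac12,$$ $$\frac1{H_+^2T}\sum_{k=1}^2\lambda_k\Big[\sum_{l=1}^4\big[(T-s_{l-1})^{H_+}-(T-s_l)^{H_+}\big]a_{k,l}\Big]^2=\frac{T^{2H}}{4H},$$ $$\sum_{k=1}^2\lambda_k\sum_{1\le l_2\le l_1\le4}c(l_1,l_2)\,a_{k,l_1}a_{k,l_2}=0,$$ $$\frac2{T^2}\sum_{1\le l_4\le l_3\le l_2\le l_1\le4}\ \sum_{\vec\kappa\in\mathcal S_{4,\alpha}}\sum_{k=1}^2\lambda_k\,c(\vec\kappa,\vec l\,)\,a_{k,l_1}a_{k,l_2}a_{k,l_3}a_{k,l_4}=\gamma_4^{\phi_\alpha},\qquad\alpha=1,\dots,7.$$ Without the distinctness assumption, the ten equations still imply that $Q$ is a 5-Volterra cubature formula. -/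

import Mathlib

open MeasureTheory ProbabilityTheory
open scoped ENNReal NNReal

noncomputable section

namespace VolterraCubature

/-! ### Indices, kernels and Taylor coefficients of the one-dimensional model
`X_t = x₀ + ∫₀ᵗ (t - r)^(H - 1/2) V(X_r) ∘ dB_r` -/

/-- The index set `𝒮_n` of all `κ = (κ_1, …, κ_n)` with `κ_l ∈ {0, 1, …, l - 1}`.
The entry `κ_l` of the text is `κ l` at the zero-based position `l - 1`. -/
abbrev VIndex (n : ℕ) : Type := (l : Fin n) → Fin (l.val + 1)

/-- The simplex `𝕋_n = {(t_1, …, t_n) : 0 ≤ t_n ≤ … ≤ t_1 ≤ T}`. -/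
def simplex (T : ℝ) (n : ℕ) : Set (Fin n → ℝ) :=
  {t | Antitone t ∧ ∀ l, t l ∈ Set.Icc 0 T}

/-- The kernel `𝒦(κ; t) = ∏_l (t_{κ_l} - t_l)^(H - 1/2)`, where `t_0 = T`.
(`Matrix.vecCons T t` is the tuple `(t_0, t_1, …, t_n)`.) -/
def kernel (H T : ℝ) {n : ℕ} (κ : VIndex n) (t : Fin n → ℝ) : ℝ :=
  ∏ l : Fin n,
    (Matrix.vecCons T t (Fin.castLE (Nat.succ_le_succ l.isLt.le) (κ l)) - t l) ^ (H - 1 / 2)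

/-- `|𝒩_α(κ)|`, the number of `l` with `κ_l = α`. -/
def occ {n : ℕ} (κ : VIndex n) (α : ℕ) : ℕ :=
  (Finset.univ.filter fun l : Fin n => (κ l).val = α).card

/-- The coefficient function
`𝒱₀(κ; x) = G^(|𝒩_0(κ)|)(x) · ∏_{α = 1}^n V^(|𝒩_α(κ)|)(x)`. -/
def coeff (G V : ℝ → ℝ) {n : ℕ} (κ : VIndex n) (x : ℝ) : ℝ :=
  iteratedDeriv (occ κ 0) G x * ∏ α ∈ Finset.Icc 1 n, iteratedDeriv (occ κ α) V x

/-- `∑_{n=1}^N ∑_{κ ∈ 𝒮_n} 1_{𝒱₀(κ; ·) = φ} I(κ)`: all terms `I(κ)` whose coefficient function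
is `φ` are collected. -/
def collect (N : ℕ) (G V φ : ℝ → ℝ) (I : (n : ℕ) → VIndex n → ℝ) : ℝ :=
  open Classical in
  ∑ n ∈ Finset.Icc 1 N, ∑ κ : VIndex n, if coeff G V κ = φ then I n κ else 0

/-- The set `𝕍_N` of all coefficient functions `𝒱₀(κ; ·)`, `κ ∈ 𝒮_n`, `1 ≤ n ≤ N`. -/
def coeffSet (N : ℕ) (G V : ℝ → ℝ) : Set (ℝ → ℝ) :=
  {φ | ∃ n ∈ Finset.Icc 1 N, ∃ κ : VIndex n, coeff G V κ = φ}

/-! ### Piecewise linear paths and integrals along them -/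

/-- The continuous path that starts at `0` and has slope `v i` on `[s i, s (i + 1)]`, `i < m`
(for `0 = s 0 ≤ s 1 ≤ … ≤ s m`, on the time interval `[0, s m]`). -/
def pwLinear {m : ℕ} (s : ℕ → ℝ) (v : Fin m → ℝ) (t : ℝ) : ℝ :=
  ∑ i : Fin m, v i * (min t (s (i.val + 1)) - min t (s i.val))

/-- `∫_{𝕋_n} φ(t) dω_{t_n} ⋯ dω_{t_1}` along a piecewise linear path `ω`, that is,
the Lebesgue integral of `φ(t) ω'(t_1) ⋯ ω'(t_n)`. -/
def pathIntegral (T : ℝ) {n : ℕ} (φ : (Fin n → ℝ) → ℝ) (ω : ℝ → ℝ) : ℝ :=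
  ∫ t in simplex T n, φ t * ∏ l : Fin n, deriv ω (t l)

/-! ### Multiple Stratonovich integrals with respect to Brownian motion -/

/-- `s 0 < s 1 < … < s m` is a partition of `[0, T]`. -/
def IsPartition (T : ℝ) (m : ℕ) (s : ℕ → ℝ) : Prop :=
  s 0 = 0 ∧ s m = T ∧ ∀ i < m, s i < s (i + 1)

/-- The polygonal interpolation of a path `b` (with `b 0 = 0`) along the partition `s`. -/
def polygon (m : ℕ) (s : ℕ → ℝ) (b : ℝ≥0 → ℝ) : ℝ → ℝ :=
  pwLinear s fun i : Fin m =>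
    (b (s (i.val + 1)).toNNReal - b (s i.val).toNNReal) / (s (i.val + 1) - s i.val)

/-- `S` is the multiple Stratonovich integral `∫_{𝕋_n} φ(t) ∘ dB_{t_n} ⋯ ∘ dB_{t_1}`: it is the
limit in mean square of the integrals along the polygonal interpolations of `B`, as the mesh of
the partition of `[0, T]` tends to `0`. -/
def IsStratonovichIntegral {Ω : Type*} [MeasurableSpace Ω] (P : Measure Ω) (B : ℝ≥0 → Ω → ℝ)
    (T : ℝ) {n : ℕ} (φ : (Fin n → ℝ) → ℝ) (S : Ω → ℝ) : Prop :=
  MemLp S 2 P ∧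
    ∀ ε : ℝ≥0∞, 0 < ε → ∃ δ : ℝ, 0 < δ ∧ ∀ (m : ℕ) (s : ℕ → ℝ), IsPartition T m s →
      (∀ i < m, s (i + 1) - s i < δ) →
        eLpNorm (fun ω => pathIntegral T φ (polygon m s fun t => B t ω) - S ω) 2 P ≤ ε

/-- The multiple Stratonovich integral `∫_{𝕋_n} φ(t) ∘ dB_{t_n} ⋯ ∘ dB_{t_1}` as a random
variable (unique up to null sets; `0` if it does not exist). -/
def stratonovich {Ω : Type*} [MeasurableSpace Ω] (P : Measure Ω) (B : ℝ≥0 → Ω → ℝ)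
    (T : ℝ) {n : ℕ} (φ : (Fin n → ℝ) → ℝ) : Ω → ℝ :=
  open Classical in
  if h : ∃ S : Ω → ℝ, IsStratonovichIntegral P B T φ S then h.choose else 0

/-! ### The discrete measure `Q` and cubature formulas -/

/-- The grid points `s_l = l T / L`. -/
def grid (T : ℝ) (L l : ℕ) : ℝ := l * T / L

/-- The weights `λ_1, …, λ_{2W}` of `Q`, with `λ_{W + k} = λ_k`. -/
def weights {W : ℕ} (lam : Fin W → ℝ) : Fin (W + W) → ℝ := Fin.append lam lam

/-- The paths `ω_1, …, ω_{2W}` charged by `Q`: for `k ≤ W` the path `ω_k` starts at `0` and has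
slope `a_{k,l} / √T` on `[s_{l-1}, s_l]`, `1 ≤ l ≤ L`; moreover `ω_{W + k} = -ω_k`. -/
def paths (T : ℝ) {W L : ℕ} (a : Fin W → Fin L → ℝ) : Fin (W + W) → ℝ → ℝ :=
  Fin.append (fun k => pwLinear (grid T L) fun l => a k l / √T)
    (fun k => -pwLinear (grid T L) fun l => a k l / √T)

/-- `Q = ∑_{k=1}^{2W} λ_k δ_{ω_k}` is a probability measure with positive weights, and it is an
`N`-Volterra cubature formula on `[0, T]`: `E^Q[Γ^φ_N] = E[Γ^φ_N]` for all `φ ∈ 𝕍_N`. -/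
structure IsVolterraCubature {Ω : Type*} [MeasurableSpace Ω] (P : Measure Ω) (B : ℝ≥0 → Ω → ℝ)
    (H T : ℝ) (G V : ℝ → ℝ) (N : ℕ) {W L : ℕ} (lam : Fin W → ℝ) (a : Fin W → Fin L → ℝ) :
    Prop where
  pos : ∀ k, 0 < weights lam k
  sum_eq_one : ∑ k, weights lam k = 1
  moments : ∀ φ ∈ coeffSet N G V,
    ∑ k, weights lam k *
        collect N G V φ (fun _ κ => pathIntegral T (kernel H T κ) (paths T a k)) =
      ∫ ω, collect N G V φ (fun _ κ => stratonovich P B T (kernel H T κ) ω) ∂P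

/-! ### The polynomial system for `W = 2`, `L = 4`, `N = 5` -/

/-- `c(l₁, l₂)`, `l₂ ≤ l₁`, with zero-based positions `l₁, l₂`. -/
def c2 (H T : ℝ) (l₁ l₂ : Fin 4) : ℝ :=
  if l₁ = l₂ then
    ∫ t₁ in grid T 4 l₁..grid T 4 (l₁.val + 1), ∫ t₂ in grid T 4 l₁..t₁,
      ((T - t₁) * (t₁ - t₂)) ^ (H - 1 / 2)
  else
    ∫ t₁ in grid T 4 l₁..grid T 4 (l₁.val + 1), ∫ t₂ in grid T 4 l₂..grid T 4 (l₂.val + 1),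
      ((T - t₁) * (t₁ - t₂)) ^ (H - 1 / 2)

/-- `c(κ, l)` for `κ ∈ 𝒮_4` and `l_4 ≤ l_3 ≤ l_2 ≤ l_1`, with zero-based positions. -/
def c4 (H T : ℝ) (κ : VIndex 4) (l : Fin 4 → Fin 4) : ℝ :=
  ∫ t₁ in grid T 4 (l 0)..grid T 4 ((l 0).val + 1),
    ∫ t₂ in grid T 4 (l 1)..min (grid T 4 ((l 1).val + 1)) t₁,
      ∫ t₃ in grid T 4 (l 2)..min (grid T 4 ((l 2).val + 1)) t₂,
        ∫ t₄ in grid T 4 (l 3)..min (grid T 4 ((l 3).val + 1)) t₃,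
          kernel H T κ ![t₁, t₂, t₃, t₄]

/-- The partition `𝒮_4 = ⋃_{α=1}^7 𝒮_{4,α}` (with `α - 1` in place of `α`). -/
def classList : Fin 7 → List (Fin 4 → ℕ) :=
  ![[![0, 0, 0, 0]],
    [![0, 0, 0, 1], ![0, 0, 1, 0], ![0, 1, 0, 0], ![0, 0, 0, 2], ![0, 0, 2, 0], ![0, 0, 0, 3]],
    [![0, 0, 1, 1], ![0, 1, 0, 1], ![0, 1, 1, 0], ![0, 0, 2, 2]],
    [![0, 0, 1, 2], ![0, 0, 2, 1], ![0, 0, 1, 3], ![0, 0, 2, 3], ![0, 1, 0, 2], ![0, 1, 2, 0],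
      ![0, 1, 0, 3]],
    [![0, 1, 1, 1]],
    [![0, 1, 1, 2], ![0, 1, 2, 1], ![0, 1, 2, 2], ![0, 1, 1, 3]],
    [![0, 1, 2, 3]]]

/-- The set `𝒮_{4,α}`. -/
def S4 (α : Fin 7) : Finset (VIndex 4) :=
  Finset.univ.filter fun κ => (fun l => (κ l).val) ∈ classList α

/-- The constants `γ^{φ_α}_4`; here `beta a b = ∫₀¹ (1 - t)^(a - 1) t^(b - 1) dt`. -/
def gam (H T : ℝ) : Fin 7 → ℝ :=
  ![T ^ (4 * H) / (32 * H ^ 2),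
    T ^ (4 * H) / (4 * H) * beta (2 * H) (H + 1 / 2),
    T ^ (4 * H) / (4 * H) * beta (2 * H) (2 * (H + 1 / 2)),
    T ^ (4 * H) / (4 * H) * beta (2 * H) (2 * (H + 1 / 2)),
    0, 0, 0]

/-- The system of ten polynomial equations in `λ_k`, `a_{k,l}`, `k = 1, 2`, `l = 1, 2, 3, 4`. -/
structure CubatureEquations (H T : ℝ) (lam : Fin 2 → ℝ) (a : Fin 2 → Fin 4 → ℝ) : Prop where
  mass : lam 0 + lam 1 = 1 / 2
  second : 1 / ((H + 1 / 2) ^ 2 * T) *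
      ∑ k, lam k * (∑ l : Fin 4,
        ((T - grid T 4 l) ^ (H + 1 / 2) - (T - grid T 4 (l.val + 1)) ^ (H + 1 / 2)) * a k l) ^ 2 =
      T ^ (2 * H) / (4 * H)
  third : ∑ k, lam k * ∑ l₁ : Fin 4, ∑ l₂ ∈ Finset.univ.filter (fun l₂ : Fin 4 => l₂ ≤ l₁),
      c2 H T l₁ l₂ * a k l₁ * a k l₂ = 0
  fourth : ∀ α : Fin 7,
      2 / T ^ 2 * ∑ l ∈ Finset.univ.filter
          (fun l : Fin 4 → Fin 4 => l 3 ≤ l 2 ∧ l 2 ≤ l 1 ∧ l 1 ≤ l 0),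
        ∑ κ ∈ S4 α, ∑ k, lam k * c4 H T κ l * a k (l 0) * a k (l 1) * a k (l 2) * a k (l 3) =
      gam H T α

/-- The nine coefficient functions `G'' V²`, `G' V' V` and `φ_1, …, φ_7` that belong to
`n = 2` and `n = 4`. -/
def evenCoeffs (G V : ℝ → ℝ) : Fin 9 → ℝ → ℝ :=
  ![fun x => iteratedDeriv 2 G x * V x ^ 2,
    fun x => iteratedDeriv 1 G x * iteratedDeriv 1 V x * V x,
    fun x => iteratedDeriv 4 G x * V x ^ 4,
    fun x => iteratedDeriv 3 G x * iteratedDeriv 1 V x * V x ^ 3,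
    fun x => iteratedDeriv 2 G x * iteratedDeriv 2 V x * V x ^ 3,
    fun x => iteratedDeriv 2 G x * iteratedDeriv 1 V x ^ 2 * V x ^ 2,
    fun x => iteratedDeriv 1 G x * iteratedDeriv 3 V x * V x ^ 3,
    fun x => iteratedDeriv 1 G x * iteratedDeriv 2 V x * iteratedDeriv 1 V x * V x ^ 2,
    fun x => iteratedDeriv 1 G x * iteratedDeriv 1 V x ^ 3 * V x]

end VolterraCubature

end

open VolterraCubature

namespace VolterraCubature

/-! ### Isserlis' formula -/

/-! Both sides of the moment condition are linear in the iterated integrals, so only the difference,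
index by index, between the expectation under `Q` and that of the Stratonovich integral matters
(`defect`). For odd `n` it is zero: the paths of `Q` come in pairs `ω`, `-ω`, and centred Gaussian
families have no odd mixed moments. For `n = 2` and `n = 4` the indices fall into `2 + 7` classes on
which the coefficient function is constant, and the sum of the defect over a class is, up to a
nonzero factor, left side minus right side of one of the nine equations other than the mass
equation. Hence the equations kill every collected sum; conversely, if the nine functions are
distinct, testing with one of them isolates its class.

The substance is the existence and the expectation of Stratonovich integrals of a continuous `φ`.
Along a polygonal path the integral is a multilinear form in the difference quotients of `B`, with
the integrals of `φ` over simplex ∩ box as coefficients. The covariance of two quotients is the `L²`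
product of the uniform densities of their intervals. Isserlis' formula therefore writes the
expectation of a product of two forms as a sum over pairings of integrals of two step functions,
evaluated where paired arguments coincide (`integral_form_mul_form`). The step function at a point
is the average of `φ · 1_simplex` over the box around it. As the mesh tends to zero this average
tends to `φ` times the proportion of the cube that breaks ties in the right order
(`tendsto_step_coef`). So the mixed moments converge when two partitions are refined separately, and
in a Hilbert space this is the Cauchy property (`exists_tendsto_of_tendsto_inner`).

The same limit with second factor `1` gives the expectation. Only pairings of neighbours respect the
order of the simplex, which leaves `1/2 ∫ φ(x, x)` and `1/4 ∫∫ φ(x, x, y, y)`. For a Volterra kernel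
these are zero, since `0` raised to `H - 1/2 > 0` is `0`, or they are power and beta integrals. On
the side of `Q` the slopes are constant on four cells, so the integrals are finite sums over
decreasing multi-indices. -/

lemma sum_neg_one_pow_card_compl_of_range_subset {α ι : Type*} [Fintype α] [Fintype ι]
    [DecidableEq ι] (g : α → ι) :
    ∑ S : Finset ι, (-1 : ℝ) ^ (Sᶜ).card * (if ∀ a, g a ∈ S then 1 else 0) =
      if Function.Surjective g then 1 else 0 := by
  classical
  have h1 : ∑ S : Finset ι, (-1 : ℝ) ^ (Sᶜ).card * (if ∀ a, g a ∈ S then 1 else 0) =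
      ∑ U : Finset ι, (-1 : ℝ) ^ U.card * (if ∀ a, g a ∉ U then 1 else 0) := by
    refine Fintype.sum_equiv (Equiv.ofBijective _ (compl_bijective (α := Finset ι))) _ _ ?_
    intro S
    simp
  have h2 : ∑ U : Finset ι, (-1 : ℝ) ^ U.card * (if ∀ a, g a ∉ U then 1 else 0) =
      ∑ U ∈ ((Finset.univ.image g)ᶜ).powerset, (-1 : ℝ) ^ U.card := by
    simp_rw [mul_ite, mul_one, mul_zero]
    rw [← Finset.sum_filter]
    refine Finset.sum_congr ?_ fun _ _ => rfl
    ext U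
    simp only [Finset.mem_filter, Finset.mem_univ, true_and, Finset.mem_powerset,
      Finset.subset_iff, Finset.mem_compl, Finset.mem_image, not_exists]
    exact ⟨fun h x hx a ha => h a (ha ▸ hx), fun h a ha => h ha a rfl⟩
  have h3 := congrArg (fun z : ℤ => (z : ℝ))
    (Finset.sum_powerset_neg_one_pow_card (x := (Finset.univ.image g)ᶜ))
  push_cast at h3
  rw [h1, h2, h3]
  congr 1
  rw [Finset.compl_eq_empty_iff, Finset.eq_univ_iff_forall]
  simp [Function.Surjective]

/-- Inclusion–exclusion over the possible ranges leaves only surjective `g`, and surjections between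
finite sets of equal size are bijections. This is the polarisation identity: the alternating sum
extracts the multilinear part of a power. -/
lemma sum_neg_one_pow_card_compl_mul_sum {α ι : Type*} [Fintype α] [Fintype ι]
    [DecidableEq ι] [DecidableEq α] (hc : Fintype.card α = Fintype.card ι) (w : (α → ι) → ℝ) :
    ∑ S : Finset ι, (-1 : ℝ) ^ (Sᶜ).card * (∑ g : α → ι, if ∀ a, g a ∈ S then w g else 0) =
      ∑ e : α ≃ ι, w e := by
  classical
  simp_rw [Finset.mul_sum]
  rw [Finset.sum_comm]
  have h1 : ∀ g : α → ι, ∑ S : Finset ι, (-1 : ℝ) ^ (Sᶜ).card *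
      (if ∀ a, g a ∈ S then w g else 0) = if Function.Surjective g then w g else 0 := by
    intro g
    have := congrArg (· * w g) (sum_neg_one_pow_card_compl_of_range_subset g)
    simp only [Finset.sum_mul] at this
    rw [ite_mul, one_mul, zero_mul] at this
    rw [← this]
    refine Finset.sum_congr rfl fun S _ => ?_
    split_ifs <;> simp
  simp_rw [h1]
  rw [← Finset.sum_filter]
  symm
  refine Finset.sum_bij (fun e _ => (e : α → ι)) ?_ ?_ ?_ ?_
  · intro e _
    simpa using e.surjective
  · intro e _ e' _ h
    exact DFunLike.coe_injective h
  · intro g hg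
    have hs : Function.Surjective g := by simpa using hg
    exact ⟨Equiv.ofBijective g ((Fintype.bijective_iff_surjective_and_card g).2 ⟨hs, hc⟩),
      Finset.mem_univ _, rfl⟩
  · intro _ _
    rfl

lemma sum_ite_mem_pow {ι : Type*} [Fintype ι] [DecidableEq ι] (α : Type*) [Fintype α]
    [DecidableEq α] (S : Finset ι) (x : ι → ℝ) :
    (∑ i ∈ S, x i) ^ Fintype.card α =
      ∑ g : α → ι, if ∀ a, g a ∈ S then ∏ a, x (g a) else 0 := by
  rw [← Finset.card_univ, ← Finset.prod_const, Finset.prod_univ_sum, ← Finset.sum_filter]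
  refine Finset.sum_congr ?_ fun _ _ => rfl
  ext g
  simp

lemma sum_sum_pow {ι : Type*} [Fintype ι] [DecidableEq ι] (k : ℕ) (S : Finset ι)
    (C : ι → ι → ℝ) :
    (∑ i ∈ S, ∑ j ∈ S, C i j) ^ k =
      ∑ g : Fin k × Bool → ι,
        if ∀ a, g a ∈ S then ∏ j, C (g (j, false)) (g (j, true)) else 0 := by
  have h1 : ∑ i ∈ S, ∑ j ∈ S, C i j =
      ∑ h : Bool → ι, if ∀ b, h b ∈ S then C (h false) (h true) else 0 := by
    rw [← Finset.sum_product', ← Finset.sum_filter]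
    refine Finset.sum_bij' (fun p _ b => if b then p.2 else p.1) (fun h _ => (h false, h true))
      ?_ ?_ ?_ ?_ ?_
    · rintro ⟨a, b⟩ h
      simpa [Bool.forall_bool] using h
    · intro h hh
      simpa [Bool.forall_bool] using hh
    · rintro ⟨a, b⟩ h
      rfl
    · intro h hh
      ext b
      cases b <;> rfl
    · rintro ⟨a, b⟩ h
      rfl
  have h2 := Finset.prod_univ_sum (ι := Fin k) (fun _ => (Finset.univ : Finset (Bool → ι)))
    (fun _ h => if ∀ b, h b ∈ S then C (h false) (h true) else 0)
  rw [Finset.prod_const, Finset.card_univ, Fintype.card_fin] at h2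
  rw [h1, h2, Fintype.piFinset_univ]
  symm
  refine Fintype.sum_equiv (Equiv.curry _ _ _) _ _ ?_
  intro g
  by_cases h : ∀ a, g a ∈ S
  · rw [if_pos h]
    refine Finset.prod_congr rfl fun j _ => ?_
    exact (if_pos fun b => h (j, b)).symm
  · rw [if_neg h]
    push Not at h
    obtain ⟨⟨j, b⟩, hj⟩ := h
    symm
    refine Finset.prod_eq_zero (Finset.mem_univ j) ?_
    rw [if_neg]
    intro h
    exact hj (h b)

/-- The `N`-th moment of the standard Gaussian distribution. -/
noncomputable def stdMoment (N : ℕ) : ℝ := ∫ x, x ^ N ∂(gaussianReal 0 1)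

lemma integrable_pow_gaussianReal (v : ℝ≥0) (N : ℕ) :
    Integrable (fun x : ℝ => x ^ N) (gaussianReal 0 v) := by
  have := (memLp_id_gaussianReal (μ := 0) (v := v) N).integrable_norm_pow'
  rw [← integrable_norm_iff (by fun_prop)]
  simpa using this

lemma integral_pow_gaussianReal (v : ℝ≥0) (N : ℕ) :
    ∫ x, x ^ N ∂(gaussianReal 0 v) = √v ^ N * stdMoment N := by
  have h := gaussianReal_map_const_mul (μ := 0) (v := 1) (√v)
  have hv : (NNReal.mk (√(v : ℝ) ^ 2) (sq_nonneg _) * 1 : ℝ≥0) = v := by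
    ext
    simp
  rw [hv, mul_zero] at h
  rw [← h, integral_map (by fun_prop) (by fun_prop), stdMoment, ← integral_const_mul]
  simp_rw [mul_pow]

lemma stdMoment_odd {N : ℕ} (hN : Odd N) : stdMoment N = 0 := by
  have h := gaussianReal_map_neg (μ := 0) (v := 1)
  rw [neg_zero] at h
  have h2 : stdMoment N = -stdMoment N := by
    conv_lhs => rw [stdMoment, ← h]
    rw [integral_map (by fun_prop) (by fun_prop), stdMoment, ← integral_neg]
    simp_rw [hN.neg_pow]
  linarith

variable {Ω : Type*} [MeasurableSpace Ω] {P : Measure Ω}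

lemma integral_pow_of_hasGaussianLaw {Y : Ω → ℝ} (hY : HasGaussianLaw Y P)
    (h0 : ∫ ω, Y ω ∂P = 0) (N : ℕ) :
    ∫ ω, Y ω ^ N ∂P = √(∫ ω, Y ω ^ 2 ∂P) ^ N * stdMoment N := by
  have hm := hY.map_eq_gaussianReal
  have hv : Var[Y; P] = ∫ ω, Y ω ^ 2 ∂P := variance_of_integral_eq_zero hY.aemeasurable h0
  have h1 : ∫ ω, Y ω ^ N ∂P = ∫ x, x ^ N ∂(P.map Y) := by
    rw [integral_map hY.aemeasurable (by fun_prop)]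
  rw [h1, hm, h0, integral_pow_gaussianReal, Real.coe_toNNReal _ (variance_nonneg _ _), hv]

lemma memLp_two_prod_of_hasGaussianLaw {ι : Type*} (s : Finset ι) {X : ι → Ω → ℝ}
    [IsFiniteMeasure P] (hX : ∀ i, HasGaussianLaw (X i) P) :
    MemLp (fun ω => ∏ i ∈ s, X i ω) 2 P := by
  classical
  -- The exponent is generalised to all finite `p` because each factor split off by Hölder's
  -- inequality doubles it.
  suffices h : ∀ p : ℝ≥0∞, p ≠ ∞ → MemLp (fun ω => ∏ i ∈ s, X i ω) p P from h 2 (by simp)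
  induction s using Finset.induction_on with
  | empty => intro p _; simpa using memLp_const 1
  | insert a s ha ih =>
    intro p hp
    simp_rw [Finset.prod_insert ha]
    have : ENNReal.HolderTriple (2 * p) (2 * p) p := by
      constructor
      rw [← two_mul, ENNReal.mul_inv (by simp) (by simp), ← mul_assoc,
        ENNReal.mul_inv_cancel (by simp) (by simp), one_mul]
    have hp2 : 2 * p ≠ ∞ := ENNReal.mul_ne_top (by simp) hp
    exact (ih (2 * p) hp2).mul ((hX a).memLp hp2)

section Isserlis

variable {ι : Type*} [Fintype ι] [DecidableEq ι] {X : ι → Ω → ℝ}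

/-- By polarisation a product is an alternating sum of powers of partial sums. Each partial sum is
Gaussian, so mixed moments reduce to moments of one-dimensional Gaussian laws. -/
lemma factorial_mul_integral_prod (hX : IsGaussianProcess X P) :
    ((Fintype.card ι).factorial : ℝ) * ∫ ω, ∏ i, X i ω ∂P =
      ∑ S : Finset ι, (-1 : ℝ) ^ (Sᶜ).card *
        ∫ ω, (∑ i ∈ S, X i ω) ^ Fintype.card ι ∂P := by
  have : IsProbabilityMeasure P := hX.isProbabilityMeasure
  have h1 : ∀ ω, ((Fintype.card ι).factorial : ℝ) * ∏ i, X i ω =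
      ∑ S : Finset ι, (-1 : ℝ) ^ (Sᶜ).card * (∑ i ∈ S, X i ω) ^ Fintype.card ι := by
    intro ω
    simp_rw [sum_ite_mem_pow ι]
    rw [sum_neg_one_pow_card_compl_mul_sum rfl (fun g => ∏ a, X (g a) ω)]
    simp_rw [Equiv.prod_comp _ (fun i => X i ω)]
    simp [Fintype.card_perm]
  rw [← integral_const_mul]
  simp_rw [h1]
  rw [integral_finsetSum]
  · simp_rw [integral_const_mul]
  · intro S _
    refine Integrable.const_mul ?_ _
    have := (hX.hasGaussianLaw_fun_sum (I := S)).memLp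
      (p := (Fintype.card ι : ℝ≥0∞)) (by simp)
    have h2 := this.integrable_norm_pow'
    rw [← integrable_norm_iff]
    · simpa using h2
    · exact (this.aestronglyMeasurable).pow _

lemma integral_prod_eq_zero_of_odd_card (hX : IsGaussianProcess X P)
    (h0 : ∀ i, ∫ ω, X i ω ∂P = 0) (hodd : Odd (Fintype.card ι)) :
    ∫ ω, ∏ i, X i ω ∂P = 0 := by
  have h := factorial_mul_integral_prod hX
  rw [Finset.sum_eq_zero] at h
  · have := Nat.factorial_pos (Fintype.card ι)
    rcases mul_eq_zero.1 h with h | h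
    · exact absurd h (by positivity)
    · exact h
  · intro S _
    rw [integral_pow_of_hasGaussianLaw hX.hasGaussianLaw_fun_sum, stdMoment_odd hodd]
    · simp
    · rw [integral_finsetSum _ fun i _ => (hX.hasGaussianLaw_eval i).integrable]
      simp [h0]

/-- Isserlis' formula, summed over labelled and oriented pairings, so that each pairing occurs `2^k
k!` times. The prefactor compensates for this; it is left as `stdMoment (2 * k) / (2 * k)!` because
only the second and fourth moments are ever evaluated. The proof applies polarisation twice: to the
product, and backwards to the `k`-th powers of the variances of the partial sums. -/
lemma integral_prod_eq_sum_equiv (hX : IsGaussianProcess X P)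
    (h0 : ∀ i, ∫ ω, X i ω ∂P = 0) {k : ℕ} (hk : Fintype.card ι = 2 * k) :
    ∫ ω, ∏ i, X i ω ∂P = stdMoment (2 * k) / (2 * k).factorial *
      ∑ e : Fin k × Bool ≃ ι, ∏ j, ∫ ω, X (e (j, false)) ω * X (e (j, true)) ω ∂P := by
  have h := factorial_mul_integral_prod hX
  have h1 : ∀ S : Finset ι, ∫ ω, (∑ i ∈ S, X i ω) ^ Fintype.card ι ∂P =
      stdMoment (2 * k) * (∑ i ∈ S, ∑ j ∈ S, ∫ ω, X i ω * X j ω ∂P) ^ k := by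
    intro S
    rw [integral_pow_of_hasGaussianLaw hX.hasGaussianLaw_fun_sum, hk, pow_mul, Real.sq_sqrt,
      mul_comm]
    · congr 2
      simp_rw [sq, Finset.sum_mul_sum]
      have hint : ∀ i j, Integrable (fun ω => X i ω * X j ω) P := fun i j =>
        (hX.hasGaussianLaw_eval i).memLp_two.integrable_mul (hX.hasGaussianLaw_eval j).memLp_two
      rw [integral_finsetSum _ fun i _ => integrable_finsetSum _ fun j _ => hint i j]
      simp_rw [integral_finsetSum S fun j _ => hint _ j]
    · positivity
    · rw [integral_finsetSum _ fun i _ => (hX.hasGaussianLaw_eval i).integrable]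
      simp [h0]
  simp_rw [h1, sum_sum_pow, mul_left_comm _ (stdMoment (2 * k))] at h
  rw [← Finset.mul_sum, sum_neg_one_pow_card_compl_mul_sum (by simp [hk, mul_comm])
    (fun g => ∏ j, ∫ ω, X (g (j, false)) ω * X (g (j, true)) ω ∂P), hk] at h
  have := Nat.factorial_pos (2 * k)
  field_simp
  linarith

end Isserlis

/-! ### Second and fourth moments of the standard Gaussian law -/

lemma stdMoment_two : stdMoment 2 = 1 := by
  have h := variance_fun_id_gaussianReal (μ := 0) (v := 1)
  rw [variance_of_integral_eq_zero (by fun_prop) (by simp [integral_id_gaussianReal])] at h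
  simpa [stdMoment] using h

/-- The sum of two independent standard Gaussians is distributed as `√2` times one of them.
Comparing fourth moments gives `4 m₄ = 2 m₄ + 6 m₂²`, hence `m₄ = 3`. -/
lemma stdMoment_four : stdMoment 4 = 3 := by
  have hi := fun N => integrable_pow_gaussianReal 1 N
  have hX : IndepFun (Prod.fst : ℝ × ℝ → ℝ) Prod.snd ((gaussianReal 0 1).prod (gaussianReal 0 1)) :=
    indepFun_prod (X := id) (Y := id) measurable_id measurable_id
  have hsum := gaussianReal_add_gaussianReal_of_indepFun (m₁ := 0) (m₂ := 0) (v₁ := 1) (v₂ := 1)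
    hX (by simp) (by simp)
  have h1 : ∫ x, x ^ 4 ∂(gaussianReal 0 2) =
      ∫ z : ℝ × ℝ, (z.1 + z.2) ^ 4 ∂((gaussianReal 0 1).prod (gaussianReal 0 1)) := by
    have h2 : (0 : ℝ) + 0 = 0 := by simp
    have h3 : (1 : ℝ≥0) + 1 = 2 := by norm_num
    rw [h2, h3] at hsum
    rw [← hsum, integral_map (by fun_prop) (by fun_prop)]
    rfl
  rw [integral_pow_gaussianReal] at h1
  have h4 : ∀ z : ℝ × ℝ, (z.1 + z.2) ^ 4 = z.1 ^ 4 * z.2 ^ 0 + 4 * (z.1 ^ 3 * z.2 ^ 1) +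
      6 * (z.1 ^ 2 * z.2 ^ 2) + 4 * (z.1 ^ 1 * z.2 ^ 3) + z.1 ^ 0 * z.2 ^ 4 := by
    intro z; ring
  have hm : ∀ a b : ℕ, Integrable (fun z : ℝ × ℝ => z.1 ^ a * z.2 ^ b)
      ((gaussianReal 0 1).prod (gaussianReal 0 1)) := fun a b => (hi a).mul_prod (hi b)
  have hv : ∀ a b : ℕ, ∫ z : ℝ × ℝ, z.1 ^ a * z.2 ^ b
      ∂((gaussianReal 0 1).prod (gaussianReal 0 1)) = stdMoment a * stdMoment b :=
    fun a b => integral_prod_mul (fun x : ℝ => x ^ a) (fun x : ℝ => x ^ b)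
  simp_rw [h4] at h1
  rw [integral_add, integral_add, integral_add, integral_add, integral_const_mul,
    integral_const_mul, integral_const_mul, hv, hv, hv, hv, hv] at h1
  · have h0 : stdMoment 0 = 1 := by simp [stdMoment]
    rw [h0, stdMoment_two, stdMoment_odd (by decide : Odd 1)] at h1
    have h5 : √((2 : ℝ≥0) : ℝ) ^ 4 = 4 := by
      rw [show (4 : ℕ) = 2 * 2 from rfl, pow_mul, Real.sq_sqrt (by simp)]
      norm_num
    rw [h5] at h1
    linarith
  all_goals fun_prop (disch := exact hm _ _)

/-! ### Integrals along piecewise linear paths as finite sums -/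

lemma isClosed_simplex (T : ℝ) (n : ℕ) : IsClosed (simplex T n) := by
  have h : simplex T n = (⋂ i, ⋂ j, ⋂ (_ : i ≤ j), {t : Fin n → ℝ | t j ≤ t i}) ∩
      Set.univ.pi fun _ => Set.Icc 0 T := by
    ext t
    simp only [simplex, Antitone, Set.mem_ofPred_eq, Set.mem_inter_iff, Set.mem_iInter,
      Set.mem_univ_pi]
  rw [h]
  refine IsClosed.inter ?_ (isClosed_set_pi fun _ _ => isClosed_Icc)
  exact isClosed_iInter fun i => isClosed_iInter fun j => isClosed_iInter fun _ =>
    isClosed_le (continuous_apply j) (continuous_apply i)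

lemma simplex_subset_pi (T : ℝ) (n : ℕ) :
    simplex T n ⊆ Set.univ.pi fun _ => Set.Icc 0 T := fun _ ht i _ => ht.2 i

lemma isCompact_simplex (T : ℝ) (n : ℕ) : IsCompact (simplex T n) :=
  (isCompact_univ_pi fun _ => isCompact_Icc).of_isClosed_subset (isClosed_simplex T n)
    (simplex_subset_pi T n)

lemma measurableSet_simplex (T : ℝ) (n : ℕ) : MeasurableSet (simplex T n) :=
  (isClosed_simplex T n).measurableSet

/-- The indicator function of the cell `(s j, s (j + 1)]`. -/
noncomputable def cellInd (s : ℕ → ℝ) (j : ℕ) : ℝ → ℝ :=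
  (Set.Ioc (s j) (s (j + 1))).indicator 1

lemma measurable_cellInd (s : ℕ → ℝ) (j : ℕ) : Measurable (cellInd s j) :=
  measurable_one.indicator measurableSet_Ioc

lemma cellInd_nonneg (s : ℕ → ℝ) (j : ℕ) (t : ℝ) : 0 ≤ cellInd s j t :=
  Set.indicator_nonneg (fun _ _ => zero_le_one) t

lemma cellInd_le_one (s : ℕ → ℝ) (j : ℕ) (t : ℝ) : cellInd s j t ≤ 1 :=
  Set.indicator_le' (fun _ _ => le_rfl) (fun _ _ => zero_le_one) t

lemma abs_prod_cellInd_le_one {n : ℕ} (s : ℕ → ℝ) (i : Fin n → ℕ) (t : Fin n → ℝ) :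
    |∏ l, cellInd s (i l) (t l)| ≤ 1 := by
  rw [Finset.abs_prod]
  exact Finset.prod_le_one (fun _ _ => abs_nonneg _) fun l _ => by
    rw [abs_of_nonneg (cellInd_nonneg _ _ _)]
    exact cellInd_le_one _ _ _

lemma measurable_prod_cellInd {n : ℕ} (s : ℕ → ℝ) (i : Fin n → ℕ) :
    Measurable fun t : Fin n → ℝ => ∏ l, cellInd s (i l) (t l) :=
  Finset.measurable_fun_prod _ fun l _ => (measurable_cellInd s (i l)).comp (measurable_pi_apply l)

/-- The integral of `φ` over the part of the simplex in the box of cells with indices `i`. -/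
noncomputable def boxIntegral (T : ℝ) {n : ℕ} (φ : (Fin n → ℝ) → ℝ) (s : ℕ → ℝ)
    (i : Fin n → ℕ) : ℝ :=
  ∫ t in simplex T n, φ t * ∏ l, cellInd s (i l) (t l)

/-- Away from `c` the function `min t c` has slope `1` to the left and `0` to the right, so each
summand contributes its slope exactly on its own cell. The nodes are excluded; they form a null set.
-/
lemma deriv_pwLinear {m : ℕ} {s : ℕ → ℝ} (hs : ∀ i < m, s i < s (i + 1)) (v : Fin m → ℝ) {t : ℝ}
    (ht : ∀ j ≤ m, t ≠ s j) :
    deriv (pwLinear s v) t = ∑ j : Fin m, v j * cellInd s j t := by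
  have hmin : ∀ c, t ≠ c → HasDerivAt (fun t => min t c) (if t < c then 1 else 0) t := by
    intro c hc
    rcases lt_or_gt_of_ne hc with h | h
    · rw [if_pos h]
      refine (hasDerivAt_id t).congr_of_eventuallyEq ?_
      filter_upwards [eventually_lt_nhds h] with x hx
      exact min_eq_left hx.le
    · rw [if_neg h.not_gt]
      refine (hasDerivAt_const t c).congr_of_eventuallyEq ?_
      filter_upwards [eventually_gt_nhds h] with x hx
      exact min_eq_right hx.le
  have h : HasDerivAt (pwLinear s v) (∑ j : Fin m, v j *
      ((if t < s (j.val + 1) then 1 else 0) - (if t < s j.val then 1 else 0))) t := by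
    unfold pwLinear
    refine HasDerivAt.fun_sum fun j _ => ?_
    exact ((hmin _ (ht _ j.isLt)).sub (hmin _ (ht _ j.isLt.le))).const_mul (v j)
  rw [h.deriv]
  refine Finset.sum_congr rfl fun j _ => ?_
  congr 1
  have h1 := ht _ j.isLt
  have h2 := ht _ j.isLt.le
  have h3 := hs j j.isLt
  unfold cellInd
  rw [Set.indicator_apply]
  rcases lt_or_gt_of_ne h2 with h4 | h4
  · rw [if_pos (h4.trans h3), if_pos h4, if_neg fun h => h.1.not_gt h4, sub_self]
  · rw [if_neg h4.not_gt, sub_zero]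
    refine if_congr ?_ rfl rfl
    exact ⟨fun h => ⟨h4, h.le⟩, fun h => lt_of_le_of_ne h.2 h1⟩

lemma ae_forall_apply_ne {n : ℕ} (s : ℕ → ℝ) :
    ∀ᵐ t : Fin n → ℝ, ∀ l j, t l ≠ s j := by
  refine ae_all_iff.2 fun l => ae_all_iff.2 fun j => ?_
  have := (Measure.quasiMeasurePreserving_eval (fun _ : Fin n => (volume : Measure ℝ)) l).ae
    (p := fun x => x ≠ s j) (by simp [ae_iff])
  exact this

lemma integrableOn_mul_of_continuous {n : ℕ} {T : ℝ} {φ : (Fin n → ℝ) → ℝ} (hφ : Continuous φ)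
    {w : (Fin n → ℝ) → ℝ} (hw : Measurable w) (hb : ∀ t, |w t| ≤ 1) :
    IntegrableOn (fun t => φ t * w t) (simplex T n) :=
  (hφ.continuousOn.integrableOn_compact (isCompact_simplex T n)).mul_bdd
    hw.aestronglyMeasurable (Filter.Eventually.of_forall hb)

/-- The coefficients do not involve the slopes, so one formula serves both the random polygons and
the deterministic paths of `Q`. -/
lemma pathIntegral_pwLinear {T : ℝ} {m : ℕ} {s : ℕ → ℝ} (hs : ∀ i < m, s i < s (i + 1)) {n : ℕ}
    {φ : (Fin n → ℝ) → ℝ} (hφ : Continuous φ) (v : Fin m → ℝ) :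
    pathIntegral T φ (pwLinear s v) =
      ∑ i : Fin n → Fin m, boxIntegral T φ s (fun l => i l) * ∏ l, v (i l) := by
  have h1 : pathIntegral T φ (pwLinear s v) = ∫ t in simplex T n,
      ∑ i : Fin n → Fin m, (φ t * ∏ l, cellInd s (i l) (t l)) * ∏ l, v (i l) := by
    refine setIntegral_congr_ae (measurableSet_simplex T n) ?_
    filter_upwards [ae_forall_apply_ne s] with t ht _
    simp_rw [deriv_pwLinear hs v fun j _ => ht _ j, Finset.prod_univ_sum, Fintype.piFinset_univ,
      Finset.mul_sum, Finset.prod_mul_distrib]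
    exact Finset.sum_congr rfl fun i _ => by ring
  rw [h1, integral_finsetSum]
  · simp_rw [integral_mul_const]
    rfl
  · intro i _
    exact (integrableOn_mul_of_continuous hφ (measurable_prod_cellInd s fun l => i l)
      (abs_prod_cellInd_le_one s _)).mul_const _

/-! ### Averages over boxes -/

/-- `φ` on the simplex, extended by zero. -/
noncomputable def cut (T : ℝ) {n : ℕ} (φ : (Fin n → ℝ) → ℝ) : (Fin n → ℝ) → ℝ :=
  (simplex T n).indicator φ

lemma measurable_cut (T : ℝ) {n : ℕ} {φ : (Fin n → ℝ) → ℝ} (hφ : Continuous φ) :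
    Measurable (cut T φ) := hφ.measurable.indicator (measurableSet_simplex T n)

lemma exists_abs_cut_le (T : ℝ) {n : ℕ} {φ : (Fin n → ℝ) → ℝ} (hφ : Continuous φ) :
    ∃ K, 0 ≤ K ∧ ∀ t, |cut T φ t| ≤ K := by
  obtain ⟨K, hK⟩ := (isCompact_simplex T n).exists_bound_of_continuousOn hφ.continuousOn
  refine ⟨max K 0, le_max_right _ _, fun t => ?_⟩
  unfold cut
  by_cases ht : t ∈ simplex T n
  · rw [Set.indicator_of_mem ht]
    exact (hK t ht).trans (le_max_left _ _)
  · simp [Set.indicator_of_notMem ht]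

/-- The half-open unit cube. -/
def cube (n : ℕ) : Set (Fin n → ℝ) := Set.univ.pi fun _ => Set.Ioc 0 1

lemma measurableSet_cube (n : ℕ) : MeasurableSet (cube n) :=
  MeasurableSet.univ_pi fun _ => measurableSet_Ioc

lemma volume_cube (n : ℕ) : volume (cube n) = 1 := by
  simp [cube, volume_pi_pi]

instance isFiniteMeasure_restrict_cube (n : ℕ) :
    IsFiniteMeasure ((volume : Measure (Fin n → ℝ)).restrict (cube n)) :=
  ⟨by simp [volume_cube]⟩

lemma integral_comp_affine_pi {n : ℕ} (g : (Fin n → ℝ) → ℝ) (hg : Measurable g)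
    (b D : Fin n → ℝ) (hD : ∀ l, 0 < D l) :
    ∫ t, g t = (∏ l, D l) * ∫ u : Fin n → ℝ, g fun l => b l + D l * u l := by
  have hpos : 0 < ∏ l, D l := Finset.prod_pos fun l _ => hD l
  have hdet : (Matrix.diagonal D).det = ∏ l, D l := Matrix.det_diagonal
  have h := Real.smul_map_diagonal_volume_pi (D := D) (by rw [hdet]; exact hpos.ne')
  rw [← integral_add_left_eq_self g b]
  conv_lhs => rw [← h]
  rw [integral_smul_measure, integral_map]
  · rw [hdet, abs_of_pos hpos, ENNReal.toReal_ofReal hpos.le, smul_eq_mul]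
    congr 1
    refine integral_congr_ae (Filter.Eventually.of_forall fun u => ?_)
    refine congrArg g (funext fun l => ?_)
    simp [Matrix.toLin'_apply, Matrix.mulVec_diagonal]
  · exact (LinearMap.continuous_on_pi _).aemeasurable
  · exact (hg.comp (by fun_prop)).aestronglyMeasurable

/-- An affine change of variables turns the box integral into volume times average. The average over
the fixed unit cube is what admits a limit as the box shrinks. -/
lemma boxIntegral_eq (T : ℝ) {n : ℕ} {φ : (Fin n → ℝ) → ℝ} (hφ : Continuous φ) {s : ℕ → ℝ}
    {i : Fin n → ℕ} (hs : ∀ l, s (i l) < s (i l + 1)) :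
    boxIntegral T φ s i = (∏ l, (s (i l + 1) - s (i l))) *
      ∫ u in cube n, cut T φ fun l => s (i l) + (s (i l + 1) - s (i l)) * u l := by
  have hm : Measurable fun t => cut T φ t * ∏ l, cellInd s (i l) (t l) :=
    (measurable_cut T hφ).mul (measurable_prod_cellInd s i)
  have h1 : boxIntegral T φ s i = ∫ t, cut T φ t * ∏ l, cellInd s (i l) (t l) := by
    rw [boxIntegral, ← integral_indicator (measurableSet_simplex T n)]
    congr 1
    ext t
    unfold cut
    by_cases ht : t ∈ simplex T n <;> simp [ht]
  rw [h1, integral_comp_affine_pi _ hm (fun l => s (i l)) (fun l => s (i l + 1) - s (i l))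
    fun l => sub_pos.2 (hs l)]
  congr 1
  rw [← integral_indicator (measurableSet_cube n)]
  congr 1
  ext u
  have hmem : ∀ l, s (i l) + (s (i l + 1) - s (i l)) * u l ∈ Set.Ioc (s (i l)) (s (i l + 1)) ↔
      u l ∈ Set.Ioc (0 : ℝ) 1 := by
    intro l
    have := sub_pos.2 (hs l)
    constructor
    · rintro ⟨h1, h2⟩
      constructor <;> nlinarith
    · rintro ⟨h1, h2⟩
      constructor <;> nlinarith
  by_cases hu : u ∈ cube n
  · rw [Set.indicator_of_mem hu, Finset.prod_eq_one, mul_one]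
    intro l _
    unfold cellInd
    rw [Set.indicator_of_mem ((hmem l).2 (hu l trivial))]
    rfl
  · rw [Set.indicator_of_notMem hu]
    have : ∃ l, u l ∉ Set.Ioc (0 : ℝ) 1 := by
      by_contra! h
      exact hu fun l _ => h l
    obtain ⟨l, hl⟩ := this
    rw [Finset.prod_eq_zero (Finset.mem_univ l), mul_zero]
    unfold cellInd
    rw [Set.indicator_of_notMem fun h => hl ((hmem l).1 h)]

/-! ### Partitions -/

/-- The type of partitions of `[0, T]`. -/
structure Subdivision (T : ℝ) : Type where
  /-- The number of cells. -/
  num : ℕ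
  /-- The partition points. -/
  pt : ℕ → ℝ
  isPartition : IsPartition T num pt

namespace Subdivision

variable {T : ℝ}

lemma pt_lt (q : Subdivision T) : ∀ i < q.num, q.pt i < q.pt (i + 1) := q.isPartition.2.2

/-- The maximal length of a cell. -/
noncomputable def mesh (q : Subdivision T) : ℝ≥0 :=
  (Finset.range q.num).sup fun i => (q.pt (i + 1) - q.pt i).toNNReal

/-- Translates between the filter `fine` and the cell-length condition in `IsStratonovichIntegral`.
-/
lemma mesh_lt_iff (q : Subdivision T) {δ : ℝ≥0} (hδ : 0 < δ) :
    q.mesh < δ ↔ ∀ i < q.num, q.pt (i + 1) - q.pt i < δ := by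
  unfold mesh
  rw [Finset.sup_lt_iff (by simpa using hδ)]
  simp only [Finset.mem_range]
  refine forall₂_congr fun i hi => ?_
  rw [Real.toNNReal_lt_iff_lt_coe (sub_pos.2 (q.pt_lt i hi)).le]

lemma sub_le_mesh (q : Subdivision T) {i : ℕ} (hi : i < q.num) :
    q.pt (i + 1) - q.pt i ≤ q.mesh := by
  have := Finset.le_sup (f := fun i => (q.pt (i + 1) - q.pt i).toNNReal) (Finset.mem_range.2 hi)
  exact (Real.le_coe_toNNReal _).trans (by exact_mod_cast this)

/-- The filter of partitions whose mesh tends to zero. -/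
noncomputable def fine (T : ℝ) : Filter (Subdivision T) := Filter.comap mesh (nhds 0)

instance : (fine T).IsCountablyGenerated := by
  unfold fine; infer_instance

lemma hasBasis_fine (T : ℝ) :
    (fine T).HasBasis (fun δ : ℝ≥0 => 0 < δ) fun δ => {q | q.mesh < δ} := by
  have h := (nhds_bot_basis (α := ℝ≥0)).comap (mesh (T := T))
  simpa [fine, Set.preimage] using h

lemma pt_monotone (q : Subdivision T) {i j : ℕ} (hij : i ≤ j) (hj : j ≤ q.num) :
    q.pt i ≤ q.pt j := by
  induction j, hij using Nat.le_induction with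
  | base => exact le_rfl
  | succ j hij ih => exact (ih (by omega)).trans (q.pt_lt j (by omega)).le

lemma pt_zero (q : Subdivision T) : q.pt 0 = 0 := q.isPartition.1

lemma pt_num (q : Subdivision T) : q.pt q.num = T := q.isPartition.2.1

lemma pt_nonneg (q : Subdivision T) {i : ℕ} (hi : i ≤ q.num) : 0 ≤ q.pt i := by
  rw [← q.pt_zero]; exact q.pt_monotone (Nat.zero_le _) hi

lemma pt_le (q : Subdivision T) {i : ℕ} (hi : i ≤ q.num) : q.pt i ≤ T :=
  (q.pt_monotone hi le_rfl).trans_eq q.pt_num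

lemma exists_mem_cell (q : Subdivision T) {x : ℝ} (hx : x ∈ Set.Ioc 0 T) :
    ∃ j : Fin q.num, x ∈ Set.Ioc (q.pt j) (q.pt (j + 1)) := by
  classical
  have hex : ∃ j, x ≤ q.pt j := ⟨q.num, hx.2.trans_eq q.pt_num.symm⟩
  have h0 : Nat.find hex ≠ 0 := by
    intro h
    have := Nat.find_spec hex
    rw [h, q.pt_zero] at this
    exact this.not_gt hx.1
  obtain ⟨j, hj⟩ := Nat.exists_eq_succ_of_ne_zero h0
  have hle : Nat.find hex ≤ q.num := Nat.find_min' hex (hx.2.trans_eq q.pt_num.symm)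
  refine ⟨⟨j, by lia⟩, ?_, ?_⟩
  · exact not_le.1 (Nat.find_min hex (by lia))
  · have := Nat.find_spec hex
    rwa [hj] at this

lemma eq_of_mem_cell (q : Subdivision T) {x : ℝ} {i j : Fin q.num}
    (hi : x ∈ Set.Ioc (q.pt i) (q.pt (i + 1))) (hj : x ∈ Set.Ioc (q.pt j) (q.pt (j + 1))) :
    i = j := by
  by_contra hne
  rcases lt_or_gt_of_ne hne with h | h
  · have := q.pt_monotone (Nat.succ_le_of_lt (Fin.lt_def.1 h)) j.isLt.le
    exact (hi.2.trans this).not_gt hj.1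
  · have := q.pt_monotone (Nat.succ_le_of_lt (Fin.lt_def.1 h)) i.isLt.le
    exact (hj.2.trans this).not_gt hi.1

/-- Uniform grids with more than `T / δ` cells have mesh below `δ`. This makes limits along `fine T`
unique. -/
instance neBot_fine (T : ℝ) [hT : Fact (0 < T)] : (fine T).NeBot := by
  rw [(hasBasis_fine T).neBot_iff]
  intro δ hδ
  have hδ' : (0 : ℝ) < δ := hδ
  obtain ⟨m, hm⟩ := exists_nat_gt (T / δ)
  have hm0 : (0 : ℝ) < m := (div_pos hT.1 hδ').trans hm
  refine ⟨⟨m, grid T m, ?_, ?_, ?_⟩, ?_⟩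
  · simp [grid]
  · simp only [grid]
    field_simp
  · intro i _
    simp only [grid]
    have := hT.1
    gcongr
    simp
  · refine (mesh_lt_iff _ hδ).2 ?_
    intro i _
    simp only [grid]
    rw [div_lt_iff₀ hδ'] at hm
    rw [← sub_div, div_lt_iff₀ hm0]
    push_cast
    linarith

end Subdivision

/-! ### Difference quotients of Brownian motion and their mixed moments -/

section Slopes

variable {Ω : Type*} [MeasurableSpace Ω] {P : Measure Ω} {B : ℝ≥0 → Ω → ℝ}

/-- The difference quotient of `B` over the interval with end points `p`. -/
noncomputable def slopeRV (B : ℝ≥0 → Ω → ℝ) (p : ℝ × ℝ) (ω : Ω) : ℝ :=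
  (B p.2.toNNReal ω - B p.1.toNNReal ω) / (p.2 - p.1)

/-- The uniform density on the interval with end points `p`. -/
noncomputable def unifDensity (p : ℝ × ℝ) (r : ℝ) : ℝ :=
  (Set.Ioc p.1 p.2).indicator 1 r / (p.2 - p.1)

lemma measurable_unifDensity (p : ℝ × ℝ) : Measurable (unifDensity p) :=
  (measurable_one.indicator measurableSet_Ioc).div_const _

lemma unifDensity_nonneg {p : ℝ × ℝ} (hp : p.1 ≤ p.2) (r : ℝ) : 0 ≤ unifDensity p r :=
  div_nonneg (Set.indicator_nonneg (fun _ _ => zero_le_one) r) (sub_nonneg.2 hp)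

lemma unifDensity_le {p : ℝ × ℝ} (hp : p.1 ≤ p.2) (r : ℝ) : unifDensity p r ≤ 1 / (p.2 - p.1) :=
  div_le_div_of_nonneg_right (Set.indicator_le' (fun _ _ => le_rfl) (fun _ _ => zero_le_one) r)
    (sub_nonneg.2 hp)

lemma isGaussianProcess_slopeRV (hB : IsPreBrownianReal B P) :
    IsGaussianProcess (slopeRV B) P := by
  classical
  refine hB.isGaussianProcess.of_isGaussianProcess fun p => ⟨{p.2.toNNReal, p.1.toNNReal},
    (p.2 - p.1)⁻¹ • (ContinuousLinearMap.proj ⟨p.2.toNNReal, by simp⟩ -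
      ContinuousLinearMap.proj ⟨p.1.toNNReal, by simp⟩), fun ω => ?_⟩
  simp [slopeRV, div_eq_inv_mul]

lemma integral_slopeRV (hB : IsPreBrownianReal B P) (p : ℝ × ℝ) :
    ∫ ω, slopeRV B p ω ∂P = 0 := by
  unfold slopeRV
  rw [integral_div, integral_sub (hB.integrable_eval _) (hB.integrable_eval _)]
  simp [hB.integral_eval]

lemma integral_mul_eval (hB : IsPreBrownianReal B P) (s t : ℝ≥0) :
    ∫ ω, B s ω * B t ω ∂P = min s t := by
  have : IsProbabilityMeasure P := hB.isGaussianProcess.isProbabilityMeasure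
  have h := covariance_eq_sub (hB.isGaussianProcess.hasGaussianLaw_eval s).memLp_two
    (hB.isGaussianProcess.hasGaussianLaw_eval t).memLp_two
  rw [hB.covariance_eval, hB.integral_eval, zero_mul, sub_zero] at h
  rw [h]
  rfl

lemma setIntegral_indicator_mul_indicator {T x y : ℝ} (hx : x ∈ Set.Icc 0 T)
    (hy : y ∈ Set.Icc 0 T) :
    ∫ r in Set.Ioc 0 T, (Set.Iic x).indicator (1 : ℝ → ℝ) r * (Set.Iic y).indicator 1 r =
      min x y := by
  have h : ∀ r, (Set.Iic x).indicator (1 : ℝ → ℝ) r * (Set.Iic y).indicator 1 r =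
      (Set.Iic (min x y)).indicator (fun _ => 1) r := by
    intro r
    by_cases h1 : r ≤ x <;> by_cases h2 : r ≤ y <;> simp [h1, h2]
  simp_rw [h]
  rw [integral_indicator measurableSet_Iic, Measure.restrict_restrict measurableSet_Iic]
  have h2 : Set.Iic (min x y) ∩ Set.Ioc 0 T = Set.Ioc 0 (min x y) := by
    ext r
    simp only [Set.mem_inter_iff, Set.mem_Iic, Set.mem_Ioc]
    exact ⟨fun h => ⟨h.2.1, h.1⟩, fun h => ⟨h.2, h.1, h.2.trans ((min_le_left _ _).trans hx.2)⟩⟩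
  rw [h2]
  simp [hx.1, hy.1]

/-- Since `E[B_s B_t] = min s t = ∫ 1_{r ≤ s} 1_{r ≤ t} dr`, both sides are the same combination of
four such terms, one for each choice of end points. The covariance is written as an integral so that
Isserlis' formula becomes an integral of step functions. -/
lemma integral_slopeRV_mul_slopeRV (hB : IsPreBrownianReal B P) {T : ℝ} {p p' : ℝ × ℝ}
    (h0 : 0 ≤ p.1) (h1 : p.1 ≤ p.2) (h2 : p.2 ≤ T) (h0' : 0 ≤ p'.1) (h1' : p'.1 ≤ p'.2)
    (h2' : p'.2 ≤ T) :
    ∫ ω, slopeRV B p ω * slopeRV B p' ω ∂P =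
      ∫ r in Set.Ioc 0 T, unifDensity p r * unifDensity p' r := by
  have hint : ∀ s t, Integrable (fun ω => B s ω * B t ω) P := fun s t =>
    (hB.isGaussianProcess.hasGaussianLaw_eval s).memLp_two.integrable_mul
      (hB.isGaussianProcess.hasGaussianLaw_eval t).memLp_two
  have hl : ∀ ω, slopeRV B p ω * slopeRV B p' ω =
      (((B p.2.toNNReal ω * B p'.2.toNNReal ω - B p.2.toNNReal ω * B p'.1.toNNReal ω) -
        B p.1.toNNReal ω * B p'.2.toNNReal ω) + B p.1.toNNReal ω * B p'.1.toNNReal ω) /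
        ((p.2 - p.1) * (p'.2 - p'.1)) := by
    intro ω
    unfold slopeRV
    rw [div_mul_div_comm]
    ring
  have hind : ∀ q : ℝ × ℝ, q.1 ≤ q.2 → ∀ r, (Set.Ioc q.1 q.2).indicator (1 : ℝ → ℝ) r =
      (Set.Iic q.2).indicator 1 r - (Set.Iic q.1).indicator 1 r := by
    intro q hq r
    by_cases h1 : r ≤ q.1
    · simp [h1, h1.trans hq]
    · by_cases h2 : r ≤ q.2 <;> simp [h1, h2, not_le.1 h1]
  have hr : ∀ r, unifDensity p r * unifDensity p' r =
      ((((Set.Iic p.2).indicator (1 : ℝ → ℝ) r * (Set.Iic p'.2).indicator 1 r -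
        (Set.Iic p.2).indicator (1 : ℝ → ℝ) r * (Set.Iic p'.1).indicator 1 r) -
        (Set.Iic p.1).indicator (1 : ℝ → ℝ) r * (Set.Iic p'.2).indicator 1 r) +
        (Set.Iic p.1).indicator (1 : ℝ → ℝ) r * (Set.Iic p'.1).indicator 1 r) /
        ((p.2 - p.1) * (p'.2 - p'.1)) := by
    intro r
    unfold unifDensity
    rw [div_mul_div_comm, hind p h1, hind p' h1']
    ring
  have hint2 : ∀ x y : ℝ, Integrable (fun r => (Set.Iic x).indicator (1 : ℝ → ℝ) r *
      (Set.Iic y).indicator 1 r) (volume.restrict (Set.Ioc 0 T)) := by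
    intro x y
    have : ∀ z : ℝ, Integrable ((Set.Iic z).indicator (1 : ℝ → ℝ))
        (volume.restrict (Set.Ioc 0 T)) := fun z =>
      (integrable_const (1 : ℝ)).indicator measurableSet_Iic
    refine (this x).mul_bdd (c := 1)
      (measurable_one.indicator measurableSet_Iic).aestronglyMeasurable
      (Filter.Eventually.of_forall fun r => ?_)
    by_cases h : r ≤ y <;> simp [h]
  simp_rw [hl, hr]
  rw [integral_div, integral_div, integral_add, integral_sub, integral_sub, integral_add,
    integral_sub, integral_sub]
  · have hm : ∀ x y : ℝ, 0 ≤ x → x ≤ T → 0 ≤ y → y ≤ T →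
        ∫ ω, B x.toNNReal ω * B y.toNNReal ω ∂P = ∫ r in Set.Ioc 0 T,
          (Set.Iic x).indicator (1 : ℝ → ℝ) r * (Set.Iic y).indicator 1 r := by
      intro x y hx hx' hy hy'
      rw [integral_mul_eval hB, setIntegral_indicator_mul_indicator ⟨hx, hx'⟩ ⟨hy, hy'⟩,
        NNReal.coe_min, Real.coe_toNNReal _ hx, Real.coe_toNNReal _ hy]
    rw [hm, hm, hm, hm] <;> linarith
  all_goals fun_prop (disch := first | exact hint _ _ | exact hint2 _ _)

/-- The product over pairs of one-dimensional covariance integrals is merged by Fubini into one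
integral over `(0, T]^k`, in which both members of a pair are evaluated at the same coordinate. -/
lemma integral_prod_slopeRV (hB : IsPreBrownianReal B P) {T : ℝ} {ι : Type*} [Fintype ι]
    [DecidableEq ι] {k : ℕ} (hk : Fintype.card ι = 2 * k) {z : ι → ℝ × ℝ}
    (h0 : ∀ i, 0 ≤ (z i).1) (h1 : ∀ i, (z i).1 ≤ (z i).2) (h2 : ∀ i, (z i).2 ≤ T) :
    ∫ ω, ∏ i, slopeRV B (z i) ω ∂P = stdMoment (2 * k) / (2 * k).factorial *
      ∑ e : Fin k × Bool ≃ ι, ∫ r, ∏ i, unifDensity (z i) (r (e.symm i).1)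
        ∂(Measure.pi fun _ : Fin k => volume.restrict (Set.Ioc 0 T)) := by
  have hg := (isGaussianProcess_slopeRV hB).comp_right z
  have h := integral_prod_eq_sum_equiv hg (fun i => integral_slopeRV hB (z i)) hk
  simp only [Function.comp_apply] at h
  rw [h]
  congr 1
  refine Finset.sum_congr rfl fun e _ => ?_
  have h3 : ∀ r : Fin k → ℝ, ∏ i, unifDensity (z i) (r (e.symm i).1) =
      ∏ j, (unifDensity (z (e (j, false))) (r j) * unifDensity (z (e (j, true))) (r j)) := by
    intro r
    rw [← Equiv.prod_comp e, Fintype.prod_prod_type]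
    refine Finset.prod_congr rfl fun j _ => ?_
    simp [mul_comm]
  simp_rw [h3]
  rw [integral_fintype_prod_eq_prod (μ := fun _ : Fin k => volume.restrict (Set.Ioc 0 T))
    (f := fun j x => unifDensity (z (e (j, false))) x * unifDensity (z (e (j, true))) x)]
  exact Finset.prod_congr rfl fun j _ => integral_slopeRV_mul_slopeRV hB (h0 _) (h1 _) (h2 _)
    (h0 _) (h1 _) (h2 _)

end Slopes

/-! ### Multilinear forms in the difference quotients and their second moments -/

namespace Subdivision

variable {Ω : Type*} [MeasurableSpace Ω] {P : Measure Ω} {B : ℝ≥0 → Ω → ℝ} {T : ℝ}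

/-- The end points of a cell. -/
def ends (q : Subdivision T) (j : Fin q.num) : ℝ × ℝ := (q.pt j, q.pt (j + 1))

/-- The multilinear form with coefficients `A` in the difference quotients of `B`. -/
noncomputable def form (B : ℝ≥0 → Ω → ℝ) (q : Subdivision T) {n : ℕ}
    (A : (Fin n → Fin q.num) → ℝ) (ω : Ω) : ℝ :=
  ∑ i, A i * ∏ l, slopeRV B (q.ends (i l)) ω

/-- The step function with coefficients `A`, normalised by the volumes of the boxes. -/
noncomputable def step (q : Subdivision T) {n : ℕ} (A : (Fin n → Fin q.num) → ℝ)
    (x : Fin n → ℝ) : ℝ :=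
  ∑ i, A i * ∏ l, unifDensity (q.ends (i l)) (x l)

lemma memLp_form (hB : IsPreBrownianReal B P) (q : Subdivision T) {n : ℕ}
    (A : (Fin n → Fin q.num) → ℝ) : MemLp (q.form B A) 2 P := by
  have : IsProbabilityMeasure P := hB.isGaussianProcess.isProbabilityMeasure
  unfold form
  refine memLp_finsetSum _ fun i _ => MemLp.const_mul ?_ _
  exact memLp_two_prod_of_hasGaussianLaw _ fun l =>
    (isGaussianProcess_slopeRV hB).hasGaussianLaw_eval _

lemma measurable_step (q : Subdivision T) {n : ℕ} (A : (Fin n → Fin q.num) → ℝ) :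
    Measurable (q.step A) := by
  unfold step
  refine Finset.measurable_fun_sum _ fun i _ => measurable_const.mul ?_
  exact Finset.measurable_fun_prod _ fun l _ =>
    (measurable_unifDensity _).comp (measurable_pi_apply l)

lemma integral_form_of_odd (hB : IsPreBrownianReal B P) (q : Subdivision T) {n : ℕ} (hn : Odd n)
    (A : (Fin n → Fin q.num) → ℝ) : ∫ ω, q.form B A ω ∂P = 0 := by
  have : IsProbabilityMeasure P := hB.isGaussianProcess.isProbabilityMeasure
  unfold form
  rw [integral_finsetSum]
  · refine Finset.sum_eq_zero fun i _ => ?_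
    rw [integral_const_mul]
    have hg := (isGaussianProcess_slopeRV hB).comp_right fun l => q.ends (i l)
    have h := integral_prod_eq_zero_of_odd_card hg (fun l => integral_slopeRV hB _) (by simpa)
    simp only [Function.comp_apply] at h
    rw [h, mul_zero]
  · intro i _
    refine Integrable.const_mul ?_ _
    exact (memLp_two_prod_of_hasGaussianLaw _ fun l =>
      (isGaussianProcess_slopeRV hB).hasGaussianLaw_eval _).integrable one_le_two

/-- All probability disappears here: Isserlis' formula is applied to each pair of monomials, and
resumming the coefficients gives the two step functions. A pairing may match arguments within one
form or across the two forms; both kinds are treated alike by pairing the disjoint union of the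
index sets. -/
lemma integral_form_mul_form (hB : IsPreBrownianReal B P) (q q' : Subdivision T) {n n' k : ℕ}
    (hk : n + n' = 2 * k) (A : (Fin n → Fin q.num) → ℝ) (A' : (Fin n' → Fin q'.num) → ℝ) :
    ∫ ω, q.form B A ω * q'.form B A' ω ∂P = stdMoment (2 * k) / (2 * k).factorial *
      ∑ e : Fin k × Bool ≃ Fin n ⊕ Fin n',
        ∫ r, q.step A (fun l => r (e.symm (Sum.inl l)).1) *
          q'.step A' (fun l => r (e.symm (Sum.inr l)).1)
        ∂(Measure.pi fun _ : Fin k => volume.restrict (Set.Ioc 0 T)) := by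
  have : IsProbabilityMeasure P := hB.isGaussianProcess.isProbabilityMeasure
  have h1 : ∀ (q : Subdivision T) (j : Fin q.num), (q.ends j).1 ≤ (q.ends j).2 :=
    fun q j => (q.pt_lt j j.isLt).le
  have h0 : ∀ (q : Subdivision T) (j : Fin q.num), 0 ≤ (q.ends j).1 :=
    fun q j => q.pt_nonneg j.isLt.le
  have h2 : ∀ (q : Subdivision T) (j : Fin q.num), (q.ends j).2 ≤ T :=
    fun q j => q.pt_le j.isLt
  have hint : ∀ (i : Fin n → Fin q.num) (i' : Fin n' → Fin q'.num), Integrable (fun ω =>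
      (∏ l, slopeRV B (q.ends (i l)) ω) * ∏ l, slopeRV B (q'.ends (i' l)) ω) P := fun i i' =>
    (memLp_two_prod_of_hasGaussianLaw _ fun l =>
      (isGaussianProcess_slopeRV hB).hasGaussianLaw_eval _).integrable_mul
    (memLp_two_prod_of_hasGaussianLaw _ fun l =>
      (isGaussianProcess_slopeRV hB).hasGaussianLaw_eval _)
  have hintr : ∀ (e : Fin k × Bool ≃ Fin n ⊕ Fin n') (i : Fin n → Fin q.num)
      (i' : Fin n' → Fin q'.num), Integrable (fun r : Fin k → ℝ =>
        (∏ l, unifDensity (q.ends (i l)) (r (e.symm (Sum.inl l)).1)) *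
          ∏ l, unifDensity (q'.ends (i' l)) (r (e.symm (Sum.inr l)).1))
        (Measure.pi fun _ : Fin k => volume.restrict (Set.Ioc 0 T)) := by
    intro e i i'
    refine Integrable.of_bound (C := (∏ l, 1 / ((q.ends (i l)).2 - (q.ends (i l)).1)) *
      ∏ l, 1 / ((q'.ends (i' l)).2 - (q'.ends (i' l)).1)) (Measurable.aestronglyMeasurable ?_)
      (Filter.Eventually.of_forall fun r => ?_)
    · refine Measurable.mul ?_ ?_ <;>
      exact Finset.measurable_fun_prod _ fun l _ =>
        (measurable_unifDensity _).comp (measurable_pi_apply _)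
    · rw [norm_mul, Real.norm_eq_abs, Real.norm_eq_abs, Finset.abs_prod, Finset.abs_prod]
      refine mul_le_mul ?_ ?_ (Finset.prod_nonneg fun _ _ => abs_nonneg _)
        (Finset.prod_nonneg fun l _ => one_div_nonneg.2 (sub_nonneg.2 (h1 _ _)))
      all_goals
        refine Finset.prod_le_prod (fun _ _ => abs_nonneg _) fun l _ => ?_
        rw [abs_of_nonneg (unifDensity_nonneg (h1 _ _) _)]
        exact unifDensity_le (h1 _ _) _
  have hterm : ∀ (i : Fin n → Fin q.num) (i' : Fin n' → Fin q'.num),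
      ∫ ω, (∏ l, slopeRV B (q.ends (i l)) ω) * ∏ l, slopeRV B (q'.ends (i' l)) ω ∂P =
      stdMoment (2 * k) / (2 * k).factorial * ∑ e : Fin k × Bool ≃ Fin n ⊕ Fin n',
        ∫ r, (∏ l, unifDensity (q.ends (i l)) (r (e.symm (Sum.inl l)).1)) *
          ∏ l, unifDensity (q'.ends (i' l)) (r (e.symm (Sum.inr l)).1)
        ∂(Measure.pi fun _ : Fin k => volume.restrict (Set.Ioc 0 T)) := by
    intro i i'
    have h := integral_prod_slopeRV hB (T := T) (k := k) (ι := Fin n ⊕ Fin n')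
      (z := Sum.elim (fun l => q.ends (i l)) fun l => q'.ends (i' l)) (by simpa)
      (by rintro (l | l) <;> simp [h0]) (by rintro (l | l) <;> simp [h1])
      (by rintro (l | l) <;> simp [h2])
    simpa only [Fintype.prod_sum_type, Sum.elim_inl, Sum.elim_inr] using h
  have hl : ∫ ω, q.form B A ω * q'.form B A' ω ∂P =
      ∑ i, ∑ i', A i * A' i' * ∫ ω, (∏ l, slopeRV B (q.ends (i l)) ω) *
        ∏ l, slopeRV B (q'.ends (i' l)) ω ∂P := by
    simp_rw [form, Finset.sum_mul_sum, mul_mul_mul_comm]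
    rw [integral_finsetSum _ fun i _ => integrable_finsetSum _ fun i' _ =>
      (hint i i').const_mul _]
    refine Finset.sum_congr rfl fun i _ => ?_
    rw [integral_finsetSum _ fun i' _ => (hint i i').const_mul _]
    simp_rw [integral_const_mul]
  have hr : ∀ e : Fin k × Bool ≃ Fin n ⊕ Fin n',
      ∫ r, q.step A (fun l => r (e.symm (Sum.inl l)).1) *
          q'.step A' (fun l => r (e.symm (Sum.inr l)).1)
        ∂(Measure.pi fun _ : Fin k => volume.restrict (Set.Ioc 0 T)) =
      ∑ i, ∑ i', A i * A' i' *
        ∫ r, (∏ l, unifDensity (q.ends (i l)) (r (e.symm (Sum.inl l)).1)) *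
          ∏ l, unifDensity (q'.ends (i' l)) (r (e.symm (Sum.inr l)).1)
        ∂(Measure.pi fun _ : Fin k => volume.restrict (Set.Ioc 0 T)) := by
    intro e
    simp_rw [step, Finset.sum_mul_sum, mul_mul_mul_comm]
    rw [integral_finsetSum _ fun i _ => integrable_finsetSum _ fun i' _ =>
      (hintr e i i').const_mul _]
    refine Finset.sum_congr rfl fun i _ => ?_
    rw [integral_finsetSum _ fun i' _ => (hintr e i i').const_mul _]
    simp_rw [integral_const_mul]
  rw [hl]
  simp_rw [hterm, hr, Finset.mul_sum]
  symm
  rw [Finset.sum_comm]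
  refine Finset.sum_congr rfl fun i _ => ?_
  rw [Finset.sum_comm]
  exact Finset.sum_congr rfl fun i' _ => Finset.sum_congr rfl fun e _ => by ring

end Subdivision

/-! ### Limits of the step functions -/

/-- Each diagonal `r i = r j` is a proper subspace, hence a null set. Injectivity ensures that,
after collapsing by a pairing, coordinates can coincide only when they belong to the same pair. -/
lemma ae_injective_and_mem_Ioc (T : ℝ) (k : ℕ) :
    ∀ᵐ r : Fin k → ℝ ∂(Measure.pi fun _ : Fin k => (volume : Measure ℝ).restrict (Set.Ioc 0 T)),
      Function.Injective r ∧ ∀ j, r j ∈ Set.Ioc 0 T := by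
  rw [← Measure.restrict_pi_pi, ae_restrict_iff' (MeasurableSet.univ_pi fun _ => measurableSet_Ioc)]
  have h : ∀ᵐ r : Fin k → ℝ, ∀ i j, i ≠ j → r i ≠ r j := by
    refine ae_all_iff.2 fun i => ae_all_iff.2 fun j => ?_
    by_cases hij : i = j
    · simp [hij]
    obtain ⟨L, hL⟩ : ∃ L : (Fin k → ℝ) →ₗ[ℝ] ℝ, ∀ x, L x = x i - x j :=
      ⟨LinearMap.proj (R := ℝ) (φ := fun _ : Fin k => ℝ) i - LinearMap.proj j, fun x => rfl⟩
    have h0 := Measure.addHaar_submodule (volume : Measure (Fin k → ℝ)) (LinearMap.ker L) (by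
      intro h
      -- The kernel is proper, because the coordinate difference is `1` at the `i`-th unit vector.
      have h1 : (Pi.single i 1 : Fin k → ℝ) ∈ LinearMap.ker L := h ▸ Submodule.mem_top
      rw [LinearMap.mem_ker, hL] at h1
      simp [Ne.symm hij] at h1)
    rw [ae_iff]
    refine measure_mono_null ?_ h0
    intro r hr
    have hr' : r i = r j := by
      by_contra hne
      exact hr fun _ => hne
    exact (hL r).trans (sub_eq_zero.2 hr')
  filter_upwards [h] with r hr hmem
  exact ⟨fun i j hij => by_contra fun hne => hr i j hne hij, fun j => hmem j trivial⟩

instance isFiniteMeasure_pi_restrict_Ioc (T : ℝ) (k : ℕ) : IsFiniteMeasure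
    (Measure.pi fun _ : Fin k => (volume : Measure ℝ).restrict (Set.Ioc 0 T)) := by
  infer_instance

/-- The coordinates `r (p 0), …, r (p (n - 1))` are decreasing when ties between equal indices
are broken by `u`. -/
def TieBroken {n k : ℕ} (p : Fin n → Fin k) (r : Fin k → ℝ) (u : Fin n → ℝ) : Prop :=
  ∀ i j, i < j → r (p j) < r (p i) ∨ p i = p j ∧ u j ≤ u i

open Classical in
/-- The limit of the step functions at `r ∘ p`. -/
noncomputable def limitStep {n k : ℕ} (φ : (Fin n → ℝ) → ℝ) (p : Fin n → Fin k)
    (r : Fin k → ℝ) : ℝ :=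
  ∫ u in cube n, if TieBroken p r u then φ fun l => r (p l) else 0

namespace Subdivision

variable {T : ℝ}

/-- The coefficients of the integral of `φ` along a polygonal path. -/
noncomputable def coef (q : Subdivision T) {n : ℕ} (φ : (Fin n → ℝ) → ℝ)
    (i : Fin n → Fin q.num) : ℝ :=
  boxIntegral T φ q.pt fun l => i l

open Classical in
/-- The index of the cell that contains `x`. -/
noncomputable def cellOf (q : Subdivision T) (x : ℝ) : ℕ :=
  if h : ∃ j : Fin q.num, x ∈ Set.Ioc (q.pt j) (q.pt (j + 1)) then h.choose else 0

lemma cellOf_lt (q : Subdivision T) {x : ℝ} (hx : x ∈ Set.Ioc 0 T) : q.cellOf x < q.num := by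
  unfold cellOf
  rw [dif_pos (q.exists_mem_cell hx)]
  exact Fin.isLt _

lemma mem_cellOf (q : Subdivision T) {x : ℝ} (hx : x ∈ Set.Ioc 0 T) :
    x ∈ Set.Ioc (q.pt (q.cellOf x)) (q.pt (q.cellOf x + 1)) := by
  unfold cellOf
  rw [dif_pos (q.exists_mem_cell hx)]
  exact (q.exists_mem_cell hx).choose_spec

/-- The point that divides the cell of `x` in the ratio `u : 1 - u`. -/
noncomputable def sample (q : Subdivision T) (x u : ℝ) : ℝ :=
  q.pt (q.cellOf x) + (q.pt (q.cellOf x + 1) - q.pt (q.cellOf x)) * u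

lemma sample_le_sample_iff (q : Subdivision T) {x u v : ℝ} (hx : x ∈ Set.Ioc 0 T) :
    q.sample x u ≤ q.sample x v ↔ u ≤ v := by
  have := sub_pos.2 (q.pt_lt _ (q.cellOf_lt hx))
  unfold sample
  rw [add_le_add_iff_left, mul_le_mul_iff_right₀ this]

lemma abs_sample_sub_le (q : Subdivision T) {x u : ℝ} (hx : x ∈ Set.Ioc 0 T)
    (hu : u ∈ Set.Ioc (0 : ℝ) 1) : |q.sample x u - x| ≤ q.mesh := by
  have h1 := q.sub_le_mesh (q.cellOf_lt hx)
  have h2 := q.mem_cellOf hx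
  have h3 := sub_pos.2 (q.pt_lt _ (q.cellOf_lt hx))
  have h4 : (q.pt (q.cellOf x + 1) - q.pt (q.cellOf x)) * u ≤
      (q.pt (q.cellOf x + 1) - q.pt (q.cellOf x)) * 1 := by
    gcongr
    exact hu.2
  have h5 := mul_pos h3 hu.1
  rw [abs_le]
  unfold sample
  constructor <;> linarith [h2.1, h2.2]

lemma sample_mem_Icc (q : Subdivision T) {x u : ℝ} (hx : x ∈ Set.Ioc 0 T)
    (hu : u ∈ Set.Ioc (0 : ℝ) 1) : q.sample x u ∈ Set.Icc 0 T := by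
  have h1 := q.pt_nonneg (q.cellOf_lt hx).le
  have h2 := q.pt_le (q.cellOf_lt hx)
  have h3 := sub_pos.2 (q.pt_lt _ (q.cellOf_lt hx))
  have h4 : (q.pt (q.cellOf x + 1) - q.pt (q.cellOf x)) * u ≤
      (q.pt (q.cellOf x + 1) - q.pt (q.cellOf x)) * 1 := by
    gcongr
    exact hu.2
  have h5 := mul_pos h3 hu.1
  unfold sample
  constructor <;> linarith

lemma tendsto_mesh : Filter.Tendsto (fun q : Subdivision T => (q.mesh : ℝ)) (fine T) (nhds 0) := by
  have h : Filter.Tendsto (mesh (T := T)) (fine T) (nhds 0) := Filter.tendsto_comap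
  rw [← NNReal.coe_zero]
  exact NNReal.tendsto_coe.2 h

lemma tendsto_sample {x u : ℝ} (hx : x ∈ Set.Ioc 0 T) (hu : u ∈ Set.Ioc (0 : ℝ) 1) :
    Filter.Tendsto (fun q : Subdivision T => q.sample x u) (fine T) (nhds x) := by
  rw [tendsto_iff_dist_tendsto_zero]
  refine squeeze_zero (fun _ => dist_nonneg) (fun q => ?_) tendsto_mesh
  rw [Real.dist_eq]
  exact q.abs_sample_sub_le hx hu

/-- Exactly one box contains `x`, and dividing its integral by its volume leaves the average;
`sample` parametrises that box by the unit cube. -/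
lemma step_coef (q : Subdivision T) {n : ℕ} {φ : (Fin n → ℝ) → ℝ} (hφ : Continuous φ)
    {x : Fin n → ℝ} (hx : ∀ l, x l ∈ Set.Ioc 0 T) :
    q.step (q.coef φ) x = ∫ u in cube n, cut T φ fun l => q.sample (x l) (u l) := by
  let i : Fin n → Fin q.num := fun l => ⟨q.cellOf (x l), q.cellOf_lt (hx l)⟩
  have hi : ∀ l, x l ∈ Set.Ioc (q.pt (i l)) (q.pt (i l + 1)) := fun l => q.mem_cellOf (hx l)
  have hlt : ∀ l, q.pt (i l) < q.pt (i l + 1) := fun l => q.pt_lt _ (i l).isLt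
  have hne : ∏ l, (q.pt (i l + 1) - q.pt (i l)) ≠ 0 :=
    Finset.prod_ne_zero_iff.2 fun l _ => (sub_pos.2 (hlt l)).ne'
  unfold step
  rw [Finset.sum_eq_single i]
  · unfold coef
    rw [boxIntegral_eq T hφ hlt]
    have h1 : ∏ l, unifDensity (q.ends (i l)) (x l) = (∏ l, (q.pt (i l + 1) - q.pt (i l)))⁻¹ := by
      rw [← Finset.prod_inv_distrib]
      refine Finset.prod_congr rfl fun l _ => ?_
      unfold unifDensity ends
      rw [Set.indicator_of_mem (hi l)]
      simp
    rw [h1, mul_right_comm, mul_inv_cancel₀ hne, one_mul]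
    rfl
  · intro i' _ hi'
    obtain ⟨l, hl⟩ := Function.ne_iff.1 hi'
    rw [Finset.prod_eq_zero (Finset.mem_univ l), mul_zero]
    unfold unifDensity ends
    rw [Set.indicator_of_notMem, zero_div]
    exact fun h => hl (q.eq_of_mem_cell h (hi l))
  · simp

lemma abs_step_coef_le (q : Subdivision T) {n : ℕ} {φ : (Fin n → ℝ) → ℝ} (hφ : Continuous φ)
    {K : ℝ} (hK : ∀ t, |cut T φ t| ≤ K) {x : Fin n → ℝ} (hx : ∀ l, x l ∈ Set.Ioc 0 T) :
    |q.step (q.coef φ) x| ≤ K := by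
  rw [q.step_coef hφ hx]
  have h := norm_setIntegral_le_of_norm_le_const (μ := volume) (s := cube n) (C := K)
    (f := fun u : Fin n → ℝ => cut T φ fun l => q.sample (x l) (u l)) (by simp [volume_cube])
    fun u _ => hK _
  simpa [Measure.real, volume_cube] using h

/-- Coordinates from different pairs have different limits, so a fine partition orders their samples
as `r` does. Coordinates from the same pair lie in the same cell for every partition, so their order
is that of `u`. -/
lemma eventually_antitone_sample_iff {n k : ℕ} (p : Fin n → Fin k) {r : Fin k → ℝ}
    (hr : Function.Injective r) (hmem : ∀ j, r j ∈ Set.Ioc 0 T) {u : Fin n → ℝ}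
    (hu : u ∈ cube n) :
    ∀ᶠ q in fine T, Antitone (fun l => q.sample (r (p l)) (u l)) ↔ TieBroken p r u := by
  have h : ∀ i j : Fin n, ∀ᶠ q in fine T,
      (q.sample (r (p j)) (u j) ≤ q.sample (r (p i)) (u i) ↔
        r (p j) < r (p i) ∨ p i = p j ∧ u j ≤ u i) := by
    intro i j
    have hi := tendsto_sample (T := T) (hmem (p i)) (hu i trivial)
    have hj := tendsto_sample (T := T) (hmem (p j)) (hu j trivial)
    by_cases hp : p i = p j
    · refine Filter.Eventually.of_forall fun q => ?_
      rw [hp, q.sample_le_sample_iff (hmem _)]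
      simp
    rcases lt_or_gt_of_ne (hr.ne hp) with h | h
    · filter_upwards [hi.eventually_lt hj h] with q hq
      simp [hp, hq.not_ge, h.not_gt]
    · filter_upwards [hj.eventually_lt hi h] with q hq
      simp [hq.le, h]
  filter_upwards [Filter.eventually_all.2 fun i => Filter.eventually_all.2 fun j => h i j] with q hq
  constructor
  · intro ha i j hij
    exact (hq i j).1 (ha hij.le)
  · intro ha i j hij
    rcases hij.eq_or_lt with rfl | hlt
    · exact le_rfl
    · exact (hq i j).2 (ha i j hlt)

/-- Dominated convergence over the cube: whether the sample point lies in the simplex is eventually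
decided by `TieBroken`, and `φ` is continuous at the common limit. Points on diagonals thus receive
a fraction of `φ`, which is the source of the Stratonovich factors `1/2` and `1/4`. -/
lemma tendsto_step_coef {n k : ℕ} {φ : (Fin n → ℝ) → ℝ} (hφ : Continuous φ) (p : Fin n → Fin k)
    {r : Fin k → ℝ} (hr : Function.Injective r) (hmem : ∀ j, r j ∈ Set.Ioc 0 T) :
    Filter.Tendsto (fun q : Subdivision T => q.step (q.coef φ) fun l => r (p l)) (fine T)
      (nhds (limitStep φ p r)) := by
  classical
  obtain ⟨K, hK0, hK⟩ := exists_abs_cut_le T hφ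
  simp_rw [fun q : Subdivision T => q.step_coef hφ (x := fun l => r (p l)) fun l => hmem (p l)]
  unfold limitStep
  refine tendsto_integral_filter_of_dominated_convergence (fun _ => K) ?_ ?_ ?_ ?_
  · refine Filter.Eventually.of_forall fun q => Measurable.aestronglyMeasurable ?_
    refine (measurable_cut T hφ).comp (measurable_pi_lambda _ fun l => ?_)
    unfold sample
    fun_prop
  · exact Filter.Eventually.of_forall fun q => Filter.Eventually.of_forall fun u => hK _
  · exact integrable_const K
  · filter_upwards [ae_restrict_mem (measurableSet_cube n)] with u hu
    have h1 : Filter.Tendsto (fun q : Subdivision T => φ fun l => q.sample (r (p l)) (u l))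
        (fine T) (nhds (φ fun l => r (p l))) :=
      (hφ.tendsto _).comp (tendsto_pi_nhds.2 fun l => tendsto_sample (hmem (p l)) (hu l trivial))
    have h2 : ∀ᶠ q in fine T, (cut T φ fun l => q.sample (r (p l)) (u l)) =
        if TieBroken p r u then φ fun l => q.sample (r (p l)) (u l) else 0 := by
      filter_upwards [eventually_antitone_sample_iff p hr hmem hu] with q hq
      unfold cut
      rw [Set.indicator_apply]
      refine if_congr ?_ rfl rfl
      rw [← hq]
      exact ⟨fun h => h.1, fun h => ⟨h, fun l => q.sample_mem_Icc (hmem _) (hu l trivial)⟩⟩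
    refine Filter.Tendsto.congr' (h2.mono fun q hq => hq.symm) ?_
    by_cases ht : TieBroken p r u
    · simpa [ht] using h1
    · simpa [ht] using tendsto_const_nhds

/-- The limit of the mixed second moments of two iterated integrals. -/
noncomputable def _root_.VolterraCubature.limitMoment (T : ℝ) {n n' : ℕ} (k : ℕ)
    (φ : (Fin n → ℝ) → ℝ) (ψ : (Fin n' → ℝ) → ℝ) : ℝ :=
  stdMoment (2 * k) / (2 * k).factorial * ∑ e : Fin k × Bool ≃ Fin n ⊕ Fin n',
    ∫ r, limitStep φ (fun l => (e.symm (Sum.inl l)).1) r *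
      limitStep ψ (fun l => (e.symm (Sum.inr l)).1) r
    ∂(Measure.pi fun _ : Fin k => volume.restrict (Set.Ioc 0 T))

/-- The partitions tend to zero mesh separately, with limit along the product filter; a limit along
the diagonal alone would not give the Cauchy property. -/
lemma tendsto_integral_form_mul_form {Ω : Type*} [MeasurableSpace Ω] {P : Measure Ω}
    {B : ℝ≥0 → Ω → ℝ} (hB : IsPreBrownianReal B P) {n n' k : ℕ} (hk : n + n' = 2 * k)
    {φ : (Fin n → ℝ) → ℝ} (hφ : Continuous φ) {ψ : (Fin n' → ℝ) → ℝ} (hψ : Continuous ψ) :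
    Filter.Tendsto (fun z : Subdivision T × Subdivision T =>
      ∫ ω, z.1.form B (z.1.coef φ) ω * z.2.form B (z.2.coef ψ) ω ∂P) (fine T ×ˢ fine T)
      (nhds (limitMoment T k φ ψ)) := by
  obtain ⟨K, hK0, hK⟩ := exists_abs_cut_le T hφ
  obtain ⟨K', hK0', hK'⟩ := exists_abs_cut_le T hψ
  simp_rw [fun z : Subdivision T × Subdivision T =>
    integral_form_mul_form hB z.1 z.2 hk (z.1.coef φ) (z.2.coef ψ)]
  unfold limitMoment
  refine Filter.Tendsto.const_mul _ (tendsto_finsetSum _ fun e _ => ?_)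
  refine tendsto_integral_filter_of_dominated_convergence (fun _ => K * K') ?_ ?_ ?_ ?_
  · refine Filter.Eventually.of_forall fun z => Measurable.aestronglyMeasurable ?_
    exact ((z.1.measurable_step _).comp (measurable_pi_lambda _ fun l => measurable_pi_apply _)).mul
      ((z.2.measurable_step _).comp (measurable_pi_lambda _ fun l => measurable_pi_apply _))
  · refine Filter.Eventually.of_forall fun z => ?_
    filter_upwards [ae_injective_and_mem_Ioc T k] with r hr
    rw [norm_mul]
    exact mul_le_mul (z.1.abs_step_coef_le hφ hK fun l => hr.2 _)
      (z.2.abs_step_coef_le hψ hK' fun l => hr.2 _) (norm_nonneg _) hK0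
  · exact integrable_const _
  · filter_upwards [ae_injective_and_mem_Ioc T k] with r hr
    exact ((tendsto_step_coef hφ _ hr.1 hr.2).comp Filter.tendsto_fst).mul
      ((tendsto_step_coef hψ _ hr.1 hr.2).comp Filter.tendsto_snd)

end Subdivision

/-! ### Existence of multiple Stratonovich integrals -/

/-- Expanding the square gives `‖x a - x b‖² → L - 2 L + L = 0`, so the family is Cauchy and
completeness applies. -/
lemma exists_tendsto_of_tendsto_inner {α E : Type*} [NormedAddCommGroup E]
    [InnerProductSpace ℝ E] [CompleteSpace E] {l : Filter α} [l.NeBot] {x : α → E} {L : ℝ}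
    (h : Filter.Tendsto (fun z : α × α => inner ℝ (x z.1) (x z.2)) (l ×ˢ l) (nhds L)) :
    ∃ y, Filter.Tendsto x l (nhds y) := by
  have hd : Filter.Tendsto (fun a => inner ℝ (x a) (x a)) l (nhds L) :=
    h.comp (Filter.tendsto_id.prodMk Filter.tendsto_id)
  have h1 : Filter.Tendsto (fun z : α × α => ‖x z.1 - x z.2‖ ^ 2) (l ×ˢ l) (nhds 0) := by
    have h2 := ((hd.comp Filter.tendsto_fst).sub (h.const_mul 2)).add (hd.comp Filter.tendsto_snd)
    have h3 : L - 2 * L + L = 0 := by ring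
    rw [h3] at h2
    refine h2.congr fun z => ?_
    simp only [Function.comp_apply]
    rw [norm_sub_sq_real, real_inner_self_eq_norm_sq, real_inner_self_eq_norm_sq]
  have h4 : Filter.Tendsto (fun z : α × α => dist (x z.1) (x z.2)) (l ×ˢ l) (nhds 0) := by
    have h5 := h1.sqrt
    rw [Real.sqrt_zero] at h5
    refine h5.congr fun z => ?_
    rw [Real.sqrt_sq (norm_nonneg _), dist_eq_norm]
  have h6 : Cauchy (Filter.map x l) := by
    rw [cauchy_map_iff]
    exact ⟨inferInstance, tendsto_uniformity_iff_dist_tendsto_zero.2 h4⟩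
  exact CompleteSpace.complete h6

lemma pathIntegral_polygon {Ω : Type*} {B : ℝ≥0 → Ω → ℝ} {T : ℝ} {n : ℕ}
    {φ : (Fin n → ℝ) → ℝ} (q : Subdivision T) (hφ : Continuous φ) (ω : Ω) :
    pathIntegral T φ (polygon q.num q.pt fun t => B t ω) = q.form B (q.coef φ) ω := by
  unfold polygon
  rw [pathIntegral_pwLinear q.pt_lt hφ]
  rfl

section Stratonovich

variable {Ω : Type*} [MeasurableSpace Ω] {P : Measure Ω} {B : ℝ≥0 → Ω → ℝ} {T : ℝ} {n : ℕ}
  {φ : (Fin n → ℝ) → ℝ}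

/-- The criterion above is applied in `L²` with `φ` in both factors, so that `n + n = 2 n` arguments
are paired. -/
lemma exists_isStratonovichIntegral (hB : IsPreBrownianReal B P) (hT : 0 < T)
    (hφ : Continuous φ) : ∃ S, IsStratonovichIntegral P B T φ S := by
  have : Fact (0 < T) := ⟨hT⟩
  let x : Subdivision T → Lp ℝ 2 P := fun q => (q.memLp_form hB (q.coef φ)).toLp _
  have hx : ∀ q, x q =ᵐ[P] q.form B (q.coef φ) := fun q => MemLp.coeFn_toLp _
  have hin : Filter.Tendsto (fun z : Subdivision T × Subdivision T => inner ℝ (x z.1) (x z.2))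
      (Subdivision.fine T ×ˢ Subdivision.fine T) (nhds (limitMoment T n φ φ)) := by
    refine (Subdivision.tendsto_integral_form_mul_form hB (k := n) (by ring) hφ hφ).congr
      fun z => ?_
    rw [L2.inner_def]
    refine integral_congr_ae ?_
    filter_upwards [hx z.1, hx z.2] with ω h1 h2
    simp [h1, h2, mul_comm]
  obtain ⟨y, hy⟩ := exists_tendsto_of_tendsto_inner hin
  refine ⟨y, Lp.memLp y, fun ε hε => ?_⟩
  have h1 := (EMetric.tendsto_nhds.1 hy) ε hε
  obtain ⟨δ, hδ, h2⟩ := (Subdivision.hasBasis_fine T).eventually_iff.1 h1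
  refine ⟨δ, hδ, fun m s hs hmesh => ?_⟩
  let q : Subdivision T := ⟨m, s, hs⟩
  have h3 := (h2 ((q.mesh_lt_iff hδ).2 hmesh)).le
  rw [Lp.edist_def] at h3
  refine le_trans (le_of_eq (eLpNorm_congr_ae ?_)) h3
  filter_upwards [hx q] with ω hω
  rw [Pi.sub_apply, hω, ← pathIntegral_polygon q hφ ω]

/-- On a probability space convergence in mean square implies convergence in `L¹`, hence of the
expectations. -/
lemma tendsto_integral_form (hB : IsPreBrownianReal B P) (hφ : Continuous φ) {S : Ω → ℝ}
    (hS : IsStratonovichIntegral P B T φ S) :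
    Filter.Tendsto (fun q : Subdivision T => ∫ ω, q.form B (q.coef φ) ω ∂P)
      (Subdivision.fine T) (nhds (∫ ω, S ω ∂P)) := by
  have : IsProbabilityMeasure P := hB.isGaussianProcess.isProbabilityMeasure
  refine tendsto_integral_of_L1' S hS.1.aestronglyMeasurable
    (Filter.Eventually.of_forall fun q => (q.memLp_form hB _).integrable one_le_two) ?_
  rw [ENNReal.tendsto_nhds_zero]
  intro ε hε
  obtain ⟨δ, hδ, h⟩ := hS.2 ε hε
  have hb := (Subdivision.hasBasis_fine T).mem_of_mem (i := ⟨δ, hδ.le⟩) hδ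
  filter_upwards [hb] with q hq
  have h1 := h q.num q.pt q.isPartition ((q.mesh_lt_iff (δ := ⟨δ, hδ.le⟩) hδ).1 hq)
  simp_rw [pathIntegral_polygon q hφ] at h1
  refine le_trans (eLpNorm_le_eLpNorm_of_exponent_le one_le_two ?_) h1
  exact ((q.memLp_form hB _).sub hS.1).aestronglyMeasurable

lemma integral_eq_zero_of_odd (hB : IsPreBrownianReal B P) (hT : 0 < T) (hφ : Continuous φ)
    {S : Ω → ℝ} (hS : IsStratonovichIntegral P B T φ S) (hn : Odd n) : ∫ ω, S ω ∂P = 0 := by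
  have : Fact (0 < T) := ⟨hT⟩
  have h := tendsto_integral_form hB hφ hS
  simp_rw [fun q : Subdivision T => q.integral_form_of_odd hB hn (q.coef φ)] at h
  exact tendsto_nhds_unique h tendsto_const_nhds

lemma simplex_zero : simplex T 0 = Set.univ := by
  ext t
  simp [simplex, Antitone]

lemma limitStep_one {k : ℕ} (p : Fin 0 → Fin k) (r : Fin k → ℝ) :
    limitStep (fun _ => 1) p r = 1 := by
  simp [limitStep, TieBroken, Measure.real, volume_cube]

lemma integral_eq_sum_limitStep (hB : IsPreBrownianReal B P) (hT : 0 < T) (hφ : Continuous φ)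
    {S : Ω → ℝ} (hS : IsStratonovichIntegral P B T φ S) {k : ℕ} (hn : n = 2 * k) :
    ∫ ω, S ω ∂P = stdMoment (2 * k) / (2 * k).factorial *
      ∑ e : Fin k × Bool ≃ Fin n ⊕ Fin 0,
        ∫ r, limitStep φ (fun l => (e.symm (Sum.inl l)).1) r
        ∂(Measure.pi fun _ : Fin k => volume.restrict (Set.Ioc 0 T)) := by
  have : Fact (0 < T) := ⟨hT⟩
  have h := tendsto_integral_form hB hφ hS
  -- The expectation is treated as a mixed second moment whose second factor is the iterated
  -- integral of order `0` of the constant `1`. That form is identically `1`, so no separate limit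
  -- theorem is needed.
  have h2 := (Subdivision.tendsto_integral_form_mul_form hB (n' := 0) (k := k) (by lia) hφ
    (ψ := fun _ => 1) continuous_const).comp
    (Filter.tendsto_id.prodMk (Filter.tendsto_id (x := Subdivision.fine T)))
  have h3 : ∀ (q : Subdivision T) (ω : Ω), q.form B (q.coef fun _ : Fin 0 → ℝ => 1) ω = 1 := by
    intro q ω
    have h4 : volume (Set.univ : Set (Fin 0 → ℝ)) = 1 := by
      rw [← volume_cube 0]
      congr 1
      ext u
      simp only [cube, Set.mem_univ_pi, Set.mem_univ, IsEmpty.forall_iff]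
    simp [Subdivision.form, Subdivision.coef, boxIntegral, simplex_zero, Measure.real, h4]
  simp only [Function.comp_def, id_eq, h3, mul_one] at h2
  rw [tendsto_nhds_unique h h2]
  simp [limitMoment, limitStep_one]

lemma isStratonovichIntegral_stratonovich (hB : IsPreBrownianReal B P) (hT : 0 < T)
    (hφ : Continuous φ) : IsStratonovichIntegral P B T φ (stratonovich P B T φ) := by
  classical
  have h := exists_isStratonovichIntegral hB hT hφ
  unfold stratonovich
  rw [dif_pos h]
  exact h.choose_spec

end Stratonovich

/-! ### Iterated integrals of bounded functions with bounded support -/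

/-- `F` is measurable and bounded, and vanishes outside a bounded set. -/
structure BoundedSupported {n : ℕ} (F : (Fin n → ℝ) → ℝ) : Prop where
  meas : Measurable F
  bound : ∃ K, ∀ t, |F t| ≤ K
  supp : ∃ R, ∀ t, F t ≠ 0 → ∀ l, |t l| ≤ R

namespace BoundedSupported

variable {n : ℕ}

lemma integrable {F : (Fin n → ℝ) → ℝ} (hF : BoundedSupported F) : Integrable F := by
  obtain ⟨K, hK⟩ := hF.bound
  obtain ⟨R, hR⟩ := hF.supp
  have hs : MeasurableSet (Set.univ.pi fun _ : Fin n => Set.Icc (-R) R) :=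
    MeasurableSet.univ_pi fun _ => measurableSet_Icc
  have h : F = (Set.univ.pi fun _ : Fin n => Set.Icc (-R) R).indicator F := by
    symm
    rw [Set.indicator_eq_self]
    intro t ht l _
    exact abs_le.1 (hR t ht l)
  rw [h, integrable_indicator_iff hs]
  refine Measure.integrableOn_of_bounded (M := K) ?_ hF.meas.aestronglyMeasurable
    (Filter.Eventually.of_forall hK)
  exact (isCompact_univ_pi fun _ => isCompact_Icc).measure_lt_top.ne

/-- Stability under slicing lets Fubini be iterated without further integrability checks. -/
lemma slice {F : (Fin (n + 1) → ℝ) → ℝ} (hF : BoundedSupported F) (x : ℝ) :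
    BoundedSupported fun y => F (Matrix.vecCons x y) := by
  obtain ⟨K, hK⟩ := hF.bound
  obtain ⟨R, hR⟩ := hF.supp
  refine ⟨hF.meas.comp ?_, ⟨K, fun t => hK _⟩, ⟨R, fun t ht l => ?_⟩⟩
  · exact measurable_pi_lambda _ fun i => Fin.cases (by simp) (fun j => by
      simpa using measurable_pi_apply j) i
  · simpa using hR _ ht l.succ

lemma integral_succ {F : (Fin (n + 1) → ℝ) → ℝ} (hF : BoundedSupported F) :
    ∫ t, F t = ∫ x : ℝ, ∫ y : Fin n → ℝ, F (Matrix.vecCons x y) := by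
  have hmp := (volume_preserving_piFinSuccAbove (fun _ : Fin (n + 1) => ℝ) 0).symm
  have heq : ∀ z : ℝ × (Fin n → ℝ),
      (MeasurableEquiv.piFinSuccAbove (fun _ : Fin (n + 1) => ℝ) 0).symm z =
        Matrix.vecCons z.1 z.2 := by
    intro z
    simp [MeasurableEquiv.piFinSuccAbove_symm_apply, Fin.insertNthEquiv, Matrix.vecCons]
  rw [← hmp.integral_comp']
  simp_rw [heq]
  refine integral_prod _ ?_
  have := hmp.integrable_comp_of_integrable hF.integrable
  refine this.congr (Filter.Eventually.of_forall fun z => ?_)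
  rw [Function.comp_apply, heq]

lemma integral_zero (F : (Fin 0 → ℝ) → ℝ) : ∫ t, F t = F ![] := by
  have h4 : volume (Set.univ : Set (Fin 0 → ℝ)) = 1 := by
    rw [← volume_cube 0]
    congr 1
    ext u
    simp only [cube, Set.mem_univ_pi, Set.mem_univ, IsEmpty.forall_iff]
  have h : F = fun _ => F ![] := by
    ext t
    rw [Subsingleton.elim t ![]]
  rw [h, integral_const]
  simp [Measure.real, h4]

lemma integral_one {F : (Fin 1 → ℝ) → ℝ} (hF : BoundedSupported F) :
    ∫ t, F t = ∫ x, F ![x] := by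
  rw [hF.integral_succ]
  simp_rw [integral_zero]

lemma integral_two {F : (Fin 2 → ℝ) → ℝ} (hF : BoundedSupported F) :
    ∫ t, F t = ∫ x, ∫ y, F ![x, y] := by
  rw [hF.integral_succ]
  simp_rw [fun x => (hF.slice x).integral_one]

lemma integral_two_symm {F : (Fin 2 → ℝ) → ℝ} (hF : BoundedSupported F) :
    ∫ t, F t = ∫ y, ∫ x, F ![x, y] := by
  have hmp := (measurePreserving_finTwoArrow (volume : Measure ℝ)).symm
  rw [volume_pi, ← hmp.integral_comp']
  have heq : ∀ z : ℝ × ℝ, MeasurableEquiv.finTwoArrow.symm z = ![z.1, z.2] := fun z => rfl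
  simp_rw [heq]
  refine integral_prod_symm (fun z : ℝ × ℝ => F ![z.1, z.2]) ?_
  exact hmp.integrable_comp_of_integrable hF.integrable

lemma integral_four {F : (Fin 4 → ℝ) → ℝ} (hF : BoundedSupported F) :
    ∫ t, F t = ∫ x, ∫ y, ∫ z, ∫ w, F ![x, y, z, w] := by
  rw [hF.integral_succ]
  simp_rw [fun x => (hF.slice x).integral_succ,
    fun x y => ((hF.slice x).slice y).integral_two]

lemma of_indicator {F : (Fin n → ℝ) → ℝ} {s : Set (Fin n → ℝ)} (hs : MeasurableSet s)
    (hF : Continuous F) {R : ℝ} (hR : ∀ t ∈ s, ∀ l, |t l| ≤ R) :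
    BoundedSupported (s.indicator F) := by
  refine ⟨hF.measurable.indicator hs, ?_, R, fun t ht => hR t (Set.mem_of_indicator_ne_zero ht)⟩
  have hc : IsCompact (Set.univ.pi fun _ : Fin n => Set.Icc (-R) R) :=
    isCompact_univ_pi fun _ => isCompact_Icc
  obtain ⟨K, hK⟩ := hc.exists_bound_of_continuousOn hF.continuousOn
  refine ⟨max K 0, fun t => ?_⟩
  by_cases ht : t ∈ s
  · rw [Set.indicator_of_mem ht]
    exact (hK t fun l _ => abs_le.1 (hR t ht l)).trans (le_max_left _ _)
  · simp [Set.indicator_of_notMem ht]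

end BoundedSupported

lemma integral_ite_Ioc {a b : ℝ} (hab : a ≤ b) (f : ℝ → ℝ) :
    (∫ x, if x ∈ Set.Ioc a b then f x else 0) = ∫ x in a..b, f x := by
  classical
  rw [intervalIntegral.integral_of_le hab, ← integral_indicator measurableSet_Ioc]
  congr 1
  ext x
  by_cases hx : x ∈ Set.Ioc a b
  · rw [if_pos hx, Set.indicator_of_mem hx]
  · rw [if_neg hx, Set.indicator_of_notMem hx]

/-! ### Expectations of double and quadruple Stratonovich integrals -/

lemma cube_indicator_le_ite (x y : ℝ) :
    (if x ∈ Set.Ioc (0 : ℝ) 1 ∧ y ∈ Set.Ioc (0 : ℝ) 1 ∧ y ≤ x then (1 : ℝ) else 0) =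
      if x ∈ Set.Ioc (0 : ℝ) 1 then (if y ∈ Set.Ioc 0 x then 1 else 0) else 0 := by
  by_cases hx : x ∈ Set.Ioc (0 : ℝ) 1
  · rw [if_pos hx]
    refine if_congr ⟨fun h => ⟨h.2.1.1, h.2.2⟩, fun h => ⟨hx, ⟨h.1, h.2.trans hx.2⟩, h.2⟩⟩ rfl rfl
  · rw [if_neg hx, if_neg fun h => hx h.1]

lemma integral_integral_cube_le :
    (∫ x : ℝ, ∫ y : ℝ, if x ∈ Set.Ioc (0 : ℝ) 1 ∧ y ∈ Set.Ioc (0 : ℝ) 1 ∧ y ≤ x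
      then (1 : ℝ) else 0) = 1 / 2 := by
  simp_rw [cube_indicator_le_ite]
  have h : ∀ x : ℝ, (∫ y : ℝ, if x ∈ Set.Ioc (0 : ℝ) 1 then
      (if y ∈ Set.Ioc 0 x then (1 : ℝ) else 0) else 0) =
      if x ∈ Set.Ioc (0 : ℝ) 1 then x else 0 := by
    intro x
    by_cases hx : x ∈ Set.Ioc (0 : ℝ) 1
    · simp_rw [if_pos hx]
      rw [integral_ite_Ioc hx.1.le]
      simp
    · simp_rw [if_neg hx]
      simp
  simp_rw [h]
  rw [integral_ite_Ioc zero_le_one]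
  simp

lemma setIntegral_cube_eq {n : ℕ} (p : (Fin n → ℝ) → Prop) [DecidablePred p] :
    (∫ u in cube n, if p u then (1 : ℝ) else 0) = ∫ u, (cube n ∩ {u | p u}).indicator 1 u := by
  rw [← integral_indicator (measurableSet_cube n)]
  congr 1
  ext u
  by_cases h1 : u ∈ cube n <;> by_cases h2 : p u <;> simp [h1, h2]

lemma boundedSupported_cube {n : ℕ} {s : Set (Fin n → ℝ)} (hs : MeasurableSet s) :
    BoundedSupported ((cube n ∩ s).indicator (1 : (Fin n → ℝ) → ℝ)) := by
  refine BoundedSupported.of_indicator (R := 1) ((measurableSet_cube n).inter hs)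
    continuous_one fun t ht l => ?_
  have := ht.1 l trivial
  rw [abs_of_pos this.1]
  exact this.2

lemma setIntegral_cube_two :
    (∫ u in cube 2, if u 1 ≤ u 0 then (1 : ℝ) else 0) = 1 / 2 := by
  classical
  have hm : MeasurableSet {u : Fin 2 → ℝ | u 1 ≤ u 0} :=
    measurableSet_le (measurable_pi_apply _) (measurable_pi_apply _)
  rw [setIntegral_cube_eq, (boundedSupported_cube hm).integral_two,
    ← integral_integral_cube_le]
  congr 1; ext x; congr 1; ext y
  rw [Set.indicator_apply]
  refine if_congr ?_ rfl rfl
  simp [cube, Fin.forall_fin_two, and_assoc]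

lemma setIntegral_cube_four :
    (∫ u in cube 4, if u 1 ≤ u 0 ∧ u 3 ≤ u 2 then (1 : ℝ) else 0) = 1 / 4 := by
  classical
  have hm : MeasurableSet {u : Fin 4 → ℝ | u 1 ≤ u 0 ∧ u 3 ≤ u 2} := by
    have h : ∀ i j : Fin 4, MeasurableSet {u : Fin 4 → ℝ | u i ≤ u j} := fun i j =>
      measurableSet_le (measurable_pi_apply _) (measurable_pi_apply _)
    convert (h 1 0).inter (h 3 2) using 1
    ext u
    simp
  rw [setIntegral_cube_eq, (boundedSupported_cube hm).integral_four]
  have h : ∀ x y z w : ℝ, (cube 4 ∩ {u : Fin 4 → ℝ | u 1 ≤ u 0 ∧ u 3 ≤ u 2}).indicator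
      (1 : (Fin 4 → ℝ) → ℝ) ![x, y, z, w] =
      (if x ∈ Set.Ioc (0 : ℝ) 1 ∧ y ∈ Set.Ioc (0 : ℝ) 1 ∧ y ≤ x then (1 : ℝ) else 0) *
      (if z ∈ Set.Ioc (0 : ℝ) 1 ∧ w ∈ Set.Ioc (0 : ℝ) 1 ∧ w ≤ z then (1 : ℝ) else 0) := by
    intro x y z w
    have hmul : ∀ (a b : Prop) [Decidable a] [Decidable b], (if a then (1 : ℝ) else 0) * (if b then (1 : ℝ) else 0) =
        if a ∧ b then 1 else 0 := by
      intro a b _ _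
      by_cases ha : a <;> by_cases hb : b <;> simp [ha, hb]
    rw [hmul, Set.indicator_apply]
    refine if_congr ?_ rfl rfl
    simp only [cube, Set.mem_inter_iff, Set.mem_univ_pi, Set.mem_ofPred_eq, Fin.forall_fin_succ]
    simp
    tauto
  simp_rw [h, integral_const_mul, integral_mul_const, integral_integral_cube_le]
  norm_num

/-- In the simplex an argument between two others of equal value would have to share that value. A
pairing that encloses an argument of another pair thus contributes nothing, so only pairings of
neighbours survive. -/
lemma limitStep_eq_zero {n k : ℕ} (φ : (Fin n → ℝ) → ℝ) {p : Fin n → Fin k} (r : Fin k → ℝ)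
    (hp : ∃ a b c, a < b ∧ b < c ∧ p a = p c ∧ p a ≠ p b) : limitStep φ p r = 0 := by
  classical
  obtain ⟨a, b, c, hab, hbc, hac, hne⟩ := hp
  unfold limitStep
  have h : ∀ u, ¬ TieBroken p r u := by
    intro u hu
    have h1 := hu a b hab
    have h2 := hu b c hbc
    rw [← hac] at h2
    rcases h1 with h1 | h1
    · rcases h2 with h2 | h2
      · exact lt_asymm h1 h2
      · exact hne h2.1.symm
    · exact hne h1.1
  simp [h]

-- The two pairs must be in decreasing order, and inside each pair the tie is broken correctly on
-- half of the square; independence of the two halves gives `1/4`.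
open Classical in
lemma limitStep_pairs (φ : (Fin 4 → ℝ) → ℝ) {i j : Fin 2} (hij : i ≠ j) (r : Fin 2 → ℝ) :
    limitStep φ ![i, i, j, j] r =
      if r j < r i then φ ![r i, r i, r j, r j] / 4 else 0 := by
  unfold limitStep
  have h : ∀ u : Fin 4 → ℝ, TieBroken ![i, i, j, j] r u ↔
      r j < r i ∧ (u 1 ≤ u 0 ∧ u 3 ≤ u 2) := by
    intro u
    simp only [TieBroken, Fin.forall_fin_succ]
    simp [hij]
    tauto
  have h2 : (fun l => r ((![i, i, j, j] : Fin 4 → Fin 2) l)) = ![r i, r i, r j, r j] := by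
    ext l
    fin_cases l <;> rfl
  simp_rw [h, h2]
  by_cases hr : r j < r i
  · simp only [hr, true_and, if_true]
    have h3 : ∀ u : Fin 4 → ℝ, (if u 1 ≤ u 0 ∧ u 3 ≤ u 2 then φ ![r i, r i, r j, r j] else 0) =
        φ ![r i, r i, r j, r j] * if u 1 ≤ u 0 ∧ u 3 ≤ u 2 then 1 else 0 := by
      intro u; split_ifs <;> simp
    simp_rw [h3]
    rw [integral_const_mul, setIntegral_cube_four]
    ring
  · simp [hr]

lemma limitStep_pair (φ : (Fin 2 → ℝ) → ℝ) (p : Fin 2 → Fin 1) (r : Fin 1 → ℝ) :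
    limitStep φ p r = φ ![r 0, r 0] / 2 := by
  classical
  unfold limitStep
  have h : ∀ u : Fin 2 → ℝ, TieBroken p r u ↔ u 1 ≤ u 0 := by
    intro u
    simp [TieBroken, Fin.forall_fin_two, Subsingleton.elim (p 0) (p 1)]
  have h2 : (fun l => r (p l)) = ![r 0, r 0] := by
    ext l
    rw [Subsingleton.elim (p l) 0]
    fin_cases l <;> rfl
  have h3 : ∀ u : Fin 2 → ℝ, (if u 1 ≤ u 0 then φ ![r 0, r 0] else 0) =
      φ ![r 0, r 0] * if u 1 ≤ u 0 then 1 else 0 := by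
    intro u; split_ifs <;> simp
  simp_rw [h, h2, h3]
  rw [integral_const_mul, setIntegral_cube_two]
  ring

lemma integral_ite_Ioc_Ioo {T : ℝ} (hT : 0 < T) (g : ℝ → ℝ → ℝ) :
    (∫ x, ∫ y, if x ∈ Set.Ioc 0 T ∧ y ∈ Set.Ioc 0 T ∧ y < x then g x y else 0) =
      ∫ x in (0)..T, ∫ y in (0)..x, g x y := by
  classical
  have h : ∀ x, (∫ y, if x ∈ Set.Ioc 0 T ∧ y ∈ Set.Ioc 0 T ∧ y < x then g x y else 0) =
      if x ∈ Set.Ioc 0 T then ∫ y in (0)..x, g x y else 0 := by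
    intro x
    by_cases hx : x ∈ Set.Ioc 0 T
    · rw [if_pos hx, intervalIntegral.integral_of_le hx.1.le, integral_Ioc_eq_integral_Ioo,
        ← integral_indicator measurableSet_Ioo]
      congr 1
      ext y
      rw [Set.indicator_apply]
      refine if_congr ?_ rfl rfl
      exact ⟨fun h => ⟨h.2.1.1, h.2.2⟩, fun h => ⟨hx, ⟨h.1, (h.2.trans_le hx.2).le⟩, h.2⟩⟩
    · rw [if_neg hx]
      simp only [hx, false_and, if_false]
      simp
  simp_rw [h]
  exact integral_ite_Ioc hT.le _

lemma integral_limitStep_pairs {T : ℝ} (hT : 0 < T) {φ : (Fin 4 → ℝ) → ℝ} (hφ : Continuous φ)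
    {i j : Fin 2} (hij : i ≠ j) :
    ∫ r, limitStep φ ![i, i, j, j] r
      ∂(Measure.pi fun _ : Fin 2 => (volume : Measure ℝ).restrict (Set.Ioc 0 T)) =
      ∫ x in (0)..T, ∫ y in (0)..x, φ ![x, x, y, y] / 4 := by
  classical
  let s : Set (Fin 2 → ℝ) := (Set.univ.pi fun _ => Set.Ioc 0 T) ∩ {r | r j < r i}
  have hs : MeasurableSet s := (MeasurableSet.univ_pi fun _ => measurableSet_Ioc).inter
    (measurableSet_lt (measurable_pi_apply _) (measurable_pi_apply _))
  have hc : Continuous fun r : Fin 2 → ℝ => φ ![r i, r i, r j, r j] / 4 := by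
    refine (hφ.comp (continuous_pi fun l => ?_)).div_const _
    fin_cases l
    exacts [continuous_apply i, continuous_apply i, continuous_apply j, continuous_apply j]
  have hb : BoundedSupported (s.indicator fun r : Fin 2 → ℝ => φ ![r i, r i, r j, r j] / 4) := by
    refine BoundedSupported.of_indicator (R := T) hs hc fun t ht l => ?_
    have := ht.1 l trivial
    rw [abs_of_pos this.1]
    exact this.2
  have h1 : ∫ r, limitStep φ ![i, i, j, j] r
      ∂(Measure.pi fun _ : Fin 2 => (volume : Measure ℝ).restrict (Set.Ioc 0 T)) =
      ∫ r, s.indicator (fun r : Fin 2 → ℝ => φ ![r i, r i, r j, r j] / 4) r := by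
    rw [← Measure.restrict_pi_pi, ← integral_indicator
      (MeasurableSet.univ_pi fun _ => measurableSet_Ioc)]
    refine congrArg _ (funext fun r => ?_)
    rw [Set.indicator_apply, Set.indicator_apply, limitStep_pairs φ hij]
    by_cases h1 : r ∈ Set.univ.pi fun _ : Fin 2 => Set.Ioc 0 T <;>
      by_cases h2 : r j < r i <;> simp [s, h1, h2]
  rw [h1, ← integral_ite_Ioc_Ioo hT]
  have hmem : ∀ r : Fin 2 → ℝ, r ∈ s ↔ r i ∈ Set.Ioc 0 T ∧ r j ∈ Set.Ioc 0 T ∧ r j < r i := by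
    intro r
    have h : (∀ l, r l ∈ Set.Ioc 0 T) ↔ r i ∈ Set.Ioc 0 T ∧ r j ∈ Set.Ioc 0 T := by
      rw [Fin.forall_fin_two]
      fin_cases i <;> fin_cases j <;> simp at hij ⊢
      exact and_comm
    rw [← and_assoc, ← h]
    exact and_congr_left fun _ => ⟨fun h l => h l trivial, fun h l _ => h l⟩
  have hpt : ∀ r, s.indicator (fun r : Fin 2 → ℝ => φ ![r i, r i, r j, r j] / 4) r =
      if r i ∈ Set.Ioc 0 T ∧ r j ∈ Set.Ioc 0 T ∧ r j < r i then
        φ ![r i, r i, r j, r j] / 4 else 0 := by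
    intro r
    rw [Set.indicator_apply]
    exact if_congr (hmem r) rfl rfl
  -- The two labellings of the pairs differ only in the order of integration, hence the two versions
  -- of Fubini below.
  have hcases : (i = 0 ∧ j = 1) ∨ (i = 1 ∧ j = 0) := by
    fin_cases i <;> fin_cases j <;> simp at hij ⊢
  rcases hcases with ⟨hi, hj⟩ | ⟨hi, hj⟩
  · rw [hb.integral_two]
    simp_rw [hpt, hi, hj]
    rfl
  · rw [hb.integral_two_symm]
    simp_rw [hpt, hi, hj]
    rfl

section Expectation

variable {Ω : Type*} [MeasurableSpace Ω] {P : Measure Ω} {B : ℝ≥0 → Ω → ℝ} {T : ℝ}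

lemma integral_stratonovich_two (hB : IsPreBrownianReal B P) (hT : 0 < T)
    {φ : (Fin 2 → ℝ) → ℝ} (hφ : Continuous φ) {S : Ω → ℝ}
    (hS : IsStratonovichIntegral P B T φ S) :
    ∫ ω, S ω ∂P = 1 / 2 * ∫ x in (0)..T, φ ![x, x] := by
  rw [integral_eq_sum_limitStep hB hT hφ hS (k := 1) rfl]
  have h1 : ∫ r, φ ![r 0, r 0] / 2
      ∂(Measure.pi fun _ : Fin 1 => (volume : Measure ℝ).restrict (Set.Ioc 0 T)) =
      (∫ x in (0)..T, φ ![x, x]) / 2 := by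
    have h := (measurePreserving_piUnique
      fun _ : Fin 1 => (volume : Measure ℝ).restrict (Set.Ioc 0 T)).integral_comp'
      (fun x => φ ![x, x] / 2)
    rw [intervalIntegral.integral_of_le hT.le, ← integral_div]
    exact h
  -- Two orientations of the single pair, each contributing half the integral, against the prefactor
  -- `1 / 2!`.
  have hc : Fintype.card (Fin 1 × Bool ≃ Fin 2 ⊕ Fin 0) = 2 := by decide +kernel
  simp_rw [limitStep_pair, h1]
  rw [Finset.sum_const, Finset.card_univ, hc, show 2 * 1 = 2 from rfl, stdMoment_two]
  simp [Nat.factorial]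
  ring

lemma integral_stratonovich_four (hB : IsPreBrownianReal B P) (hT : 0 < T)
    {φ : (Fin 4 → ℝ) → ℝ} (hφ : Continuous φ) {S : Ω → ℝ}
    (hS : IsStratonovichIntegral P B T φ S) :
    ∫ ω, S ω ∂P = 1 / 4 * ∫ x in (0)..T, ∫ y in (0)..x, φ ![x, x, y, y] := by
  rw [integral_eq_sum_limitStep hB hT hφ hS (k := 2) rfl]
  let p : (Fin 2 × Bool ≃ Fin 4 ⊕ Fin 0) → Fin 4 → Fin 2 := fun e l => (e.symm (Sum.inl l)).1
  let J := ∫ x in (0)..T, ∫ y in (0)..x, φ ![x, x, y, y] / 4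
  -- Of the `24` labelled pairings, `4 + 4` join neighbours and each contributes `J`; the rest
  -- vanish. With the prefactor `3 / 4!` the total is `J`.
  have h01 : (Finset.univ.filter fun e => p e = ![0, 0, 1, 1]).card = 4 := by decide +kernel
  have h10 : (Finset.univ.filter fun e => p e = ![1, 1, 0, 0]).card = 4 := by decide +kernel
  have hall : ∀ e, p e = ![0, 0, 1, 1] ∨ p e = ![1, 1, 0, 0] ∨
      ∃ a b c, a < b ∧ b < c ∧ p e a = p e c ∧ p e a ≠ p e b := by decide +kernel
  have hne : (![0, 0, 1, 1] : Fin 4 → Fin 2) ≠ ![1, 1, 0, 0] := by decide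
  have h : ∀ e, ∫ r, limitStep φ (p e) r
      ∂(Measure.pi fun _ : Fin 2 => (volume : Measure ℝ).restrict (Set.Ioc 0 T)) =
      (if p e = ![0, 0, 1, 1] then J else 0) + (if p e = ![1, 1, 0, 0] then J else 0) := by
    intro e
    by_cases h1 : p e = ![0, 0, 1, 1]
    · rw [if_pos h1, if_neg (h1 ▸ hne), add_zero, h1]
      exact integral_limitStep_pairs hT hφ (by decide)
    by_cases h2 : p e = ![1, 1, 0, 0]
    · rw [if_neg h1, if_pos h2, zero_add, h2]
      exact integral_limitStep_pairs hT hφ (by decide)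
    · have h3 := ((hall e).resolve_left h1).resolve_left h2
      simp [h1, h2, limitStep_eq_zero φ _ h3]
  have hsum : ∑ e, ∫ r, limitStep φ (p e) r
      ∂(Measure.pi fun _ : Fin 2 => (volume : Measure ℝ).restrict (Set.Ioc 0 T)) = 8 * J := by
    simp_rw [h]
    rw [Finset.sum_add_distrib, ← Finset.sum_filter, ← Finset.sum_filter, Finset.sum_const,
      Finset.sum_const, h01, h10]
    ring
  have hJ : J = (∫ x in (0)..T, ∫ y in (0)..x, φ ![x, x, y, y]) / 4 := by
    simp only [J, intervalIntegral.integral_div]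
  change _ * ∑ e, ∫ r, limitStep φ (p e) r ∂_ = _
  rw [hsum, hJ, show 2 * 2 = 4 from rfl, stdMoment_four]
  simp [Nat.factorial]
  ring

end Expectation

/-! ### Beta integrals -/

lemma integral_rpow_mul_one_sub_rpow {a b : ℝ} (ha : 0 < a) (hb : 0 < b) :
    ∫ x in (0)..1, x ^ (a - 1) * (1 - x) ^ (b - 1) = beta a b := by
  rw [beta_eq_betaIntegralReal a b ha hb, Complex.betaIntegral]
  have h : ∫ x in (0 : ℝ)..1, (x : ℂ) ^ ((a : ℂ) - 1) * (1 - (x : ℂ)) ^ ((b : ℂ) - 1) =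
      ((∫ x in (0 : ℝ)..1, x ^ (a - 1) * (1 - x) ^ (b - 1) : ℝ) : ℂ) := by
    rw [← intervalIntegral.integral_ofReal]
    refine intervalIntegral.integral_congr fun x hx => ?_
    rw [Set.uIcc_of_le zero_le_one] at hx
    rw [Complex.ofReal_mul, Complex.ofReal_cpow hx.1, Complex.ofReal_cpow (sub_nonneg.2 hx.2)]
    push_cast
    rfl
  rw [h, Complex.ofReal_re]

lemma integral_rpow_mul_sub_rpow {a b w : ℝ} (ha : 0 < a) (hb : 0 < b) (hw : 0 < w) :
    ∫ v in (0)..w, v ^ (a - 1) * (w - v) ^ (b - 1) = w ^ (a + b - 1) * beta a b := by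
  have h := intervalIntegral.mul_integral_comp_mul_left (a := 0) (b := 1)
    (f := fun v => v ^ (a - 1) * (w - v) ^ (b - 1)) w
  rw [mul_zero, mul_one] at h
  rw [← h, ← integral_rpow_mul_one_sub_rpow ha hb, ← intervalIntegral.integral_const_mul,
    ← intervalIntegral.integral_const_mul]
  refine intervalIntegral.integral_congr fun x hx => ?_
  rw [Set.uIcc_of_le zero_le_one] at hx
  have h1 : w - w * x = w * (1 - x) := by ring
  rw [h1, Real.mul_rpow hw.le hx.1, Real.mul_rpow hw.le (sub_nonneg.2 hx.2)]
  have h2 : w ^ (a + b - 1) = w * w ^ (a - 1) * w ^ (b - 1) := by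
    rw [show a + b - 1 = 1 + (a - 1) + (b - 1) by ring, Real.rpow_add hw, Real.rpow_add hw,
      Real.rpow_one]
  rw [h2]
  ring

/-- Exchange of the order of integration over a triangle. -/
lemma integral_triangle_swap {T : ℝ} (hT : 0 < T) {g : ℝ → ℝ → ℝ}
    (hg : Continuous fun t : Fin 2 → ℝ => g (t 0) (t 1)) :
    ∫ x in (0)..T, ∫ y in (0)..x, g x y = ∫ y in (0)..T, ∫ x in y..T, g x y := by
  classical
  let s : Set (Fin 2 → ℝ) := (Set.univ.pi fun _ => Set.Ioc 0 T) ∩ {r | r 1 < r 0}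
  have hs : MeasurableSet s := (MeasurableSet.univ_pi fun _ => measurableSet_Ioc).inter
    (measurableSet_lt (measurable_pi_apply _) (measurable_pi_apply _))
  have hb : BoundedSupported (s.indicator fun t : Fin 2 → ℝ => g (t 0) (t 1)) := by
    refine BoundedSupported.of_indicator (R := T) hs hg fun t ht l => ?_
    have := ht.1 l trivial
    rw [abs_of_pos this.1]
    exact this.2
  have hpt : ∀ x y, s.indicator (fun t : Fin 2 → ℝ => g (t 0) (t 1)) ![x, y] =
      if x ∈ Set.Ioc 0 T ∧ y ∈ Set.Ioc 0 T ∧ y < x then g x y else 0 := by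
    intro x y
    rw [Set.indicator_apply]
    refine if_congr ?_ rfl rfl
    simp [s, Fin.forall_fin_two, and_assoc]
  rw [← integral_ite_Ioc_Ioo hT g, ← integral_ite_Ioc hT.le]
  have h2 := hb.integral_two
  rw [hb.integral_two_symm] at h2
  simp_rw [hpt] at h2
  rw [← h2]
  congr 1
  ext y
  by_cases hy : y ∈ Set.Ioc 0 T
  · rw [if_pos hy, ← integral_ite_Ioc hy.2]
    congr 1
    ext x
    refine if_congr ?_ rfl rfl
    exact ⟨fun h => ⟨h.2.2, h.1.2⟩, fun h => ⟨⟨hy.1.trans h.1, h.2⟩, hy, h.1⟩⟩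
  · rw [if_neg hy]
    simp [hy]

/-- With `y` outermost and `w = T - y`, `v = T - x`, the inner integral is a beta integral scaled to
`[0, w]`, and a pure power of `w` remains. -/
lemma integral_triangle_beta {T a b c : ℝ} (hT : 0 < T) (ha : 0 ≤ a) (hb : 0 ≤ b) (hc : 0 ≤ c) :
    ∫ x in (0)..T, ∫ y in (0)..x, (T - x) ^ a * (T - y) ^ b * (x - y) ^ c =
      T ^ (a + b + c + 2) / (a + b + c + 2) * beta (a + 1) (c + 1) := by
  have hcont : Continuous fun t : Fin 2 → ℝ =>
      (T - t 0) ^ a * (T - t 1) ^ b * (t 0 - t 1) ^ c := by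
    have h : ∀ {f : (Fin 2 → ℝ) → ℝ} {e : ℝ}, Continuous f → 0 ≤ e →
        Continuous fun t => f t ^ e := fun hf he => hf.rpow_const fun _ => Or.inr he
    exact ((h (by fun_prop) ha).mul (h (by fun_prop) hb)).mul (h (by fun_prop) hc)
  rw [integral_triangle_swap hT (g := fun x y => (T - x) ^ a * (T - y) ^ b * (x - y) ^ c) hcont]
  have h1 : ∀ y, ∫ x in y..T, (T - x) ^ a * (T - y) ^ b * (x - y) ^ c =
      (T - y) ^ b * ∫ v in (0)..(T - y), v ^ a * (T - y - v) ^ c := by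
    intro y
    have h := intervalIntegral.integral_comp_sub_left (a := y) (b := T)
      (fun v => v ^ a * (T - y - v) ^ c) T
    rw [sub_self] at h
    rw [← h, ← intervalIntegral.integral_const_mul]
    refine intervalIntegral.integral_congr fun x _ => ?_
    rw [show T - y - (T - x) = x - y by ring]
    ring
  simp_rw [h1]
  have h2 := intervalIntegral.integral_comp_sub_left (a := 0) (b := T)
    (fun w => w ^ b * ∫ v in (0)..w, v ^ a * (w - v) ^ c) T
  rw [sub_self, sub_zero] at h2
  rw [h2]
  have h3 : ∫ w in (0)..T, w ^ b * ∫ v in (0)..w, v ^ a * (w - v) ^ c =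
      ∫ w in (0)..T, w ^ (a + b + c + 1) * beta (a + 1) (c + 1) := by
    rw [intervalIntegral.integral_of_le hT.le, intervalIntegral.integral_of_le hT.le]
    refine setIntegral_congr_fun measurableSet_Ioc fun w hw => ?_
    have h4 := integral_rpow_mul_sub_rpow (a := a + 1) (b := c + 1) (by linarith) (by linarith)
      hw.1
    simp only [add_sub_cancel_right] at h4
    rw [h4, ← mul_assoc, ← Real.rpow_add hw.1]
    congr 2
    ring
  rw [h3, intervalIntegral.integral_mul_const, integral_rpow (Or.inl (by linarith)),
    Real.zero_rpow (by linarith), sub_zero]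
  congr 2 <;> ring_nf

/-! ### Expectations for the Volterra kernels -/

/-- The condition `H > 1/2` makes the exponent positive. The theory above is for continuous
integrands and applies to the kernels through this lemma. -/
lemma continuous_kernel {H : ℝ} (hH : 1 / 2 < H) (T : ℝ) {n : ℕ} (κ : VIndex n) :
    Continuous (kernel H T κ) := by
  unfold kernel
  refine continuous_finsetProd _ fun l _ => ?_
  refine Continuous.rpow_const ?_ fun _ => Or.inr (by linarith)
  refine Continuous.sub ?_ (continuous_apply l)
  have h : ∀ i : Fin (n + 1), Continuous fun t : Fin n → ℝ => Matrix.vecCons T t i := by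
    intro i
    refine Fin.cases ?_ (fun j => ?_) i
    · simpa using continuous_const
    · simpa using continuous_apply j
  exact h _

lemma kernel_pair {H : ℝ} (hH : 1 / 2 < H) {T x : ℝ} (hx : x ≤ T) (κ : VIndex 2) :
    kernel H T κ ![x, x] = if (κ 1).val = 0 then (T - x) ^ (2 * H - 1) else 0 := by
  have hw : ∀ j : Fin 3, Matrix.vecCons T ![x, x] j = if j.val = 0 then T else x := by
    intro j
    fin_cases j <;> simp
  unfold kernel
  rw [Fin.prod_univ_two, hw, hw]
  have h0 : (κ 0).val = 0 := by have := (κ 0).isLt; simp at this ⊢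
  simp only [Fin.val_castLE, h0, if_true]
  split_ifs
  · simp only [Matrix.cons_val_zero, Matrix.cons_val_one]
    rw [← Real.rpow_add_of_nonneg (by linarith) (by linarith) (by linarith)]
    congr 1
    ring
  · simp [Real.zero_rpow (by linarith : H - 2⁻¹ ≠ 0)]

/-- The number of factors `x - y` in the kernel at the point `(x, x, y, y)`, and `3` if the kernel
vanishes there. -/
def pairType (κ : VIndex 4) : ℕ :=
  if (κ 1).val = 0 ∧ (κ 3).val ≠ 3 then
    (if (κ 2).val = 0 then 0 else 1) + (if (κ 3).val = 0 then 0 else 1)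
  else 3

/-- Here `t₁ = t₂ = x` and `t₃ = t₄ = y`. The second factor vanishes unless `κ₂ = 0`, and the fourth
vanishes if `κ₄ = 3`. Otherwise the third and fourth factors are powers of `T - y` when the entry is
`0` and of `x - y` when it is `1` or `2`. -/
lemma kernel_pairs {H : ℝ} (hH : 1 / 2 < H) {T x y : ℝ} (hx : x ≤ T) (hy : y ≤ x)
    (κ : VIndex 4) :
    kernel H T κ ![x, x, y, y] = if pairType κ < 3 then
      (T - x) ^ (2 * (H - 1 / 2)) * (T - y) ^ ((2 - pairType κ) * (H - 1 / 2)) *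
        (x - y) ^ (pairType κ * (H - 1 / 2)) else 0 := by
  -- `w` encodes the tuple `(T, x, x, y, y)` as a function on `ℕ`, so that the cases on the entries
  -- of `κ` rewrite without dependent types.
  obtain ⟨w, hw, w0, w1, w2, w3⟩ : ∃ w : ℕ → ℝ,
      (∀ j : Fin 5, Matrix.vecCons T ![x, x, y, y] j = w j.val) ∧
        w 0 = T ∧ w 1 = x ∧ w 2 = x ∧ w 3 = y := by
    refine ⟨fun j => if j = 0 then T else if j < 3 then x else y, fun j => ?_, ?_⟩
    · fin_cases j <;> simp
    · simp
  obtain ⟨h, hh, hpos⟩ : ∃ h, H - 1 / 2 = h ∧ 0 < h := ⟨_, rfl, by linarith⟩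
  have hz : (0 : ℝ) ^ h = 0 := Real.zero_rpow hpos.ne'
  have h2 : ∀ z : ℝ, 0 ≤ z → z ^ (2 * h) = z ^ h * z ^ h := by
    intro z hz
    rw [← Real.rpow_add_of_nonneg hz hpos.le hpos.le, two_mul]
  have hx' := h2 (T - x) (by linarith)
  have hy' := h2 (T - y) (by linarith)
  have hxy' := h2 (x - y) (by linarith)
  unfold kernel pairType
  rw [Fin.prod_univ_four, hw, hw, hw, hw, hh]
  simp only [Fin.val_castLE]
  have h0 : (κ 0).val = 0 := by have := (κ 0).isLt; simp at this ⊢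
  have hb : (κ 1).val < 2 := (κ 1).isLt
  have hc : (κ 2).val < 3 := (κ 2).isLt
  have hd : (κ 3).val < 4 := (κ 3).isLt
  rw [h0]
  generalize (κ 1).val = b at *
  generalize (κ 2).val = c at *
  generalize (κ 3).val = d at *
  have v0 : (![x, x, y, y] : Fin 4 → ℝ) 0 = x := rfl
  have v1 : (![x, x, y, y] : Fin 4 → ℝ) 1 = x := rfl
  have v2 : (![x, x, y, y] : Fin 4 → ℝ) 2 = y := rfl
  have v3 : (![x, x, y, y] : Fin 4 → ℝ) 3 = y := rfl
  rw [v0, v1, v2, v3]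
  have e1 : (2 - 1 : ℝ) = 1 := by norm_num
  interval_cases b <;> interval_cases c <;> interval_cases d <;>
    simp [w0, w1, w2, w3, hz, hx', hy', hxy', e1] <;> ring

section VolterraExpectation

variable {Ω : Type*} [MeasurableSpace Ω] {P : Measure Ω} {B : ℝ≥0 → Ω → ℝ} {H T : ℝ}

lemma integral_stratonovich_kernel_two (hB : IsPreBrownianReal B P) (hH : 1 / 2 < H) (hT : 0 < T)
    (κ : VIndex 2) : ∫ ω, stratonovich P B T (kernel H T κ) ω ∂P =
      if (κ 1).val = 0 then T ^ (2 * H) / (4 * H) else 0 := by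
  rw [integral_stratonovich_two hB hT (continuous_kernel hH T κ)
    (isStratonovichIntegral_stratonovich hB hT (continuous_kernel hH T κ))]
  have h : ∫ x in (0)..T, kernel H T κ ![x, x] =
      ∫ x in (0)..T, if (κ 1).val = 0 then (T - x) ^ (2 * H - 1) else 0 := by
    refine intervalIntegral.integral_congr fun x hx => ?_
    rw [Set.uIcc_of_le hT.le] at hx
    exact kernel_pair hH hx.2 κ
  rw [h]
  split_ifs
  · have h2 := intervalIntegral.integral_comp_sub_left (a := 0) (b := T)
      (fun x => x ^ (2 * H - 1)) T
    rw [sub_self, sub_zero] at h2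
    rw [h2, integral_rpow (Or.inl (by linarith)), Real.zero_rpow (by linarith)]
    simp only [sub_add_cancel, sub_zero]
    field_simp
    norm_num
  · simp

/-- The expectation of a quadruple integral whose kernel has `j` factors `x - y` at
`(x, x, y, y)`. -/
noncomputable def pairMoment (H T : ℝ) (j : ℕ) : ℝ :=
  if j < 3 then T ^ (4 * H) / (16 * H) * beta (2 * H) (j * (H - 1 / 2) + 1) else 0

lemma integral_stratonovich_kernel_four (hB : IsPreBrownianReal B P) (hH : 1 / 2 < H) (hT : 0 < T)
    (κ : VIndex 4) :
    ∫ ω, stratonovich P B T (kernel H T κ) ω ∂P = pairMoment H T (pairType κ) := by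
  rw [integral_stratonovich_four hB hT (continuous_kernel hH T κ)
    (isStratonovichIntegral_stratonovich hB hT (continuous_kernel hH T κ))]
  have h : ∫ x in (0)..T, ∫ y in (0)..x, kernel H T κ ![x, x, y, y] =
      ∫ x in (0)..T, ∫ y in (0)..x, if pairType κ < 3 then
      (T - x) ^ (2 * (H - 1 / 2)) * (T - y) ^ ((2 - pairType κ) * (H - 1 / 2)) *
        (x - y) ^ (pairType κ * (H - 1 / 2)) else 0 := by
    refine intervalIntegral.integral_congr fun x hx => ?_
    rw [Set.uIcc_of_le hT.le] at hx
    refine intervalIntegral.integral_congr fun y hy => ?_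
    rw [Set.uIcc_of_le hx.1] at hy
    exact kernel_pairs hH hx.2 hy.2 κ
  rw [h]
  unfold pairMoment
  split_ifs with hj
  · have hj' : (pairType κ : ℝ) ≤ 2 := by exact_mod_cast Nat.lt_succ_iff.1 hj
    have hpos : 0 < H - 1 / 2 := by linarith
    rw [integral_triangle_beta hT (by positivity) (mul_nonneg (by linarith) hpos.le)
      (by positivity)]
    have e1 : 2 * (H - 1 / 2) + (2 - (pairType κ : ℝ)) * (H - 1 / 2) +
        pairType κ * (H - 1 / 2) + 2 = 4 * H := by ring
    have e2 : 2 * (H - 1 / 2) + 1 = 2 * H := by ring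
    rw [e1, e2]
    ring
  · simp

lemma beta_one {u : ℝ} (hu : 0 < u) : beta u 1 = 1 / u := by
  unfold beta
  rw [Real.Gamma_add_one hu.ne', Real.Gamma_one]
  have := (Real.Gamma_pos_of_pos hu).ne'
  field_simp

/-- This converts `B(2H, 2H)`, which comes out of the integration, into the `B(2H, 2H + 1)` of the
constants for `φ₃` and `φ₄`. -/
lemma beta_self_add_one {u : ℝ} (hu : 0 < u) : beta u (u + 1) = beta u u / 2 := by
  unfold beta
  have h1 : u + (u + 1) = (u + u) + 1 := by ring
  rw [h1, Real.Gamma_add_one hu.ne', Real.Gamma_add_one (by linarith)]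
  have := (Real.Gamma_pos_of_pos (add_pos hu hu)).ne'
  field_simp
  ring

/-- Within a class only the number of indices of each pair type matters: one of type `0` in the
first class, four of type `1` in the second, two of type `2` in the third and in the fourth, and
none with nonzero moment in the others. -/
lemma sum_pairMoment (hH : 1 / 2 < H) (α : Fin 7) :
    ∑ κ ∈ S4 α, pairMoment H T (pairType κ) = gam H T α := by
  have hmaps : ∀ κ ∈ S4 α, pairType κ ∈ Finset.range 4 := by
    intro κ _
    unfold pairType
    rw [Finset.mem_range]
    split_ifs <;> lia
  have h1 : ∑ κ ∈ S4 α, pairMoment H T (pairType κ) =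
      ∑ j ∈ Finset.range 4, ((S4 α).filter fun κ => pairType κ = j).card * pairMoment H T j := by
    rw [← Finset.sum_fiberwise_of_maps_to hmaps]
    refine Finset.sum_congr rfl fun j _ => ?_
    rw [Finset.sum_congr rfl fun κ hκ => by rw [(Finset.mem_filter.1 hκ).2], Finset.sum_const,
      nsmul_eq_mul]
  have h2 : ∀ α : Fin 7, (((S4 α).filter fun κ => pairType κ = 0).card,
      ((S4 α).filter fun κ => pairType κ = 1).card, ((S4 α).filter fun κ => pairType κ = 2).card) =
      (![(1, 0, 0), (0, 4, 0), (0, 0, 2), (0, 0, 2), (0, 0, 0), (0, 0, 0), (0, 0, 0)] :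
        Fin 7 → ℕ × ℕ × ℕ) α := by decide +kernel
  have h3 := h2 α
  rw [Prod.ext_iff, Prod.ext_iff] at h3
  obtain ⟨c0, c1, c2⟩ := h3
  simp only at c0 c1 c2
  have m0 : pairMoment H T 0 = T ^ (4 * H) / (32 * H ^ 2) := by
    rw [pairMoment, if_pos (by norm_num), Nat.cast_zero, zero_mul, zero_add,
      beta_one (by linarith : 0 < 2 * H)]
    field_simp
    ring
  have m1 : 4 * pairMoment H T 1 = T ^ (4 * H) / (4 * H) * beta (2 * H) (H + 1 / 2) := by
    have e : 1 * (H - 1 / 2) + 1 = H + 1 / 2 := by ring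
    rw [pairMoment, if_pos (by norm_num), Nat.cast_one, e]
    ring
  have m2 : 2 * pairMoment H T 2 = T ^ (4 * H) / (4 * H) * beta (2 * H) (2 * (H + 1 / 2)) := by
    have e : 2 * (H - 1 / 2) + 1 = 2 * H := by ring
    have e2 : 2 * (H + 1 / 2) = 2 * H + 1 := by ring
    rw [e2, beta_self_add_one (by linarith)]
    rw [pairMoment, if_pos (by norm_num), Nat.cast_ofNat, e]
    ring
  have m3 : pairMoment H T 3 = 0 := by simp [pairMoment]
  rw [h1, Finset.sum_range_succ, Finset.sum_range_succ, Finset.sum_range_succ,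
    Finset.sum_range_succ, Finset.sum_range_zero, c0, c1, c2, m3]
  fin_cases α
  · simp [gam, m0]
  · simpa [gam] using m1
  · simpa [gam] using m2
  · simpa [gam] using m2
  all_goals simp [gam]

end VolterraExpectation

/-! ### Integrals along the paths of the cubature measure -/

lemma pathIntegral_neg (T : ℝ) {n : ℕ} (φ : (Fin n → ℝ) → ℝ) (ω : ℝ → ℝ) :
    pathIntegral T φ (-ω) = (-1) ^ n * pathIntegral T φ ω := by
  unfold pathIntegral
  rw [← integral_const_mul]
  congr 1
  ext t
  have h : ∀ x, deriv (-ω) x = -1 * deriv ω x := by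
    intro x
    rw [deriv.neg]
    ring
  simp_rw [h, Finset.prod_mul_distrib, Finset.prod_const, Finset.card_univ, Fintype.card_fin]
  ring

/-- Reversing a path multiplies the integral by `(-1)^n`, so the symmetric pairs cancel for odd `n`
and double for even `n`; this is the factor `2` in the equations. -/
lemma sum_weights_paths {T : ℝ} {W L n : ℕ} (lam : Fin W → ℝ) (a : Fin W → Fin L → ℝ)
    (φ : (Fin n → ℝ) → ℝ) :
    ∑ k, weights lam k * pathIntegral T φ (paths T a k) = (1 + (-1) ^ n) *
      ∑ k, lam k * pathIntegral T φ (pwLinear (grid T L) fun l => a k l / √T) := by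
  rw [Fin.sum_univ_add]
  simp only [weights, paths, Fin.append_left, Fin.append_right, pathIntegral_neg]
  rw [add_mul, one_mul, Finset.mul_sum]
  congr 1
  exact Finset.sum_congr rfl fun k _ => by ring

lemma grid_zero (T : ℝ) (L : ℕ) : grid T L 0 = 0 := by simp [grid]

lemma grid_self (T : ℝ) {L : ℕ} (hL : L ≠ 0) : grid T L L = T := by
  have : (L : ℝ) ≠ 0 := by exact_mod_cast hL
  simp only [grid]
  field_simp

lemma grid_strictMono {T : ℝ} (hT : 0 < T) {L : ℕ} (hL : L ≠ 0) : StrictMono (grid T L) := by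
  intro i j hij
  have : (0 : ℝ) < L := by exact_mod_cast Nat.pos_of_ne_zero hL
  have hij' : (i : ℝ) < j := by exact_mod_cast hij
  simp only [grid]
  gcongr

/-! ### Box integrals over the uniform grid as nested interval integrals -/

section Boxes

variable {T : ℝ} {L n : ℕ} {φ : (Fin n → ℝ) → ℝ}

/-- The part of the simplex in the box with indices `i`. -/
def gridBox (T : ℝ) (L : ℕ) {n : ℕ} (i : Fin n → Fin L) : Set (Fin n → ℝ) :=
  {t | Antitone t ∧ ∀ l, t l ∈ Set.Ioc (grid T L (i l)) (grid T L ((i l).val + 1))}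

lemma boxIntegral_grid (hT : 0 < T) (φ : (Fin n → ℝ) → ℝ) (i : Fin n → Fin L) :
    boxIntegral T φ (grid T L) (fun l => i l) = ∫ t, (gridBox T L i).indicator φ t := by
  unfold boxIntegral
  rw [← integral_indicator (measurableSet_simplex T n)]
  congr 1
  ext t
  by_cases h : ∀ l, t l ∈ Set.Ioc (grid T L (i l)) (grid T L ((i l).val + 1))
  · have hprod : ∏ l, cellInd (grid T L) (i l) (t l) = 1 :=
      Finset.prod_eq_one fun l _ => Set.indicator_of_mem (h l) _
    have hT' : ∀ l, t l ∈ Set.Icc 0 T := by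
      intro l
      have hL : L ≠ 0 := by have := (i l).isLt; lia
      have hm := (grid_strictMono hT hL).monotone
      have h1 := hm (Nat.zero_le (i l).val)
      have h2 := hm (Nat.succ_le_of_lt (i l).isLt)
      rw [grid_zero] at h1
      rw [grid_self T hL] at h2
      exact ⟨h1.trans (h l).1.le, (h l).2.trans h2⟩
    by_cases ha : Antitone t
    · rw [Set.indicator_of_mem (show t ∈ simplex T n from ⟨ha, hT'⟩),
        Set.indicator_of_mem (show t ∈ gridBox T L i from ⟨ha, h⟩), hprod, mul_one]
    · rw [Set.indicator_of_notMem (fun h => ha h.1), Set.indicator_of_notMem (fun h => ha h.1)]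
  · rw [Set.indicator_of_notMem (fun h' : t ∈ gridBox T L i => h h'.2)]
    push Not at h
    obtain ⟨l, hl⟩ := h
    refine Set.indicator_apply_eq_zero.2 fun _ => ?_
    rw [Finset.prod_eq_zero (Finset.mem_univ l), mul_zero]
    exact Set.indicator_of_notMem hl _

lemma measurableSet_gridBox (i : Fin n → Fin L) : MeasurableSet (gridBox T L i) := by
  have h : gridBox T L i = (⋂ j, ⋂ k, ⋂ (_ : j ≤ k), {t : Fin n → ℝ | t k ≤ t j}) ∩
      Set.univ.pi fun l => Set.Ioc (grid T L (i l)) (grid T L ((i l).val + 1)) := by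
    ext t
    simp only [gridBox, Antitone, Set.mem_ofPred_eq, Set.mem_inter_iff, Set.mem_iInter,
      Set.mem_univ_pi]
  rw [h]
  refine MeasurableSet.inter ?_ (MeasurableSet.univ_pi fun _ => measurableSet_Ioc)
  exact MeasurableSet.iInter fun j => MeasurableSet.iInter fun k => MeasurableSet.iInter fun _ =>
    measurableSet_le (measurable_pi_apply _) (measurable_pi_apply _)

lemma gridBox_eq_empty (hT : 0 < T) {i : Fin n → Fin L} (hi : ¬ Antitone i) :
    gridBox T L i = ∅ := by
  refine Set.eq_empty_of_forall_notMem fun t ht => hi fun l l' hl => ?_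
  by_contra hlt
  rw [not_le] at hlt
  have hL : L ≠ 0 := by have := (i l).isLt; lia
  have h1 := (grid_strictMono hT hL).monotone (Nat.succ_le_of_lt (Fin.lt_def.1 hlt))
  have h2 := ht.1 hl
  have h3 := (ht.2 l).2
  have h4 := (ht.2 l').1
  exact absurd (h4.trans_le (h2.trans (h3.trans h1))) (lt_irrefl _)

lemma boundedSupported_gridBox (hT : 0 < T) (hφ : Continuous φ) (i : Fin n → Fin L) :
    BoundedSupported ((gridBox T L i).indicator φ) := by
  refine BoundedSupported.of_indicator (R := T) (measurableSet_gridBox i) hφ fun t ht l => ?_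
  have hL : L ≠ 0 := by have := (i l).isLt; lia
  have hm := (grid_strictMono hT hL).monotone
  have h1 := hm (Nat.zero_le (i l).val)
  have h2 := hm (Nat.succ_le_of_lt (i l).isLt)
  rw [grid_zero] at h1
  rw [grid_self T hL] at h2
  rw [abs_of_nonneg (h1.trans (ht.2 l).1.le)]
  exact (ht.2 l).2.trans h2

end Boxes

lemma boxIntegral_two {T : ℝ} (hT : 0 < T) {L : ℕ} {φ : (Fin 2 → ℝ) → ℝ} (hφ : Continuous φ)
    {i : Fin 2 → Fin L} (hi : i 1 ≤ i 0) :
    boxIntegral T φ (grid T L) (fun l => i l) =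
      ∫ t₁ in grid T L (i 0)..grid T L ((i 0).val + 1),
        ∫ t₂ in grid T L (i 1)..min (grid T L ((i 1).val + 1)) t₁, φ ![t₁, t₂] := by
  classical
  have hL : L ≠ 0 := by have := (i 0).isLt; lia
  have hm := (grid_strictMono hT hL).monotone
  have hs : ∀ l, grid T L (i l) ≤ grid T L ((i l).val + 1) := fun l => hm (Nat.le_succ _)
  have h10 := hm (Fin.le_def.1 hi)
  rw [boxIntegral_grid hT, (boundedSupported_gridBox hT hφ i).integral_two,
    ← integral_ite_Ioc (hs 0)]
  congr 1
  ext x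
  by_cases hx : x ∈ Set.Ioc (grid T L (i 0)) (grid T L ((i 0).val + 1))
  -- Decreasing cell indices keep the upper limit `min …` above the lower one, so the interval
  -- integral carries no sign. When the cells differ, the minimum is the right end of the lower
  -- cell.
  · rw [if_pos hx, ← integral_ite_Ioc (le_min (hs 1) (h10.trans hx.1.le))]
    congr 1
    ext y
    rw [Set.indicator_apply]
    refine if_congr ?_ rfl rfl
    constructor
    · intro h
      exact ⟨(h.2 1).1, le_min (h.2 1).2 (h.1 (by decide : (0 : Fin 2) ≤ 1))⟩
    · intro h
      refine ⟨Fin.antitone_iff_succ_le.2 fun l => ?_, Fin.forall_fin_two.2 ⟨hx, h.1, ?_⟩⟩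
      · fin_cases l
        exact h.2.trans (min_le_right _ _)
      · exact h.2.trans (min_le_left _ _)
  · rw [if_neg hx]
    have h : ∀ y, (gridBox T L i).indicator φ ![x, y] = 0 := fun y =>
      Set.indicator_of_notMem (fun h => hx (h.2 0)) _
    simp [h]

lemma boxIntegral_four {T : ℝ} (hT : 0 < T) {L : ℕ} {φ : (Fin 4 → ℝ) → ℝ} (hφ : Continuous φ)
    {i : Fin 4 → Fin L} (h10 : i 1 ≤ i 0) (h21 : i 2 ≤ i 1) (h32 : i 3 ≤ i 2) :
    boxIntegral T φ (grid T L) (fun l => i l) =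
      ∫ t₁ in grid T L (i 0)..grid T L ((i 0).val + 1),
        ∫ t₂ in grid T L (i 1)..min (grid T L ((i 1).val + 1)) t₁,
          ∫ t₃ in grid T L (i 2)..min (grid T L ((i 2).val + 1)) t₂,
            ∫ t₄ in grid T L (i 3)..min (grid T L ((i 3).val + 1)) t₃,
              φ ![t₁, t₂, t₃, t₄] := by
  classical
  have hL : L ≠ 0 := by have := (i 0).isLt; lia
  have hm := (grid_strictMono hT hL).monotone
  have hs : ∀ l, grid T L (i l) ≤ grid T L ((i l).val + 1) := fun l => hm (Nat.le_succ _)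
  have g10 := hm (Fin.le_def.1 h10)
  have g21 := hm (Fin.le_def.1 h21)
  have g32 := hm (Fin.le_def.1 h32)
  rw [boxIntegral_grid hT, (boundedSupported_gridBox hT hφ i).integral_four,
    ← integral_ite_Ioc (hs 0)]
  congr 1
  ext x
  by_cases hx : x ∈ Set.Ioc (grid T L (i 0)) (grid T L ((i 0).val + 1))
  swap
  · rw [if_neg hx]
    have h : ∀ y z w, (gridBox T L i).indicator φ ![x, y, z, w] = 0 := fun y z w =>
      Set.indicator_of_notMem (fun h => hx (h.2 0)) _
    simp [h]
  rw [if_pos hx, ← integral_ite_Ioc (le_min (hs 1) (g10.trans hx.1.le))]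
  congr 1
  ext y
  by_cases hy : y ∈ Set.Ioc (grid T L (i 1)) (min (grid T L ((i 1).val + 1)) x)
  swap
  · rw [if_neg hy]
    have h : ∀ z w, (gridBox T L i).indicator φ ![x, y, z, w] = 0 := fun z w =>
      Set.indicator_of_notMem (fun h => hy ⟨(h.2 1).1,
        le_min (h.2 1).2 (h.1 (by decide : (0 : Fin 4) ≤ 1))⟩) _
    simp [h]
  rw [if_pos hy, ← integral_ite_Ioc (le_min (hs 2) (g21.trans hy.1.le))]
  congr 1
  ext z
  by_cases hz : z ∈ Set.Ioc (grid T L (i 2)) (min (grid T L ((i 2).val + 1)) y)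
  swap
  · rw [if_neg hz]
    have h : ∀ w, (gridBox T L i).indicator φ ![x, y, z, w] = 0 := fun w =>
      Set.indicator_of_notMem (fun h => hz ⟨(h.2 2).1,
        le_min (h.2 2).2 (h.1 (by decide : (1 : Fin 4) ≤ 2))⟩) _
    simp [h]
  rw [if_pos hz, ← integral_ite_Ioc (le_min (hs 3) (g32.trans hz.1.le))]
  congr 1
  ext w
  rw [Set.indicator_apply]
  refine if_congr ?_ rfl rfl
  constructor
  · intro h
    exact ⟨(h.2 3).1, le_min (h.2 3).2 (h.1 (by decide : (2 : Fin 4) ≤ 3))⟩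
  · intro h
    refine ⟨Fin.antitone_iff_succ_le.2 fun l => ?_, fun l => ?_⟩
    · fin_cases l
      exacts [hy.2.trans (min_le_right _ _), hz.2.trans (min_le_right _ _),
        h.2.trans (min_le_right _ _)]
    · fin_cases l
      exacts [hx, ⟨hy.1, hy.2.trans (min_le_left _ _)⟩, ⟨hz.1, hz.2.trans (min_le_left _ _)⟩,
        ⟨h.1, h.2.trans (min_le_left _ _)⟩]

lemma boxIntegral_eq_zero {T : ℝ} (hT : 0 < T) {L n : ℕ} (φ : (Fin n → ℝ) → ℝ)
    {i : Fin n → Fin L} (hi : ¬ Antitone i) : boxIntegral T φ (grid T L) (fun l => i l) = 0 := by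
  rw [boxIntegral_grid hT, gridBox_eq_empty hT hi]
  simp

lemma pathIntegral_grid {T : ℝ} (hT : 0 < T) {L : ℕ} (hL : L ≠ 0) {n : ℕ}
    {φ : (Fin n → ℝ) → ℝ} (hφ : Continuous φ) (v : Fin L → ℝ) :
    pathIntegral T φ (pwLinear (grid T L) fun l => v l / √T) =
      (∑ i : Fin n → Fin L, boxIntegral T φ (grid T L) (fun l => i l) * ∏ l, v (i l)) /
        √T ^ n := by
  rw [pathIntegral_pwLinear (fun i _ => grid_strictMono hT hL (Nat.lt_succ_self i)) hφ,
    Finset.sum_div]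
  refine Finset.sum_congr rfl fun i _ => ?_
  rw [Finset.prod_div_distrib, Finset.prod_const, Finset.card_univ, Fintype.card_fin, mul_div_assoc]

lemma pathIntegral_grid_four {H T : ℝ} (hH : 1 / 2 < H) (hT : 0 < T) (κ : VIndex 4)
    (v : Fin 4 → ℝ) :
    pathIntegral T (kernel H T κ) (pwLinear (grid T 4) fun l => v l / √T) =
      (∑ l ∈ Finset.univ.filter (fun l : Fin 4 → Fin 4 => l 3 ≤ l 2 ∧ l 2 ≤ l 1 ∧ l 1 ≤ l 0),
        c4 H T κ l * (v (l 0) * v (l 1) * v (l 2) * v (l 3))) / T ^ 2 := by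
  have hc := continuous_kernel hH T κ
  rw [pathIntegral_grid hT (by norm_num) hc]
  have hsq : √T ^ 4 = T ^ 2 := by
    rw [show 4 = 2 * 2 from rfl, pow_mul, Real.sq_sqrt hT.le]
  rw [hsq, Finset.sum_filter]
  congr 1
  refine Finset.sum_congr rfl fun l _ => ?_
  by_cases hl : l 3 ≤ l 2 ∧ l 2 ≤ l 1 ∧ l 1 ≤ l 0
  · rw [if_pos hl, boxIntegral_four hT hc hl.2.2 hl.2.1 hl.1, Fin.prod_univ_four]
    rfl
  · rw [if_neg hl, boxIntegral_eq_zero hT, zero_mul]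
    exact fun h => hl ⟨h (by decide), h (by decide), h (by decide)⟩

/-! ### Double integrals on the grid -/

lemma sum_fin_two_arrow {L : ℕ} (F : Fin L → Fin L → ℝ) :
    ∑ i : Fin 2 → Fin L, F (i 0) (i 1) = ∑ j, ∑ k, F j k := by
  rw [← Fintype.sum_prod_type']
  exact Fintype.sum_equiv (finTwoArrowEquiv _) _ _ fun _ => rfl

lemma boxIntegral_two_eq_c2 {H T : ℝ} (hH : 1 / 2 < H) (hT : 0 < T) {κ : VIndex 2}
    (hκ : (κ 1).val = 1) {i : Fin 2 → Fin 4} (hi : i 1 ≤ i 0) :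
    boxIntegral T (kernel H T κ) (grid T 4) (fun l => i l) = c2 H T (i 0) (i 1) := by
  have hm := (grid_strictMono hT (by norm_num : 4 ≠ 0)).monotone
  have hker : ∀ x y, x ≤ T → y ≤ x → kernel H T κ ![x, y] = ((T - x) * (x - y)) ^ (H - 1 / 2) := by
    intro x y hx hy
    have h0 : (κ 0).val = 0 := by have := (κ 0).isLt; simp at this ⊢
    obtain ⟨w, hw, w0, w1⟩ : ∃ w : ℕ → ℝ,
        (∀ j : Fin 3, Matrix.vecCons T ![x, y] j = w j.val) ∧ w 0 = T ∧ w 1 = x := by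
      refine ⟨fun j => if j = 0 then T else if j = 1 then x else y, fun j => ?_, by simp⟩
      fin_cases j <;> simp
    unfold kernel
    rw [Fin.prod_univ_two, hw, hw]
    simp only [Fin.val_castLE]
    rw [h0, hκ, w0, w1, Real.mul_rpow (by linarith) (by linarith)]
    rfl
  have hle : ∀ j : Fin 4, grid T 4 (j.val + 1) ≤ T := fun j =>
    (hm (Nat.succ_le_of_lt j.isLt)).trans_eq (grid_self T (by norm_num))
  rw [boxIntegral_two hT (continuous_kernel hH T κ) hi]
  unfold c2
  have hs := hm (Nat.le_succ (i 0).val)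
  have hs1 := hm (Nat.le_succ (i 1).val)
  split_ifs with h
  · rw [intervalIntegral.integral_of_le hs, intervalIntegral.integral_of_le hs]
    refine setIntegral_congr_fun measurableSet_Ioc fun x hx => ?_
    simp only [h.symm, min_eq_right hx.2]
    refine intervalIntegral.integral_congr fun y hy => ?_
    rw [Set.uIcc_of_le hx.1.le] at hy
    exact hker x y (hx.2.trans (hle _)) hy.2
  · have hlt : i 1 < i 0 := lt_of_le_of_ne hi (Ne.symm h)
    have hb := hm (Nat.succ_le_of_lt (Fin.lt_def.1 hlt))
    rw [intervalIntegral.integral_of_le hs, intervalIntegral.integral_of_le hs]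
    refine setIntegral_congr_fun measurableSet_Ioc fun x hx => ?_
    simp only [min_eq_left (hb.trans hx.1.le)]
    refine intervalIntegral.integral_congr fun y hy => ?_
    rw [Set.uIcc_of_le hs1] at hy
    exact hker x y (hx.2.trans (hle _)) (hy.2.trans (hb.trans hx.1.le))

lemma pathIntegral_grid_chain {H T : ℝ} (hH : 1 / 2 < H) (hT : 0 < T) {κ : VIndex 2}
    (hκ : (κ 1).val = 1) (v : Fin 4 → ℝ) :
    pathIntegral T (kernel H T κ) (pwLinear (grid T 4) fun l => v l / √T) =
      (∑ l₁ : Fin 4, ∑ l₂ ∈ Finset.univ.filter (fun l₂ : Fin 4 => l₂ ≤ l₁),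
        c2 H T l₁ l₂ * v l₁ * v l₂) / T := by
  rw [pathIntegral_grid hT (by norm_num) (continuous_kernel hH T κ), Real.sq_sqrt hT.le]
  congr 1
  simp_rw [Finset.sum_filter]
  rw [← sum_fin_two_arrow fun l₁ l₂ => if l₂ ≤ l₁ then c2 H T l₁ l₂ * v l₁ * v l₂ else 0]
  refine Finset.sum_congr rfl fun i _ => ?_
  split_ifs with hi
  · rw [boxIntegral_two_eq_c2 hH hT hκ hi, Fin.prod_univ_two, mul_assoc]
  · rw [boxIntegral_eq_zero hT, zero_mul]
    exact fun h => hi (h (by decide))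

/-- The integral of `(T - t) ^ (H - 1 / 2)` over a cell of the grid. -/
noncomputable def cellMass (H T : ℝ) (j : Fin 4) : ℝ :=
  ((T - grid T 4 j) ^ (H + 1 / 2) - (T - grid T 4 (j.val + 1)) ^ (H + 1 / 2)) / (H + 1 / 2)

lemma integral_sub_rpow {H : ℝ} (hH : 1 / 2 < H) (T a b : ℝ) :
    ∫ x in a..b, (T - x) ^ (H - 1 / 2) =
      ((T - a) ^ (H + 1 / 2) - (T - b) ^ (H + 1 / 2)) / (H + 1 / 2) := by
  rw [intervalIntegral.integral_comp_sub_left (fun x => x ^ (H - 1 / 2)) T,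
    integral_rpow (Or.inl (by linarith)), show H - 1 / 2 + 1 = H + 1 / 2 by ring]

lemma boxIntegral_two_eq_cellMass {H T : ℝ} (hH : 1 / 2 < H) (hT : 0 < T) {κ : VIndex 2}
    (hκ : (κ 1).val = 0) {i : Fin 2 → Fin 4} (hi : i 1 ≤ i 0) :
    boxIntegral T (kernel H T κ) (grid T 4) (fun l => i l) =
      if i 0 = i 1 then cellMass H T (i 0) ^ 2 / 2 else
        cellMass H T (i 0) * cellMass H T (i 1) := by
  have hm := (grid_strictMono hT (by norm_num : 4 ≠ 0)).monotone
  have hker : ∀ x y, kernel H T κ ![x, y] = (T - x) ^ (H - 1 / 2) * (T - y) ^ (H - 1 / 2) := by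
    intro x y
    have h0 : (κ 0).val = 0 := by have := (κ 0).isLt; simp at this ⊢
    obtain ⟨w, hw, w0⟩ : ∃ w : ℕ → ℝ,
        (∀ j : Fin 3, Matrix.vecCons T ![x, y] j = w j.val) ∧ w 0 = T := by
      refine ⟨fun j => if j = 0 then T else if j = 1 then x else y, fun j => ?_, by simp⟩
      fin_cases j <;> simp
    unfold kernel
    rw [Fin.prod_univ_two, hw, hw]
    simp only [Fin.val_castLE]
    rw [h0, hκ, w0]
    rfl
  rw [boxIntegral_two hT (continuous_kernel hH T κ) hi]
  simp_rw [hker, intervalIntegral.integral_const_mul, integral_sub_rpow hH]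
  have hs := hm (Nat.le_succ (i 0).val)
  split_ifs with h
  -- `U x` is the kernel mass from the left end of the cell to `x`. The integrand on the diagonal
  -- cell is `U' U`, with antiderivative `U² / 2`.
  · let U : ℝ → ℝ := fun x =>
      ((T - grid T 4 (i 0)) ^ (H + 1 / 2) - (T - x) ^ (H + 1 / 2)) / (H + 1 / 2)
    have hU : ∀ x, HasDerivAt U ((T - x) ^ (H - 1 / 2)) x := by
      intro x
      have h1 := (((hasDerivAt_id x).const_sub T).rpow_const (p := H + 1 / 2)
        (Or.inr (by linarith))).const_sub ((T - grid T 4 (i 0)) ^ (H + 1 / 2))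
      have h2 := h1.div_const (H + 1 / 2)
      refine h2.congr_deriv ?_
      have h3 : H + 1 / 2 ≠ 0 := by linarith
      have h4 : H + 1 / 2 - 1 = H - 1 / 2 := by ring
      rw [h4, id]
      field_simp
    have hU2 : ∀ x, HasDerivAt (fun x => U x ^ 2 / 2) ((T - x) ^ (H - 1 / 2) * U x) x := by
      intro x
      refine (((hU x).pow 2).div_const 2).congr_deriv ?_
      norm_num
      ring
    have hcont : Continuous fun x => (T - x) ^ (H - 1 / 2) * U x := by
      refine Continuous.mul ?_ ?_
      · exact (continuous_const.sub continuous_id).rpow_const fun _ => Or.inr (by linarith)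
      · exact (continuous_const.sub ((continuous_const.sub continuous_id).rpow_const
          fun _ => Or.inr (by linarith))).div_const _
    have h5 : ∫ x in grid T 4 (i 0)..grid T 4 ((i 0).val + 1), (T - x) ^ (H - 1 / 2) * U x =
        cellMass H T (i 0) ^ 2 / 2 := by
      rw [intervalIntegral.integral_eq_sub_of_hasDerivAt (fun x _ => hU2 x)
        (hcont.intervalIntegrable _ _)]
      simp [U, cellMass]
    rw [← h5, intervalIntegral.integral_of_le hs, intervalIntegral.integral_of_le hs]
    refine setIntegral_congr_fun measurableSet_Ioc fun x hx => ?_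
    simp only [← h, min_eq_right hx.2]
    rfl
  · have hlt : i 1 < i 0 := lt_of_le_of_ne hi (Ne.symm h)
    have hb := hm (Nat.succ_le_of_lt (Fin.lt_def.1 hlt))
    have h5 : ∫ x in grid T 4 (i 0)..grid T 4 ((i 0).val + 1),
        (T - x) ^ (H - 1 / 2) * cellMass H T (i 1) = cellMass H T (i 0) * cellMass H T (i 1) := by
      rw [intervalIntegral.integral_mul_const, integral_sub_rpow hH]
      rfl
    rw [← h5, intervalIntegral.integral_of_le hs, intervalIntegral.integral_of_le hs]
    refine setIntegral_congr_fun measurableSet_Ioc fun x hx => ?_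
    simp only [min_eq_left (hb.trans hx.1.le)]
    rfl

/-- Half squares on the diagonal and cross terms below it add up to half the square of the sum. This
symmetry is why the second equation is a square, while the third, with kernel `(T - t₁)(t₁ - t₂)`,
is a general quadratic form. -/
lemma pathIntegral_grid_square {H T : ℝ} (hH : 1 / 2 < H) (hT : 0 < T) {κ : VIndex 2}
    (hκ : (κ 1).val = 0) (v : Fin 4 → ℝ) :
    pathIntegral T (kernel H T κ) (pwLinear (grid T 4) fun l => v l / √T) =
      (∑ l, cellMass H T l * v l) ^ 2 / (2 * T) := by
  rw [pathIntegral_grid hT (by norm_num) (continuous_kernel hH T κ), Real.sq_sqrt hT.le,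
    ← div_div]
  congr 1
  let g := cellMass H T
  let F : Fin 4 → Fin 4 → ℝ := fun l₁ l₂ => if l₂ ≤ l₁ then
    (if l₁ = l₂ then g l₁ ^ 2 / 2 else g l₁ * g l₂) * (v l₁ * v l₂) else 0
  have h1 : ∑ i : Fin 2 → Fin 4, boxIntegral T (kernel H T κ) (grid T 4) (fun l => i l) *
      ∏ l, v (i l) = ∑ i : Fin 2 → Fin 4, F (i 0) (i 1) := by
    refine Finset.sum_congr rfl fun i _ => ?_
    simp only [F]
    split_ifs with hi hi'
    · rw [boxIntegral_two_eq_cellMass hH hT hκ hi, if_pos hi', Fin.prod_univ_two]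
    · rw [boxIntegral_two_eq_cellMass hH hT hκ hi, if_neg hi', Fin.prod_univ_two]
    · rw [boxIntegral_eq_zero hT, zero_mul]
      exact fun h => hi (h (by decide))
  rw [h1, sum_fin_two_arrow]
  change _ = (∑ l, g l * v l) ^ 2 / 2
  simp only [F, Fin.sum_univ_four]
  simp [Fin.le_def]
  ring

/-! ### Collecting terms by coefficient functions -/

/-- The coefficient depends on `κ` only through the number of zeros and the multiset of the other
multiplicities, data that a finite computation can compare. -/
lemma coeff_apply_eq_multiset_prod (G V : ℝ → ℝ) {n : ℕ} (κ : VIndex n) (x : ℝ) :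
    coeff G V κ x = iteratedDeriv (occ κ 0) G x *
      (((Finset.Icc 1 n).val.map (occ κ)).map fun j => iteratedDeriv j V x).prod := by
  rw [Multiset.map_map]
  rfl

lemma coeff_eq_evenCoeffs_two (G V : ℝ → ℝ) (κ : VIndex 2) :
    coeff G V κ = evenCoeffs G V (if (κ 1).val = 0 then 0 else 1) := by
  have h : ∀ κ : VIndex 2, if (κ 1).val = 0
      then occ κ 0 = 2 ∧ (Finset.Icc 1 2).val.map (occ κ) = {0, 0}
      else occ κ 0 = 1 ∧ (Finset.Icc 1 2).val.map (occ κ) = {1, 0} := by decide +kernel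
  have hκ := h κ
  ext x
  rw [coeff_apply_eq_multiset_prod]
  split_ifs at hκ ⊢
  all_goals
    rw [hκ.1, hκ.2]
    simp [evenCoeffs, -mul_eq_mul_left_iff, -mul_eq_mul_right_iff]
    try ring

lemma coeff_eq_evenCoeffs_four (G V : ℝ → ℝ) {α : Fin 7} {κ : VIndex 4} (hκ : κ ∈ S4 α) :
    coeff G V κ = evenCoeffs G V (Fin.natAdd 2 α) := by
  have h : ∀ α : Fin 7, ∀ κ ∈ S4 α, (occ κ 0, (Finset.Icc 1 4).val.map (occ κ)) =
      (![(4, {0, 0, 0, 0}), (3, {1, 0, 0, 0}), (2, {2, 0, 0, 0}), (2, {1, 1, 0, 0}),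
        (1, {3, 0, 0, 0}), (1, {2, 1, 0, 0}), (1, {1, 1, 1, 0})] : Fin 7 → ℕ × Multiset ℕ) α := by
    decide +kernel
  have h' := Prod.ext_iff.1 (h α κ hκ)
  simp only at h'
  ext x
  rw [coeff_apply_eq_multiset_prod, h'.1, h'.2]
  fin_cases α <;> simp [evenCoeffs, -mul_eq_mul_left_iff, -mul_eq_mul_right_iff] <;> ring

/-- The sums of `D` over the classes of indices with the coefficient functions `evenCoeffs`. -/
noncomputable def classSum (D : (n : ℕ) → VIndex n → ℝ) : Fin 9 → ℝ :=
  Fin.append (m := 2) (n := 7)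
    (fun j => ∑ κ ∈ Finset.univ.filter fun κ : VIndex 2 => (κ 1).val = j.val, D 2 κ)
    (fun α => ∑ κ ∈ S4 α, D 4 κ)

lemma sum_eq_sum_S4 (f : VIndex 4 → ℝ) : ∑ κ, f κ = ∑ α, ∑ κ ∈ S4 α, f κ := by
  have hu : (Finset.univ : Finset (VIndex 4)) = Finset.univ.biUnion S4 := by decide +kernel
  have hd : ∀ α β : Fin 7, α ≠ β → Disjoint (S4 α) (S4 β) := by decide +kernel
  rw [hu, Finset.sum_biUnion fun α _ β _ h => hd α β h]

-- No distinctness is required: if some of the nine functions coincide, their class sums are simply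
-- added. This is what makes the sufficiency of the equations unconditional.
open Classical in
lemma collect_eq_sum_classSum (G V φ : ℝ → ℝ) {D : (n : ℕ) → VIndex n → ℝ}
    (hodd : ∀ n ∈ Finset.Icc 1 5, Odd n → ∀ κ, D n κ = 0) :
    collect 5 G V φ D = ∑ j, if evenCoeffs G V j = φ then classSum D j else 0 := by
  have hI : Finset.Icc 1 5 = {1, 2, 3, 4, 5} := by decide
  have hz : ∀ n ∈ Finset.Icc 1 5, Odd n →
      ∑ κ : VIndex n, (if coeff G V κ = φ then D n κ else 0) = 0 := fun n hn ho =>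
    Finset.sum_eq_zero fun κ _ => by rw [hodd n hn ho κ, ite_self]
  unfold collect
  rw [hI, Finset.sum_insert (by decide), Finset.sum_insert (by decide),
    Finset.sum_insert (by decide), Finset.sum_insert (by decide), Finset.sum_singleton,
    hz 1 (by decide) (by decide), hz 3 (by decide) (by decide), hz 5 (by decide) (by decide),
    zero_add, zero_add, add_zero, sum_eq_sum_S4]
  rw [Fin.sum_univ_add (a := 2) (b := 7)]
  congr 1
  · have hmaps : ∀ κ ∈ (Finset.univ : Finset (VIndex 2)), κ 1 ∈ (Finset.univ : Finset (Fin 2)) :=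
      fun κ _ => Finset.mem_univ _
    rw [← Finset.sum_fiberwise_of_maps_to hmaps]
    refine Finset.sum_congr rfl fun j _ => ?_
    have h1 : classSum D (Fin.castAdd 7 j) =
        ∑ κ ∈ Finset.univ.filter fun κ : VIndex 2 => (κ 1).val = j.val, D 2 κ :=
      Fin.append_left _ _ _
    have hfil : (Finset.univ.filter fun κ : VIndex 2 => κ 1 = j) =
        Finset.univ.filter fun κ : VIndex 2 => (κ 1).val = j.val :=
      Finset.filter_congr fun κ _ => Fin.ext_iff
    have hc : ∀ κ ∈ Finset.univ.filter fun κ : VIndex 2 => (κ 1).val = j.val,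
        coeff G V κ = evenCoeffs G V (Fin.castAdd 7 j) := by
      intro κ hκ
      rw [coeff_eq_evenCoeffs_two, (Finset.mem_filter.1 hκ).2]
      fin_cases j <;> rfl
    rw [hfil, h1, Finset.sum_congr rfl fun κ hκ => by rw [hc κ hκ]]
    split_ifs <;> simp
  · refine Finset.sum_congr rfl fun α _ => ?_
    have h1 : classSum D (Fin.natAdd 2 α) = ∑ κ ∈ S4 α, D 4 κ := Fin.append_right _ _ _
    rw [h1, Finset.sum_congr rfl fun κ hκ => by rw [coeff_eq_evenCoeffs_four G V hκ]]
    split_ifs <;> simp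

lemma evenCoeffs_mem_coeffSet (G V : ℝ → ℝ) (j : Fin 9) : evenCoeffs G V j ∈ coeffSet 5 G V := by
  refine Fin.addCases (m := 2) (n := 7) (fun j => ?_) (fun α => ?_) j
  · have h : ∀ j : Fin 2, ∃ κ : VIndex 2, (if (κ 1).val = 0 then (0 : Fin 9) else 1) =
        Fin.castAdd 7 j := by decide +kernel
    obtain ⟨κ, hκ⟩ := h j
    exact ⟨2, by decide, κ, by rw [coeff_eq_evenCoeffs_two, hκ]⟩
  · have h : ∀ α : Fin 7, (S4 α).Nonempty := by decide +kernel
    obtain ⟨κ, hκ⟩ := h α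
    exact ⟨4, by decide, κ, coeff_eq_evenCoeffs_four G V hκ⟩

/-! ### The defect, its class sums and the polynomial system -/

section Equations

variable {Ω : Type*} [MeasurableSpace Ω] {P : Measure Ω} {B : ℝ≥0 → Ω → ℝ} {H T : ℝ}

/-- The difference of the expectations of an iterated integral under the cubature measure and
under the Wiener measure. -/
noncomputable def defect (P : Measure Ω) (B : ℝ≥0 → Ω → ℝ) (H T : ℝ) (lam : Fin 2 → ℝ)
    (a : Fin 2 → Fin 4 → ℝ) (n : ℕ) (κ : VIndex n) : ℝ :=
  ∑ k, weights lam k * pathIntegral T (kernel H T κ) (paths T a k) -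
    ∫ ω, stratonovich P B T (kernel H T κ) ω ∂P

/-- Collecting is linear, and each Stratonovich integral is integrable, so expectation and the sum
over paths both pass inside. -/
lemma collect_defect (hB : IsPreBrownianReal B P) (hH : 1 / 2 < H) (hT : 0 < T) (G V φ : ℝ → ℝ)
    (lam : Fin 2 → ℝ) (a : Fin 2 → Fin 4 → ℝ) :
    ∑ k, weights lam k *
        collect 5 G V φ (fun _ κ => pathIntegral T (kernel H T κ) (paths T a k)) -
      ∫ ω, collect 5 G V φ (fun _ κ => stratonovich P B T (kernel H T κ) ω) ∂P =
      collect 5 G V φ (defect P B H T lam a) := by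
  classical
  have : IsProbabilityMeasure P := hB.isGaussianProcess.isProbabilityMeasure
  have hint : ∀ (n : ℕ) (κ : VIndex n), Integrable (fun ω =>
      if coeff G V κ = φ then stratonovich P B T (kernel H T κ) ω else 0) P := by
    intro n κ
    split_ifs
    · exact (isStratonovichIntegral_stratonovich hB hT
        (continuous_kernel hH T κ)).1.integrable one_le_two
    · exact integrable_zero _ _ _
  have h1 : ∫ ω, collect 5 G V φ (fun _ κ => stratonovich P B T (kernel H T κ) ω) ∂P =
      collect 5 G V φ (fun _ κ => ∫ ω, stratonovich P B T (kernel H T κ) ω ∂P) := by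
    unfold collect
    rw [integral_finsetSum _ fun n _ => integrable_finsetSum _ fun κ _ => hint n κ]
    refine Finset.sum_congr rfl fun n _ => ?_
    rw [integral_finsetSum _ fun κ _ => hint n κ]
    refine Finset.sum_congr rfl fun κ _ => ?_
    split_ifs <;> simp
  have h2 : ∑ k, weights lam k *
      collect 5 G V φ (fun _ κ => pathIntegral T (kernel H T κ) (paths T a k)) =
      collect 5 G V φ (fun _ κ =>
        ∑ k, weights lam k * pathIntegral T (kernel H T κ) (paths T a k)) := by
    unfold collect
    simp_rw [Finset.mul_sum]
    rw [Finset.sum_comm]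
    refine Finset.sum_congr rfl fun n _ => ?_
    rw [Finset.sum_comm]
    refine Finset.sum_congr rfl fun κ _ => ?_
    split_ifs <;> simp
  rw [h1, h2]
  unfold collect
  rw [← Finset.sum_sub_distrib]
  refine Finset.sum_congr rfl fun n _ => ?_
  rw [← Finset.sum_sub_distrib]
  refine Finset.sum_congr rfl fun κ _ => ?_
  split_ifs
  · rfl
  · simp

lemma defect_of_odd (hB : IsPreBrownianReal B P) (hH : 1 / 2 < H) (hT : 0 < T) (lam : Fin 2 → ℝ)
    (a : Fin 2 → Fin 4 → ℝ) {n : ℕ} (hn : Odd n) (κ : VIndex n) : defect P B H T lam a n κ = 0 := by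
  have hc := continuous_kernel hH T κ
  rw [defect, sum_weights_paths, hn.neg_one_pow, integral_eq_zero_of_odd hB hT hc
    (isStratonovichIntegral_stratonovich hB hT hc) hn]
  simp

/-- The class consists of the single index `(0, 0)`; the path integral is half a square, and the
factor `2` from the symmetric paths cancels the half. -/
lemma classSum_defect_zero (hB : IsPreBrownianReal B P) (hH : 1 / 2 < H) (hT : 0 < T)
    (lam : Fin 2 → ℝ) (a : Fin 2 → Fin 4 → ℝ) :
    classSum (defect P B H T lam a) 0 = 1 / ((H + 1 / 2) ^ 2 * T) *
      ∑ k, lam k * (∑ l : Fin 4,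
        ((T - grid T 4 l) ^ (H + 1 / 2) - (T - grid T 4 (l.val + 1)) ^ (H + 1 / 2)) * a k l) ^ 2 -
      T ^ (2 * H) / (4 * H) := by
  let κ : VIndex 2 := fun _ => 0
  have hf : (Finset.univ.filter fun κ : VIndex 2 => (κ 1).val = (0 : Fin 2).val) = {κ} := by
    decide +kernel
  have h1 : classSum (defect P B H T lam a) 0 =
      ∑ κ ∈ Finset.univ.filter fun κ : VIndex 2 => (κ 1).val = (0 : Fin 2).val,
        defect P B H T lam a 2 κ := Fin.append_left (m := 2) (n := 7) _ _ 0
  have hκ : (κ 1).val = 0 := rfl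
  rw [h1, hf, Finset.sum_singleton, defect, sum_weights_paths,
    integral_stratonovich_kernel_two hB hH hT, if_pos hκ]
  congr 1
  simp_rw [pathIntegral_grid_square hH hT hκ]
  rw [Finset.mul_sum, Finset.mul_sum]
  refine Finset.sum_congr rfl fun k _ => ?_
  have h2 : ∑ l, cellMass H T l * a k l = (∑ l : Fin 4,
      ((T - grid T 4 l) ^ (H + 1 / 2) - (T - grid T 4 (l.val + 1)) ^ (H + 1 / 2)) * a k l) /
        (H + 1 / 2) := by
    rw [Finset.sum_div]
    refine Finset.sum_congr rfl fun l _ => ?_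
    unfold cellMass
    ring
  rw [h2]
  have : H + 1 / 2 ≠ 0 := by linarith
  field_simp
  ring

lemma classSum_defect_one (hB : IsPreBrownianReal B P) (hH : 1 / 2 < H) (hT : 0 < T)
    (lam : Fin 2 → ℝ) (a : Fin 2 → Fin 4 → ℝ) :
    classSum (defect P B H T lam a) 1 = 2 / T *
      ∑ k, lam k * ∑ l₁ : Fin 4, ∑ l₂ ∈ Finset.univ.filter (fun l₂ : Fin 4 => l₂ ≤ l₁),
        c2 H T l₁ l₂ * a k l₁ * a k l₂ := by
  let κ : VIndex 2 := fun l => Fin.last l.val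
  have hf : (Finset.univ.filter fun κ : VIndex 2 => (κ 1).val = (1 : Fin 2).val) = {κ} := by
    decide +kernel
  have h1 : classSum (defect P B H T lam a) 1 =
      ∑ κ ∈ Finset.univ.filter fun κ : VIndex 2 => (κ 1).val = (1 : Fin 2).val,
        defect P B H T lam a 2 κ := Fin.append_left (m := 2) (n := 7) _ _ 1
  have hκ : (κ 1).val = 1 := rfl
  rw [h1, hf, Finset.sum_singleton, defect, sum_weights_paths,
    integral_stratonovich_kernel_two hB hH hT, if_neg (by rw [hκ]; decide), sub_zero]
  simp_rw [pathIntegral_grid_chain hH hT hκ]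
  rw [Finset.mul_sum, Finset.mul_sum]
  refine Finset.sum_congr rfl fun k _ => ?_
  ring

lemma classSum_defect_natAdd (hB : IsPreBrownianReal B P) (hH : 1 / 2 < H) (hT : 0 < T)
    (lam : Fin 2 → ℝ) (a : Fin 2 → Fin 4 → ℝ) (α : Fin 7) :
    classSum (defect P B H T lam a) (Fin.natAdd 2 α) =
      2 / T ^ 2 * ∑ l ∈ Finset.univ.filter
          (fun l : Fin 4 → Fin 4 => l 3 ≤ l 2 ∧ l 2 ≤ l 1 ∧ l 1 ≤ l 0),
        ∑ κ ∈ S4 α, ∑ k, lam k * c4 H T κ l * a k (l 0) * a k (l 1) * a k (l 2) * a k (l 3) -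
      gam H T α := by
  have h1 : classSum (defect P B H T lam a) (Fin.natAdd 2 α) =
      ∑ κ ∈ S4 α, defect P B H T lam a 4 κ := Fin.append_right _ _ _
  rw [h1, ← sum_pairMoment hH α]
  simp_rw [defect, integral_stratonovich_kernel_four hB hH hT, sum_weights_paths,
    pathIntegral_grid_four hH hT]
  rw [Finset.sum_sub_distrib]
  congr 1
  rw [Finset.sum_comm, Finset.mul_sum]
  refine Finset.sum_congr rfl fun κ _ => ?_
  rw [Finset.sum_comm, Finset.mul_sum, Finset.mul_sum]
  refine Finset.sum_congr rfl fun k _ => ?_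
  rw [Finset.sum_div, Finset.mul_sum, Finset.mul_sum, Finset.mul_sum]
  exact Finset.sum_congr rfl fun l _ => by ring

lemma cubatureEquations_iff (hB : IsPreBrownianReal B P) (hH : 1 / 2 < H) (hT : 0 < T)
    (lam : Fin 2 → ℝ) (a : Fin 2 → Fin 4 → ℝ) :
    CubatureEquations H T lam a ↔
      lam 0 + lam 1 = 1 / 2 ∧ ∀ j, classSum (defect P B H T lam a) j = 0 := by
  constructor
  · intro h
    refine ⟨h.mass, Fin.addCases (m := 2) (n := 7) (fun j => ?_) fun α => ?_⟩
    · fin_cases j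
      · exact (classSum_defect_zero hB hH hT lam a).trans (sub_eq_zero.2 h.second)
      · refine (classSum_defect_one hB hH hT lam a).trans ?_
        rw [h.third, mul_zero]
    · exact (classSum_defect_natAdd hB hH hT lam a α).trans (sub_eq_zero.2 (h.fourth α))
  · rintro ⟨hm, h⟩
    refine ⟨hm, ?_, ?_, fun α => ?_⟩
    · exact sub_eq_zero.1 ((classSum_defect_zero hB hH hT lam a).symm.trans (h 0))
    · have h1 := (classSum_defect_one hB hH hT lam a).symm.trans (h 1)
      -- The third equation is stated without the factor `2 / T`, which is cancelled here.
      exact (mul_eq_zero.1 h1).resolve_left (by positivity)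
    · exact sub_eq_zero.1 ((classSum_defect_natAdd hB hH hT lam a α).symm.trans (h _))

lemma sum_weights (lam : Fin 2 → ℝ) : ∑ k, weights lam k = 2 * (lam 0 + lam 1) := by
  rw [Fin.sum_univ_add]
  simp only [weights, Fin.append_left, Fin.append_right, Fin.sum_univ_two]
  ring

lemma weights_pos {lam : Fin 2 → ℝ} (hlam : ∀ k, 0 < lam k) (k : Fin (2 + 2)) :
    0 < weights lam k := by
  refine Fin.addCases (fun i => ?_) (fun i => ?_) k
  · rw [weights, Fin.append_left]
    exact hlam i
  · rw [weights, Fin.append_right]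
    exact hlam i

open Classical in
lemma collect_defect_eq (hB : IsPreBrownianReal B P) (hH : 1 / 2 < H) (hT : 0 < T)
    (G V φ : ℝ → ℝ) (lam : Fin 2 → ℝ) (a : Fin 2 → Fin 4 → ℝ) :
    collect 5 G V φ (defect P B H T lam a) =
      ∑ j, if evenCoeffs G V j = φ then classSum (defect P B H T lam a) j else 0 := by
  exact collect_eq_sum_classSum G V φ fun n _ hn κ => defect_of_odd hB hH hT lam a hn κ

lemma isVolterraCubature_of_equations (hB : IsPreBrownianReal B P) (hH : 1 / 2 < H) (hT : 0 < T)
    (G V : ℝ → ℝ) {lam : Fin 2 → ℝ} (hlam : ∀ k, 0 < lam k) {a : Fin 2 → Fin 4 → ℝ}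
    (h : CubatureEquations H T lam a) : IsVolterraCubature P B H T G V 5 lam a := by
  classical
  obtain ⟨hm, hz⟩ := (cubatureEquations_iff hB hH hT lam a).1 h
  refine ⟨weights_pos hlam, by rw [sum_weights, hm]; norm_num, fun φ _ => ?_⟩
  rw [← sub_eq_zero, collect_defect hB hH hT, collect_defect_eq hB hH hT]
  simp [hz]

/-- Testing with the `j`-th of the nine functions, the collected sum contains by injectivity only
the `j`-th class sum, which must therefore vanish. -/
lemma equations_of_isVolterraCubature (hB : IsPreBrownianReal B P) (hH : 1 / 2 < H) (hT : 0 < T)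
    {G V : ℝ → ℝ} (hinj : Function.Injective (evenCoeffs G V)) {lam : Fin 2 → ℝ}
    {a : Fin 2 → Fin 4 → ℝ} (h : IsVolterraCubature P B H T G V 5 lam a) :
    CubatureEquations H T lam a := by
  classical
  refine (cubatureEquations_iff hB hH hT lam a).2 ⟨?_, fun j => ?_⟩
  · have := h.sum_eq_one
    rw [sum_weights] at this
    linarith
  · have h1 := sub_eq_zero.2 (h.moments _ (evenCoeffs_mem_coeffSet G V j))
    rw [collect_defect hB hH hT, collect_defect_eq hB hH hT] at h1
    simpa [hinj.eq_iff] using h1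

end Equations

end VolterraCubature

theorem theorem5p3 {Ω : Type*} [MeasurableSpace Ω] (P : Measure Ω) (B : ℝ≥0 → Ω → ℝ)
    (hB : IsBrownianReal B P) (H T : ℝ) (hH : 1 / 2 < H) (hT : 0 < T)
    (G V : ℝ → ℝ) (hG : ContDiff ℝ 5 G) (hV : ContDiff ℝ 4 V)
    (lam : Fin 2 → ℝ) (hlam : ∀ k, 0 < lam k) (a : Fin 2 → Fin 4 → ℝ) :
    (∀ n ∈ Finset.Icc 1 5, ∀ κ : VIndex n,
      IsStratonovichIntegral P B T (kernel H T κ) (stratonovich P B T (kernel H T κ))) ∧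
    (Function.Injective (evenCoeffs G V) →
      (IsVolterraCubature P B H T G V 5 lam a ↔ CubatureEquations H T lam a)) ∧
    (CubatureEquations H T lam a → IsVolterraCubature P B H T G V 5 lam a) := by
  have hB' := hB.toIsPreBrownianReal
  exact ⟨fun n _ κ => isStratonovichIntegral_stratonovich hB' hT (continuous_kernel hH T κ),
    fun hinj => ⟨equations_of_isVolterraCubature hB' hH hT hinj,
      isVolterraCubature_of_equations hB' hH hT G V hlam⟩,
    isVolterraCubature_of_equations hB' hH hT G V hlam⟩
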